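/- Let $L$ be an even non-degenerate lattice with quadratic form $q$ (so $(x,x)=2q(x)$), dual lattice $L'$, discriminant group $D=L'/L$, signature $\mathrm{sig}=b^+-b^-$, and level $N=\mathrm{level}(L)$, the least positive integer with $N q(x)\in\mathbb Z$ for all $x\in L'$. Write $e(z)=e^{2\pi i z}$. Let $2\le k\in\tfrac12\mathbb Z$ and let $f:\mathbb H\to\mathbb C[D]$ be a cusp form of weight $k$ for the Weil representation $\rho$ of $\mathrm{Mp}_2(\mathbb Z)$ on $\mathbb C[D]$, given by $\rho(T)\mathfrak e_\mu=e(q(\mu))\mathfrak e_\mu$ and $\rho(S)\mathfrak e_\mu=\frac{e(-\mathrm{sig}/8)}{\sqrt{|D|}}\sum_{\nu\in D}e(-(\mu,\nu))\mathfrak e_\nu$, with Fourier expansion $$f(\tau)=\sum_{\mu\in D}\ \sum_{n\in q(\mu)+\mathbb Z}a(\mu,n)\,e(n\tau)\,\mathfrak e_\mu .$$ For a prime $p\nmid N$ let $T(p^2)$ be the Hecke operator $f\mapsto p^{k-2}\sum_\delta f|\delta$, where $\delta$ runs through $\Gamma\backslash\Gamma\alpha\Gamma$ with $\Gamma=\mathrm{Mp}_2(\mathbb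 Z)$, $\alpha=\left(\left(\begin{smallmatrix}p^2&0\\0&1\end{smallmatrix}\right),p^{-1/2}\right)$, $(f|\alpha)(\tau)=p^k\sum_{\mu}f_\mu(p^2\tau)\,\mathfrak e_{p\mu}$, and $f|\alpha\gamma=(f|\alpha)|\gamma$ for $\gamma\in\Gamma$, where $\Gamma$ acts by $(g|(\gamma,\phi))(\tau)=\phi(\tau)^{-2k}\rho(\gamma,\phi)^{-1}g(\gamma\tau)$. Assume that $f\ne0$ and that $f$ is an eigenform of $T(p^2)$ with eigenvalue $\Lambda_p$ for all primes $p\nmid N$. Put $G_D(d)=\sum_{\mu\in D}e(d\,q(\mu))$ and, for odd $p$, $\chi_D(p)=\epsilon_p^{\mathrm{sig}+\left(\frac{-1}{|D|}\right)}\left(\frac{p}{|D|\,2^{\mathrm{sig}}}\right)$, where the symbols are Kronecker symbols (multiplicative also in negative powers of $2$) and $\epsilon_p=1$ for $p\equiv1$, $\epsilon_p=i$ for $p\equiv3\pmod 4$. Let $\lambda\in D$ and $t\in q(\lambda)+\mathbb Z$ be such that $p^2\nmid N t$ for all primes $p\nmid N$. For primes $p\nmid N$ put $$Q_p(s)=\begin{cases}\dfrac{1+\delta_{p\nmid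 t}\,\frac{G_D(1)}{G_D(p)}\,p^{k-1-s}}{1-\left(\frac{\Lambda_p}{p^{k-1}}-(1-p^{-1})\frac{G_D(1)}{G_D(p)}\right)p^{k-1-s}+p^{2(k-1-s)}},&2\mid\mathrm{rk}(L),\\[3ex]\dfrac{1-\chi_D(p)\left(\frac{-t}{p}\right)p^{-1/2}\,p^{k-1-s}}{1-\frac{\Lambda_p}{p^{k-1}}\,p^{k-1-s}+p^{2(k-1-s)}},&2\nmid\mathrm{rk}(L),\end{cases}$$ where $p\nmid t$ means that $p$ does not divide the numerator of the rational number $t$. Then for all $s\in\mathbb C$ with $\mathrm{Re}(s)>k+1$: the series $L_{(\lambda,t)}(f,s)=\sum_{n\ge1}a(n\lambda,n^2t)\,n^{-s}$ converges absolutely; the denominators of all $Q_p(s)$ are nonzero; the product $\prod_{p\nmid N}Q_p(s)$ converges absolutely, in the sense that $\sum_{p\nmid N}|Q_p(s)-1|<\infty$, and its value is nonzero; and $$L_{(\lambda,t)}(f,s)=\Bigg(\sum_{\substack{n\ge1\\ n\mid N^\infty}}\frac{a(n\lambda,n^2t)}{n^s}\Bigg)\cdot\prod_{p\nmid N}Q_p(s).$$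 -/

import Mathlib

open UpperHalfPlane (IsZeroAtImInfty ofComplex)
open scoped UpperHalfPlane
open scoped Manifold

noncomputable section

/-! ### Even lattices and discriminant forms -/

/-- An even non-degenerate `ℤ`-lattice: a finitely generated subgroup `L` spanning a rational
quadratic space `(V, q)`, with `q` non-degenerate and integral on `L`. The bilinear form is
`(x, y) = q (x + y) - q x - q y`, so that `(x, x) = 2 q x`. -/
structure EvenLattice (V : Type*) [AddCommGroup V] [Module ℚ V] where
  q : QuadraticForm ℚ V
  nondegenerate : q.polarBilin.Nondegenerate
  lattice : Submodule ℤ V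
  fg : lattice.FG
  span_eq_top : Submodule.span ℚ (lattice : Set V) = ⊤
  even : ∀ x ∈ lattice, ∃ m : ℤ, q x = m

namespace EvenLattice

variable {V : Type*} [AddCommGroup V] [Module ℚ V] (L : EvenLattice V)

/-- The dual lattice `L' = {x ∈ V : (x, y) ∈ ℤ for all y ∈ L}`. -/
def dual : Submodule ℤ V :=
  LinearMap.BilinForm.dualSubmodule L.q.polarBilin L.lattice

/-- The discriminant group `D = L' / L`. -/
abbrev Disc : Type _ := L.dual ⧸ L.lattice.submoduleOf L.dual

/-- The rank of `L`. -/
def rank (_L : EvenLattice V) : ℕ := Module.finrank ℚ V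

/-- The signature `b⁺ - b⁻` of `L`. -/
def sig : ℤ := (sigPos L.q : ℤ) - (sigNeg L.q : ℤ)

/-- The level of `L`: the least positive `N` with `N q(x) ∈ ℤ` for all `x ∈ L'`. -/
def level : ℕ := sInf {N : ℕ | 0 < N ∧ ∀ x ∈ L.dual, ∃ m : ℤ, (N : ℚ) * L.q x = m}

/-- A representative in `L'` of a class in `D`. -/
def rep (μ : L.Disc) : V := ((Quotient.out μ : L.dual) : V)

/-- A rational representative of `q(μ) ∈ ℚ / ℤ` for `μ ∈ D`. -/
def qD (μ : L.Disc) : ℚ := L.q (L.rep μ)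

/-- A rational representative of `(μ, ν) ∈ ℚ / ℤ` for `μ, ν ∈ D`. -/
def bD (μ ν : L.Disc) : ℚ := L.q.polarBilin (L.rep μ) (L.rep ν)

/-- The coset `q(μ) + ℤ` of rational numbers. -/
def qCoset (μ : L.Disc) : Set ℚ := {n | ∃ m : ℤ, n = L.qD μ + m}

theorem rep_sub_mem (x : L.dual) :
    (x : V) - L.rep (Submodule.Quotient.mk x) ∈ L.lattice := by
  have h : (Submodule.Quotient.mk (Quotient.out (Submodule.Quotient.mk x : L.Disc)) : L.Disc)
      = Submodule.Quotient.mk x := Quotient.out_eq _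
  have h2 := (Submodule.Quotient.eq _).1 h.symm
  simpa [Submodule.submoduleOf, rep] using h2

/-- `qD` induces the reduction of `q` modulo `ℤ`, whatever representatives are used. -/
theorem mem_qCoset (x : L.dual) : L.q (x : V) ∈ L.qCoset (Submodule.Quotient.mk x) := by
  set r := L.rep (Submodule.Quotient.mk x) with hr
  have h := L.rep_sub_mem x
  obtain ⟨a, ha⟩ := L.even _ h
  have hrd : r ∈ L.dual := (Quotient.out (Submodule.Quotient.mk x : L.Disc)).2
  obtain ⟨b, hb⟩ := Submodule.mem_one.mp (hrd _ h)
  refine ⟨a + b, ?_⟩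
  have e : (x : V) = r + ((x : V) - r) := by abel
  have hp : L.q (r + ((x : V) - r)) = L.q r + L.q ((x : V) - r)
      + L.q.polarBilin r ((x : V) - r) := by
    rw [QuadraticMap.polarBilin_apply_apply, QuadraticMap.polar]; ring
  rw [← hr] at ha
  rw [e, hp, ha]
  have hb' : L.q.polarBilin r ((x : V) - r) = (b : ℚ) := by
    rw [← hb]; simp
  rw [hb', qD, ← hr]
  push_cast
  ring

instance : Finite L.Disc := by
  classical
  have hs : ⊤ ≤ Submodule.span ℚ (L.lattice : Set V) := L.span_eq_top.ge
  obtain ⟨S, hS⟩ := L.fg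
  have hfin : Module.Finite ℚ V := by
    refine ⟨⟨S, ?_⟩⟩
    rw [← top_le_iff, ← L.span_eq_top, Submodule.span_le, ← hS]
    exact Submodule.span_le_restrictScalars ℤ ℚ _
  let b := Module.Basis.ofSpan hs
  have hb : ∀ i, b i ∈ L.lattice := fun i => Module.Basis.ofSpan_subset hs ⟨i, rfl⟩
  have : Finite _ := Module.Finite.finite_basis b
  have hM : Submodule.span ℤ (Set.range b) ≤ L.lattice :=
    Submodule.span_le.2 (by rintro _ ⟨i, rfl⟩; exact hb i)
  have hle : L.dual ≤ Submodule.span ℤ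
      (Set.range (LinearMap.BilinForm.dualBasis L.q.polarBilin L.nondegenerate b)) := by
    rw [← LinearMap.BilinForm.dualSubmodule_span_of_basis]
    intro x hx y hy
    exact hx y (hM hy)
  have hNoeth : IsNoetherian ℤ (Submodule.span ℤ
      (Set.range (LinearMap.BilinForm.dualBasis L.q.polarBilin L.nondegenerate b))) :=
    isNoetherian_span_of_finite ℤ (Set.finite_range _)
  have : Module.Finite ℤ L.dual := by
    have := isNoetherian_of_le hle
    infer_instance
  refine Module.finite_of_fg_torsion L.Disc ?_
  intro y
  obtain ⟨x, rfl⟩ := Submodule.Quotient.mk_surjective _ y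
  cases nonempty_fintype
    ↑((linearIndepOn_empty ℚ (id : V → V)).extend (Set.empty_subset (L.lattice : Set V)))
  let n : ℕ := ∏ i, (b.repr (x : V) i).den
  have hn : n ≠ 0 := Finset.prod_ne_zero_iff.2 fun i _ => (b.repr (x : V) i).den_nz
  refine ⟨⟨(n : ℤ), mem_nonZeroDivisors_of_ne_zero (by exact_mod_cast hn)⟩, ?_⟩
  change (n : ℤ) • (Submodule.Quotient.mk x : L.Disc) = 0
  rw [← Submodule.Quotient.mk_smul, Submodule.Quotient.mk_eq_zero]
  change (((n : ℤ) • x : L.dual) : V) ∈ L.lattice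
  have hx : (((n : ℤ) • x : L.dual) : V) = ∑ i, ((n : ℤ) • (b.repr (x : V) i)) • b i := by
    conv_lhs => rw [Submodule.coe_smul, ← b.sum_repr (x : V)]
    rw [Finset.smul_sum]
    exact Finset.sum_congr rfl fun i _ => (smul_assoc _ _ _).symm
  rw [hx]
  refine Submodule.sum_mem _ fun i _ => ?_
  obtain ⟨c, hc⟩ : (b.repr (x : V) i).den ∣ n := Finset.dvd_prod_of_mem _ (Finset.mem_univ i)
  have : ((n : ℤ) • (b.repr (x : V) i)) = (((c : ℤ) * (b.repr (x : V) i).num : ℤ) : ℚ) := by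
    rw [hc, zsmul_eq_mul]
    push_cast
    have := Rat.den_mul_eq_num (b.repr (x : V) i)
    rw [← this]; ring
  rw [this, Int.cast_smul_eq_zsmul]
  exact L.lattice.smul_mem _ (hb i)

instance : Fintype L.Disc := Fintype.ofFinite _

/-! ### Elementary symbols -/

/-- `e(z) = exp(2πiz)`. -/
def e (z : ℂ) : ℂ := Complex.exp (2 * Real.pi * Complex.I * z)

/-- `ε_d`, equal to `1` for `d ≡ 1 mod 4` and to `i` for `d ≡ 3 mod 4` (`d` odd). -/
def epsilonSym (d : ℕ) : ℂ := if d % 4 = 1 then 1 else Complex.I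

/-- The Kronecker symbol `(a / n)` for `n ≥ 1`: multiplicative in `n`, equal to the Jacobi symbol
for odd `n`, and with `(a / 2) = 0, 1, -1` according to `a` even, `a ≡ ±1` or `a ≡ ±3 mod 8`. -/
def kroneckerSym (a : ℤ) (n : ℕ) : ℤ :=
  (ZMod.χ₈ (a : ZMod 8)) ^ n.factorization 2 * jacobiSym a (n / 2 ^ n.factorization 2)

/-- The Legendre symbol `(x / p)` of a rational number `x` whose denominator is prime to `p`:
the numerator times the denominator of `x` differs from `x` by a square. -/
def ratLegendre (x : ℚ) (p : ℕ) : ℤ := jacobiSym (x.num * x.den) p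

/-! ### Vector valued modular forms for the Weil representation -/

/-- Functions on the upper half plane with values in `ℂ[D]`; `F τ μ` is the coefficient of the
basis vector `e_μ` in `F(τ)`. -/
abbrev VVFun : Type _ := ℍ → L.Disc → ℂ

/-- The Weil representation at `T = ((1, 1; 0, 1), 1)`, iterated `m` times:
`e_μ ↦ e(m q(μ)) e_μ`. -/
def weilT (m : ℤ) (v : L.Disc → ℂ) : L.Disc → ℂ := fun μ => e (m * L.qD μ) * v μ

/-- The Weil representation at `S = ((0, -1; 1, 0), √τ)`:
`e_ν ↦ e(-sig/8) |D|^(-1/2) ∑_μ e(-(ν, μ)) e_μ`. -/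
def weilS (v : L.Disc → ℂ) : L.Disc → ℂ := fun μ =>
  e (-(L.sig : ℂ) / 8) / (Real.sqrt (Nat.card L.Disc) : ℂ) * ∑ ν, e (-(L.bD ν μ : ℂ)) * v ν

/-- The Weil representation at `S⁻¹`, the inverse (and adjoint) of `weilS`. -/
def weilSInv (v : L.Disc → ℂ) : L.Disc → ℂ := fun μ =>
  e ((L.sig : ℂ) / 8) / (Real.sqrt (Nat.card L.Disc) : ℂ) * ∑ ν, e (L.bD ν μ : ℂ) * v ν

/-- The action `(F | γ)(τ) = φ(τ)^(-2k) ρ(γ)⁻¹ F(γτ)` of `(γ, φ) ∈ Mp₂(ℤ)` in weight `k`,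
at `T ^ m`. -/
def slashT (m : ℤ) (F : L.VVFun) : L.VVFun := fun τ => L.weilT (-m) (F ((m : ℝ) +ᵥ τ))

/-- The weight `k` action of `S = ((0, -1; 1, 0), √τ)`; powers of `τ` use the principal branch. -/
def slashS (k : ℝ) (F : L.VVFun) : L.VVFun := fun τ =>
  (τ : ℂ) ^ (-(k : ℂ)) • L.weilSInv (F (ModularGroup.S • τ))

/-- The weight `k` action of `S⁻¹ = ((0, 1; -1, 0), 1 / √(-1/τ))`. -/
def slashSInv (k : ℝ) (F : L.VVFun) : L.VVFun := fun τ =>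
  (-1 / (τ : ℂ)) ^ (k : ℂ) • L.weilS (F (ModularGroup.S • τ))

/-- Cusp forms of weight `k` for the Weil representation of `L`: holomorphic functions
`f : ℍ → ℂ[D]` invariant under the weight `k` action of `Mp₂(ℤ)`, i.e. under its generators `T`
and `S`, that vanish at `i∞`. -/
structure IsCuspForm (k : ℝ) (f : L.VVFun) : Prop where
  holo : ∀ μ, MDifferentiable 𝓘(ℂ) 𝓘(ℂ) (fun τ => f τ μ)
  slash_T : L.slashT 1 f = f
  slash_S : L.slashS k f = f
  zero_at_infty : ∀ μ, IsZeroAtImInfty (fun τ => f τ μ)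

/-- The Fourier coefficients `a(μ, n)` in
`f(τ) = ∑_{μ ∈ D} ∑_{n ∈ q(μ) + ℤ} a(μ, n) e(n τ) e_μ`, that is
`a(μ, n) = ∫₀¹ f_μ(x + i) e(-n (x + i)) dx` for `n ∈ q(μ) + ℤ`; they are `0` for other `n`. -/
def coeff (f : L.VVFun) (μ : L.Disc) (n : ℚ) : ℂ :=
  open scoped Classical in
  if n ∈ L.qCoset μ then
    ∫ x in (0 : ℝ)..1, f (x +ᵥ UpperHalfPlane.I) μ * e (-(n : ℂ) * (x + Complex.I))
  else 0

/-! ### Hecke operators -/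

/-- The action of `α = ((p², 0; 0, 1), p^(-1/2))`, up to the factor `p^k`:
`∑_μ F_μ e_μ ↦ ∑_μ F_μ(p² τ) e_{pμ}`. -/
def heckeAlpha (p : ℕ) (F : L.VVFun) : L.VVFun := fun τ μ =>
  open scoped Classical in
  ∑ ν with p • ν = μ, F (ofComplex ((p : ℂ) ^ 2 * τ)) ν

/-- The Hecke operator `T(p²)` of weight `k`, for a prime `p` not dividing the level:
`f | T(p²) = det(α)^(k/2 - 1) ∑_δ f | δ`, with `δ` running through the cosets
`Γ \ Γ α Γ` of `Γ = Mp₂(ℤ)` and `α = ((p², 0; 0, 1), p^(-1/2))` acting on `ℂ[D]` by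
`e_μ ↦ e_{pμ}`. The coset representatives are `α γ` with `γ` running through the representatives
`1`, `S T^h` (`h` mod `p²`), `S T^(-pj) S⁻¹ = (1, 0; pj, 1)` (`0 < j < p`) of `Γ₀(p²) \ SL₂(ℤ)`.
The factor is `det(α)^(k/2 - 1) p^k = p^(2k - 2)`. -/
def hecke (k : ℝ) (p : ℕ) (f : L.VVFun) : L.VVFun :=
  let F := L.heckeAlpha p f
  ((p : ℂ) ^ (2 * (k : ℂ) - 2)) •
    (F + ∑ h ∈ Finset.range (p ^ 2), L.slashT h (L.slashS k F)
      + ∑ j ∈ Finset.Ico 1 p,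
          L.slashSInv k (L.slashT (-((p * j : ℕ) : ℤ)) (L.slashS k F)))

/-- `f` is a simultaneous eigenform: it is non-zero and `f | T(p²) = Λ_p f` for all primes `p` not
dividing the level. -/
def IsEigenform (k : ℝ) (f : L.VVFun) (Λ : ℕ → ℂ) : Prop :=
  f ≠ 0 ∧ ∀ p : ℕ, p.Prime → ¬ p ∣ L.level → L.hecke k p f = Λ p • f

/-! ### The symmetric square `L`-function and its Euler factors -/

/-- The general term `a(nμ, n² t) / n^s`. -/
def LTerm (f : L.VVFun) (μ : L.Disc) (t : ℚ) (s : ℂ) (n : ℕ+) : ℂ :=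
  L.coeff f ((n : ℕ) • μ) ((n : ℚ) ^ 2 * t) / (n : ℂ) ^ s

/-- `L_{(μ,t)}(f, s) = ∑_{n ≥ 1} a(nμ, n² t) n^(-s)`. -/
def LFun (f : L.VVFun) (μ : L.Disc) (t : ℚ) (s : ℂ) : ℂ := ∑' n : ℕ+, L.LTerm f μ t s n

/-- The part of the series with `n ∣ level(L)^∞`. -/
def LLevel (f : L.VVFun) (μ : L.Disc) (t : ℚ) (s : ℂ) : ℂ :=
  ∑' n : {n : ℕ+ // ∃ m : ℕ, (n : ℕ) ∣ L.level ^ m}, L.LTerm f μ t s n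

/-- The Gauss sum `G_D(d) = ∑_{μ ∈ D} e(d q(μ))`. -/
def gaussSum (d : ℕ) : ℂ := ∑ μ : L.Disc, e (d * L.qD μ)

/-- `χ_D(p) = ε_p^(sig + (-1 / |D|)) (p / (|D| 2^sig))` for an odd prime `p`, with Kronecker
symbols; as `(p / 2) = ±1`, `(p / 2^sig)` is `(p / 2)^|sig|` also for negative `sig`. -/
def chiD (p : ℕ) : ℂ :=
  epsilonSym p ^ (L.sig + kroneckerSym (-1) (Nat.card L.Disc)) *
    ((kroneckerSym p (Nat.card L.Disc) * kroneckerSym p 2 ^ L.sig.natAbs : ℤ) : ℂ)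

/-- The numerator of the Euler factor at `p`. Here `p ∤ t` for the rational number `t` (whose
denominator is prime to `p`) means that `p` does not divide its numerator. -/
def eulerNum (k : ℝ) (t : ℚ) (p : ℕ) (s : ℂ) : ℂ :=
  if Even L.rank then
    1 + (if (p : ℤ) ∣ t.num then 0 else 1) * (L.gaussSum 1 / L.gaussSum p) * (p : ℂ) ^ (k - 1 - s)
  else
    1 - L.chiD p * (ratLegendre (-t) p : ℂ) * (p : ℂ) ^ (-1 / 2 : ℂ) * (p : ℂ) ^ (k - 1 - s)

/-- The denominator of the Euler factor at `p`. -/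
def eulerDen (k : ℝ) (Λ : ℕ → ℂ) (p : ℕ) (s : ℂ) : ℂ :=
  if Even L.rank then
    1 - (Λ p / (p : ℂ) ^ ((k : ℂ) - 1) - (1 - (p : ℂ)⁻¹) * (L.gaussSum 1 / L.gaussSum p))
        * (p : ℂ) ^ (k - 1 - s) + (p : ℂ) ^ (2 * (k - 1 - s))
  else
    1 - Λ p / (p : ℂ) ^ ((k : ℂ) - 1) * (p : ℂ) ^ (k - 1 - s) + (p : ℂ) ^ (2 * (k - 1 - s))

/-- The rational Euler factor at `p`. -/
def eulerFactor (k : ℝ) (Λ : ℕ → ℂ) (t : ℚ) (p : ℕ) (s : ℂ) : ℂ :=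
  L.eulerNum k t p s / L.eulerDen k Λ p s

/-- The primes not dividing the level. -/
abbrev GoodPrime : Type := {p : ℕ // p.Prime ∧ ¬ p ∣ L.level}

end EvenLattice

end

/-! The Euler product is a formal consequence of linear recurrences. Let `p` be a prime not dividing
the level `N`. Comparing Fourier coefficients in `f | T(p²) = Λ_p f` gives, with `pν = μ`, Λ_p a(μ,
n) = p^(2k-2) a(ν, n/p²) + a(pμ, p² n) + p^(k-2) M_p(n) a(μ, n) (`hecke_coeff`, `exists_mid`). The
middle term `M_p` does not change when `n` is multiplied by a square prime to `p`, and it takes a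
single value at all `n` divisible by `p`. The condition `p² ∤ N t` kills `a(ν, n/p²)` at the first
step of the chain `n, pn, p²n, ...`. Each chain thus satisfies a two-term recurrence with an
exceptional first step, and its generating series is the quotient of a linear by a quadratic
polynomial in `p^(k-1-s)` (`tsum_natTerm_prime_pow`). The factors are then split off one prime at a
time (`tsum_eq_tsum_mul_tprod`).

The substance is the value of `M_p`. It comes from the cosets on which `f` is transformed by
matrices with lower left entry `p`, so the Weil representation is needed at matrices whose lower
left entry is prime to `N`. For even signature an explicit kernel in Gauss sums
(`FinQuad.IsEven.weilFormula`) follows by induction on words in `S` and `T`, after an orthogonal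
splitting of the discriminant form into parts of prime power level. For odd signature the weight is
half-integral. There `f` is multiplied by the theta function of `ℤ`, the even case is applied to `L
⊕ ℤ`, and the transformation of theta itself, found by Poisson summation, is divided out
(`midFormula_odd`). Galois conjugation of Gauss sums, the congruence `G(p) ≡ G(1)^p` modulo `p` and
quadratic reciprocity identify the constants with `G_D(1)/G_D(p)` and `χ_D(p)`.

Milgram's formula is obtained on the way. With `S` normalised by the Gauss sum, `TSTST = S` holds
for the matrices by direct computation; a non-zero form whose `S` differs from this by a scalar `s`
then gives `s² = s`.

For convergence, `y^k ∑ |f_μ|²` is invariant and bounded. Hence `a(μ, n) = O(n^(k/2))` and `|Λ_p| ≤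
p^k + p^(k-1)`, which keeps the denominators away from zero for `Re s > k + 1`. -/

noncomputable section

set_option linter.unusedSectionVars false

/-! ### Finite quadratic modules and their Gauss sums. -/

/-- A non-degenerate finite quadratic module in multiplicative notation: `ψ x` plays the role of
`e (q x)`, `B x y` that of `e (x, y)`, and `n` is a multiple of the level. -/
structure FinQuad (A : Type*) [AddCommGroup A] (n : ℕ) where
  ψ : A → ℂ
  B : A → A → ℂ
  ψ_add : ∀ x y, ψ (x + y) = ψ x * ψ y * B x y
  B_add : ∀ x y z, B (x + y) z = B x z * B y z
  B_comm : ∀ x y, B x y = B y x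
  ψ_neg : ∀ x, ψ (-x) = ψ x
  ψ_pow : ∀ x, ψ x ^ n = 1
  nondeg : ∀ x, (∀ y, B x y = 1) → x = 0
  n_pos : 0 < n

theorem zpow_eq_zpow_of_zmod {n : ℕ} {z : ℂ} (hn : 0 < n) (h : z ^ n = 1) {i j : ℤ}
    (hij : (i : ZMod n) = (j : ZMod n)) : z ^ i = z ^ j := by
  have hz : z ≠ 0 := by
    rintro rfl
    simp [zero_pow hn.ne'] at h
  obtain ⟨m, hm⟩ := (ZMod.intCast_eq_intCast_iff_dvd_sub i j n).1 hij
  have : j = i + n * m := by linarith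
  rw [this, zpow_add₀ hz, zpow_mul, zpow_natCast, h, one_zpow, mul_one]


namespace FinQuad

variable {A : Type*} [AddCommGroup A] {n : ℕ} (Q : FinQuad A n)

theorem ψ_ne_zero (x : A) : Q.ψ x ≠ 0 := by
  intro h
  have := Q.ψ_pow x
  rw [h, zero_pow Q.n_pos.ne'] at this
  exact zero_ne_one this

theorem B_eq (x y : A) : Q.B x y = Q.ψ (x + y) / (Q.ψ x * Q.ψ y) := by
  rw [Q.ψ_add, mul_div_cancel_left₀]
  exact mul_ne_zero (Q.ψ_ne_zero x) (Q.ψ_ne_zero y)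

theorem B_ne_zero (x y : A) : Q.B x y ≠ 0 := by
  rw [Q.B_eq]
  exact div_ne_zero (Q.ψ_ne_zero _) (mul_ne_zero (Q.ψ_ne_zero x) (Q.ψ_ne_zero y))

theorem B_pow (x y : A) : Q.B x y ^ n = 1 := by
  rw [Q.B_eq, div_pow, mul_pow, Q.ψ_pow, Q.ψ_pow, Q.ψ_pow]; simp

theorem B_add_right (x y z : A) : Q.B x (y + z) = Q.B x y * Q.B x z := by
  rw [Q.B_comm, Q.B_add, Q.B_comm y, Q.B_comm z]

theorem B_zero (y : A) : Q.B 0 y = 1 := by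
  have := Q.B_add 0 0 y
  rw [add_zero] at this
  exact (mul_eq_left₀ (Q.B_ne_zero 0 y)).1 this.symm

theorem ψ_zero : Q.ψ 0 = 1 := by
  have := Q.ψ_add 0 0
  rw [add_zero, Q.B_zero, mul_one] at this
  exact (mul_eq_left₀ (Q.ψ_ne_zero 0)).1 this.symm

theorem B_neg (x y : A) : Q.B (-x) y = (Q.B x y)⁻¹ := by
  have := Q.B_add (-x) x y
  rw [neg_add_cancel, Q.B_zero] at this
  exact eq_inv_of_mul_eq_one_left this.symm

/-- Expand `1 = ψ (x + -x)`; the symmetry `ψ (-x) = ψ x` is what makes `ψ` quadratic and not merely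
of degree two. -/
theorem B_self (x : A) : Q.B x x = Q.ψ x ^ (2 : ℤ) := by
  have := Q.ψ_add x (-x)
  rw [add_neg_cancel, Q.ψ_zero, Q.ψ_neg, Q.B_comm, Q.B_neg] at this
  have h := Q.B_ne_zero x x
  field_simp at this
  rw [this, zpow_ofNat]

theorem B_zsmul (m : ℤ) (x y : A) : Q.B (m • x) y = Q.B x y ^ m := by
  induction m using Int.induction_on with
  | zero => simp [Q.B_zero]
  | succ i ih => rw [add_zsmul, one_zsmul, Q.B_add, ih, zpow_add_one₀ (Q.B_ne_zero x y)]
  | pred i ih => rw [sub_zsmul, one_zsmul, sub_eq_add_neg, Q.B_add, ih, Q.B_neg,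
      ← zpow_sub_one₀ (Q.B_ne_zero x y), sub_eq_add_neg]

theorem B_zsmul_right (m : ℤ) (x y : A) : Q.B x (m • y) = Q.B x y ^ m := by
  rw [Q.B_comm, Q.B_zsmul, Q.B_comm]

theorem ψ_zsmul (m : ℤ) (x : A) : Q.ψ (m • x) = Q.ψ x ^ (m * m) := by
  have h0 := Q.ψ_ne_zero x
  induction m using Int.induction_on with
  | zero => simp [Q.ψ_zero]
  | succ i ih =>
    rw [add_zsmul, one_zsmul, Q.ψ_add, ih, Q.B_zsmul, Q.B_self, ← zpow_mul, ← zpow_add_one₀ h0,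
      ← zpow_add₀ h0]
    ring_nf
  | pred i ih =>
    rw [sub_zsmul, one_zsmul, sub_eq_add_neg, Q.ψ_add, ih, Q.ψ_neg, Q.B_comm, Q.B_neg, Q.B_comm,
      Q.B_zsmul, Q.B_self, ← zpow_mul, ← zpow_add_one₀ h0, ← zpow_neg, ← zpow_add₀ h0]
    ring_nf

/-- Nondegeneracy turns the bound on the order of the values of `B` into a bound on the exponent of
`A`, so integers act on `A` through `ZMod n`. -/
theorem zsmul_eq_zero (Q : FinQuad A n) (x : A) : (n : ℤ) • x = 0 :=
  Q.nondeg _ fun y => by rw [Q.B_zsmul, zpow_natCast, Q.B_pow]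

theorem zsmul_congr (Q : FinQuad A n) {i j : ℤ} (h : (i : ZMod n) = j) (x : A) : i • x = j • x := by
  obtain ⟨m, hm⟩ := (ZMod.intCast_eq_intCast_iff_dvd_sub i j n).1 h
  have : j = i + m * n := by linarith
  rw [this, add_zsmul, mul_zsmul, Q.zsmul_eq_zero, zsmul_zero, add_zero]

theorem ψ_zpow_congr {i j : ℤ} (h : (i : ZMod n) = j) (x : A) : Q.ψ x ^ i = Q.ψ x ^ j :=
  zpow_eq_zpow_of_zmod Q.n_pos (Q.ψ_pow x) h

theorem B_zpow_congr {i j : ℤ} (h : (i : ZMod n) = j) (x y : A) : Q.B x y ^ i = Q.B x y ^ j :=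
  zpow_eq_zpow_of_zmod Q.n_pos (Q.B_pow x y) h

variable [Fintype A]

/-- The Gauss sum `∑ e (m q x)`. -/
def G (m : ℤ) : ℂ := ∑ x, Q.ψ x ^ m

theorem G_congr {i j : ℤ} (h : (i : ZMod n) = j) : Q.G i = Q.G j :=
  Finset.sum_congr rfl fun x _ => Q.ψ_zpow_congr h x

/-- Multiplication by a unit modulo `n`. -/
def smulEquiv (Q : FinQuad A n) {m m' : ℤ} (h : ((m * m' : ℤ) : ZMod n) = (1 : ℤ)) : A ≃ A where
  toFun x := m • x
  invFun x := m' • x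
  left_inv x := by
    change m' • m • x = x
    rw [← mul_zsmul, mul_comm, Q.zsmul_congr h, one_zsmul]
  right_inv x := by
    change m • m' • x = x
    rw [← mul_zsmul, Q.zsmul_congr h, one_zsmul]

theorem G_mul_sq {m m' : ℤ} (h : ((m * m' : ℤ) : ZMod n) = (1 : ℤ)) (i : ℤ) :
    Q.G (i * (m * m)) = Q.G i := by
  refine Fintype.sum_equiv (Q.smulEquiv h) _ _ fun x => ?_
  change _ = Q.ψ (m • x) ^ i
  rw [Q.ψ_zsmul, ← zpow_mul]
  ring_nf

/-- Completing the square: replace `y` by `y + m' z`. -/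
theorem gauss_shift {m m' : ℤ} (h : ((m * m' : ℤ) : ZMod n) = (1 : ℤ)) (z : A) :
    ∑ y, Q.ψ y ^ m * (Q.B y z)⁻¹ = Q.ψ z ^ (-m') * Q.G m := by
  rw [G, Finset.mul_sum]
  refine (Fintype.sum_equiv (Equiv.addRight (m' • z)) _ _ fun y => ?_).symm
  simp only [Equiv.coe_addRight]
  rw [Q.ψ_add, Q.B_add, Q.B_zsmul, Q.B_zsmul_right, Q.ψ_zsmul, Q.B_self, mul_zpow, mul_zpow,
    ← zpow_mul, ← zpow_mul, ← zpow_mul, mul_inv]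
  have h1 : Q.B y z ^ (m' * m) = Q.B y z := by
    rw [← zpow_one (Q.B y z), ← zpow_mul]
    refine Q.B_zpow_congr ?_ y z
    rw [← h]; push_cast; ring
  have h2 : Q.ψ z ^ (m' * m' * m) = Q.ψ z ^ m' := by
    refine Q.ψ_zpow_congr ?_ z
    have : ((m' * m' * m : ℤ) : ZMod n) = m' * ((m * m' : ℤ) : ZMod n) := by push_cast; ring
    rw [this, h]; simp
  rw [h1, h2, two_mul, zpow_add₀ (Q.ψ_ne_zero z), zpow_neg]
  have := Q.B_ne_zero y z
  have := zpow_ne_zero m' (Q.ψ_ne_zero z)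
  field_simp

theorem sum_B (x : A) [Decidable (x = 0)] :
    ∑ y, Q.B x y = if x = 0 then (Fintype.card A : ℂ) else 0 := by
  split_ifs with h
  · subst h; simp [Q.B_zero]
  · obtain ⟨z, hz⟩ : ∃ z, Q.B x z ≠ 1 := by
      by_contra! hc
      exact h (Q.nondeg x hc)
    have : ∑ y, Q.B x y = Q.B x z * ∑ y, Q.B x y := by
      rw [Finset.mul_sum]
      refine (Fintype.sum_equiv (Equiv.addRight z) _ _ fun y => ?_).symm
      simp only [Equiv.coe_addRight]
      rw [Q.B_add_right, mul_comm]
    have h2 : (Q.B x z - 1) * ∑ y, Q.B x y = 0 := by rw [sub_mul, ← this]; ring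
    exact (mul_eq_zero.1 h2).resolve_left (sub_ne_zero.2 hz)

/-- In the double sum of `ψ(z + y)^m ψ(y)^(-m)` the square of `y` cancels, and the sum over `y` is
one of a character that is trivial only for `z = 0`. -/
theorem G_mul_G_neg {m m' : ℤ} (h : ((m * m' : ℤ) : ZMod n) = (1 : ℤ)) :
    Q.G m * Q.G (-m) = Fintype.card A := by
  classical
  have h1 : Q.G m * Q.G (-m) = ∑ z, ∑ y, Q.ψ z ^ m * Q.B (m • z) y := by
    rw [Finset.sum_comm, G, G, Finset.sum_mul_sum, Finset.sum_comm]
    refine Finset.sum_congr rfl fun y _ => ?_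
    refine (Fintype.sum_equiv (Equiv.addRight y) _ _ fun z => ?_).symm
    simp only [Equiv.coe_addRight]
    rw [Q.ψ_add, mul_zpow, mul_zpow, Q.B_zsmul, zpow_neg]
    have := zpow_ne_zero m (Q.ψ_ne_zero y)
    field_simp
  rw [h1]
  have h2 : ∀ z : A, m • z = 0 ↔ z = 0 := fun z => by
    constructor
    · intro hz
      have : (m' * m) • z = 0 := by rw [mul_zsmul, hz, zsmul_zero]
      rwa [mul_comm, Q.zsmul_congr h, one_zsmul] at this
    · rintro rfl; simp
  simp_rw [← Finset.mul_sum, Q.sum_B, h2]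
  simp [Q.ψ_zero]

theorem card_ne_zero : (Fintype.card A : ℂ) ≠ 0 := by
  have : Nonempty A := ⟨0⟩
  exact_mod_cast Fintype.card_ne_zero

theorem G_ne_zero {m m' : ℤ} (h : ((m * m' : ℤ) : ZMod n) = (1 : ℤ)) : Q.G m ≠ 0 :=
  left_ne_zero_of_mul (b := Q.G (-m)) (by rw [Q.G_mul_G_neg h]; exact card_ne_zero)

theorem G_one_ne_zero : Q.G 1 ≠ 0 := Q.G_ne_zero (m' := 1) (by simp)

/-! ### The Weil representation on words in `S` and `T` -/

variable [DecidableEq A]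

/-- The matrix of `T`. -/
def Tm : Matrix A A ℂ := Matrix.diagonal Q.ψ

/-- The matrix of `S`, normalised by the Gauss sum. -/
def Sm : Matrix A A ℂ := fun x y => (Q.G 1)⁻¹ * (Q.B x y)⁻¹

/-- The matrix of a word in `S` (`true`) and `T` (`false`). -/
def W (w : List Bool) : Matrix A A ℂ :=
  w.foldr (fun b M => (if b then Q.Sm else Q.Tm) * M) 1

@[simp] theorem W_nil : Q.W [] = 1 := rfl
@[simp] theorem W_true (w : List Bool) : Q.W (true :: w) = Q.Sm * Q.W w := rfl
@[simp] theorem W_false (w : List Bool) : Q.W (false :: w) = Q.Tm * Q.W w := rfl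

/-- The expected matrix of `(a, b; c, d)` up to a scalar, for `c c' ≡ 1`. -/
def K (a d c' : ℤ) : Matrix A A ℂ := fun x y =>
  Q.ψ x ^ (a * c') * Q.B x y ^ (-c') * Q.ψ y ^ (d * c')

theorem K_congr {a₁ d₁ c₁ a₂ d₂ c₂ : ℤ} (ha : ((a₁ * c₁ : ℤ) : ZMod n) = (a₂ * c₂ : ℤ))
    (hc : (c₁ : ZMod n) = c₂) (hd : ((d₁ * c₁ : ℤ) : ZMod n) = (d₂ * c₂ : ℤ)) :
    Q.K a₁ d₁ c₁ = Q.K a₂ d₂ c₂ := by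
  ext x y
  rw [K, K, Q.ψ_zpow_congr ha, Q.ψ_zpow_congr hd, Q.B_zpow_congr (j := -c₂)]
  push_cast; rw [hc]

theorem Tm_mul_K {a c c' d : ℤ} (h : ((c * c' : ℤ) : ZMod n) = (1 : ℤ)) :
    Q.Tm * Q.K a d c' = Q.K (a + c) d c' := by
  ext x y
  rw [Tm, Matrix.diagonal_mul, K, K, ← mul_assoc, ← mul_assoc, ← zpow_one_add₀ (Q.ψ_ne_zero x)]
  rw [Q.ψ_zpow_congr (j := (a + c) * c')]
  push_cast at h ⊢
  linear_combination -h

/-- The sum over the middle variable is a Gauss sum with quadratic coefficient `a c'`. Completing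
the square needs `a` invertible besides `c`; this restriction governs the whole induction on words
below. -/
theorem Sm_mul_K {a b c d a' c' : ℤ} (hc : ((c * c' : ℤ) : ZMod n) = (1 : ℤ))
    (ha : ((a * a' : ℤ) : ZMod n) = (1 : ℤ)) (hdet : a * d - b * c = 1) :
    Q.Sm * Q.K a d c' = (Q.G (a * c) / Q.G 1) • Q.K (-c) b a' := by
  have hdet' : (a * d - b * c : ZMod n) = 1 := by exact_mod_cast congrArg (Int.cast (R := ZMod n)) hdet
  push_cast at hc ha
  ext x y
  have h1 : ((a * c' * (a' * c) : ℤ) : ZMod n) = (1 : ℤ) := by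
    push_cast; linear_combination ha * c * c' + hc
  have e1 : (Q.Sm * Q.K a d c') x y
      = (Q.G 1)⁻¹ * Q.ψ y ^ (d * c') * ∑ z, Q.ψ z ^ (a * c') * (Q.B z (x + c' • y))⁻¹ := by
    rw [Matrix.mul_apply, Finset.mul_sum]
    refine Finset.sum_congr rfl fun z _ => ?_
    rw [Sm, K, Q.B_add_right, Q.B_zsmul_right, Q.B_comm z x, mul_inv, zpow_neg]
    ring
  have e2 : Q.G (a * c') = Q.G (a * c) := by
    have hc2 : ((c * c' : ℤ) : ZMod n) = (1 : ℤ) := by push_cast; exact hc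
    rw [← Q.G_mul_sq hc2 (a * c')]
    refine Q.G_congr ?_
    push_cast
    linear_combination a * c * hc
  rw [e1, Q.gauss_shift h1, e2, Q.ψ_add, Q.ψ_zsmul, Q.B_zsmul_right, mul_zpow, mul_zpow,
    ← zpow_mul, ← zpow_mul, Matrix.smul_apply, K, smul_eq_mul]
  have f1 : Q.ψ x ^ (-(a' * c)) = Q.ψ x ^ (-c * a') := by ring_nf
  have f2 : Q.B x y ^ (c' * -(a' * c)) = Q.B x y ^ (-a') := by
    refine Q.B_zpow_congr ?_ x y
    push_cast; linear_combination -a' * hc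
  have f3 : Q.ψ y ^ (d * c') * Q.ψ y ^ (c' * c' * -(a' * c)) = Q.ψ y ^ (b * a') := by
    rw [← zpow_add₀ (Q.ψ_ne_zero y)]
    refine Q.ψ_zpow_congr ?_ y
    push_cast
    linear_combination (-(d:ZMod n) * c') * ha + (b * a' - c' * a') * hc + c' * a' * hdet'
  rw [f1, f2, ← f3]
  ring

theorem Sm_eq_K : Q.Sm = (Q.G 1)⁻¹ • Q.K 0 0 1 := by
  ext x y; simp [Sm, K]

/-- The normalisation of `Sm` by `G 1` makes this relation hold without a scalar: the left side has
one more factor `Sm`, and its sum produces exactly one factor `G 1`. -/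
theorem braid : Q.Tm * (Q.Sm * (Q.Tm * (Q.Sm * Q.Tm))) = Q.Sm := by
  have h1 : ∀ x y, (Q.Sm * Q.Tm) x y = ((Q.G 1)⁻¹ • Q.K 0 1 1) x y := fun x y => by
    rw [Tm, Matrix.mul_diagonal]; simp [Sm, K]; ring
  rw [show Q.Sm * Q.Tm = _ from Matrix.ext h1, Matrix.mul_smul,
    Q.Tm_mul_K (c := 1) (by simp), Matrix.mul_smul,
    Q.Sm_mul_K (a := 0 + 1) (b := 0) (c := 1) (d := 1) (a' := 1) (c' := 1) (by simp) (by simp)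
      (by norm_num), zero_add, mul_one,
    div_self Q.G_one_ne_zero, one_smul, Matrix.mul_smul, Q.Tm_mul_K (c := 1) (by simp), Q.Sm_eq_K]
  norm_num

theorem Sm_mul_Sm : Q.Sm * Q.Sm
    = Matrix.of fun x y => if x + y = 0 then (Fintype.card A : ℂ) / Q.G 1 ^ 2 else 0 := by
  ext x y
  have : ∀ z, Q.Sm x z * Q.Sm z y = ((Q.G 1) ^ 2)⁻¹ * Q.B (-(x + y)) z := fun z => by
    rw [Sm, Sm, Q.B_neg, Q.B_add, Q.B_comm z y, mul_inv]; ring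
  rw [Matrix.mul_apply]
  simp_rw [this]
  rw [← Finset.mul_sum, Q.sum_B]
  simp only [neg_eq_zero, Matrix.of_apply]
  split_ifs
  · field_simp
  · simp

end FinQuad

/-! ### Galois conjugation of Gauss sums. -/

theorem zmod_unit_iff {n : ℕ} {c : ℤ} :
    (∃ c' : ℤ, ((c * c' : ℤ) : ZMod n) = (1 : ℤ)) ↔ IsCoprime c n := by
  constructor
  · rintro ⟨c', h⟩
    obtain ⟨m, hm⟩ := (ZMod.intCast_eq_intCast_iff_dvd_sub _ _ n).1 h
    exact ⟨c', m, by linarith⟩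
  · rintro ⟨u, v, h⟩
    refine ⟨u, (ZMod.intCast_eq_intCast_iff_dvd_sub _ _ n).2 ⟨v, by linarith⟩⟩

/-- All primitive `n`-th roots of unity share one minimal polynomial, so integral relations between
roots of unity survive `ζ ↦ ζ ^ m`. This is the Galois action of the cyclotomic field in elementary
form. -/
theorem aeval_pow_eq_zero_of_coprime {n m : ℕ} (hn : 0 < n) {ζ : ℂ} (hζ : IsPrimitiveRoot ζ n)
    (hm : m.Coprime n) {P : Polynomial ℤ} (hP : Polynomial.aeval ζ P = 0) :
    Polynomial.aeval (ζ ^ m) P = 0 := by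
  have h1 : minpoly ℤ ζ ∣ P := minpoly.isIntegrallyClosed_dvd (hζ.isIntegral hn) hP
  rw [hζ.minpoly_eq_pow_coprime hm] at h1
  obtain ⟨R, rfl⟩ := h1
  rw [map_mul, minpoly.aeval, zero_mul]

namespace FinQuad

variable {A : Type*} [AddCommGroup A] {n : ℕ} (Q : FinQuad A n) [Fintype A]

theorem exists_poly (Q : FinQuad A n) : ∃ P : Polynomial ℤ, ∃ ζ : ℂ, IsPrimitiveRoot ζ n ∧
    ∀ m : ℕ, Q.G m = Polynomial.aeval (ζ ^ m) P := by
  have hn : NeZero n := ⟨Q.n_pos.ne'⟩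
  have hζ := Complex.isPrimitiveRoot_exp n Q.n_pos.ne'
  set ζ := Complex.exp (2 * Real.pi * Complex.I / n)
  choose k _ hk using fun x => hζ.eq_pow_of_pow_eq_one (Q.ψ_pow x)
  refine ⟨∑ x, Polynomial.X ^ k x, ζ, hζ, fun m => ?_⟩
  simp only [G, map_sum, map_pow, Polynomial.aeval_X, zpow_natCast]
  refine Finset.sum_congr rfl fun x _ => ?_
  rw [← hk, ← pow_mul, ← pow_mul, mul_comm]

/-- The square of the Gauss sum is `± |A|`, which expresses that the signature is even. -/
def IsEven : Prop := ∃ ε : ℤ, (ε = 1 ∨ ε = -1) ∧ Q.G 1 ^ 2 = ε * Fintype.card A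

theorem exists_nat_rep (Q : FinQuad A n) {a : ℤ} (ha : IsCoprime a n) :
    ∃ m : ℕ, m.Coprime n ∧ ((m : ℤ) : ZMod n) = a := by
  have hn : NeZero n := ⟨Q.n_pos.ne'⟩
  have h : (((a : ZMod n).val : ℤ) : ZMod n) = a := by simp
  refine ⟨(a : ZMod n).val, ?_, h⟩
  rw [← Nat.isCoprime_iff_coprime]
  obtain ⟨c', hc⟩ := zmod_unit_iff.2 ha
  refine zmod_unit_iff.1 ⟨c', ?_⟩
  rw [Int.cast_mul, h, ← Int.cast_mul, hc]

variable {Q}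

/-- `G a` is the Galois conjugate of `G 1`. The square of `G 1` is rational, hence fixed, so `G a`
and `G 1` have the same square. -/
theorem IsEven.G_eq (hQ : Q.IsEven) {a : ℤ} (ha : IsCoprime a n) :
    ∃ δ : ℤ, (δ = 1 ∨ δ = -1) ∧ Q.G a = δ * Q.G 1 := by
  obtain ⟨ε, hε, h⟩ := hQ
  obtain ⟨m, hm, hma⟩ := Q.exists_nat_rep ha
  obtain ⟨P, ζ, hζ, hP⟩ := Q.exists_poly
  have h1 := hP 1
  rw [pow_one, Nat.cast_one] at h1
  have hz : Polynomial.aeval ζ (P ^ 2 - Polynomial.C (ε * Fintype.card A)) = 0 := by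
    rw [map_sub, map_pow, ← h1, h]; simp
  have hz' := aeval_pow_eq_zero_of_coprime Q.n_pos hζ hm hz
  rw [map_sub, map_pow, ← hP m, sub_eq_zero] at hz'
  have h3 : Q.G m ^ 2 = Q.G 1 ^ 2 := by rw [hz', h]; simp
  rw [← Q.G_congr hma]
  rcases sq_eq_sq_iff_eq_or_eq_neg.1 h3 with h4 | h4
  · exact ⟨1, .inl rfl, by simp [h4]⟩
  · exact ⟨-1, .inr rfl, by simp [h4]⟩

/-- Conjugate the relation `G a = δ G 1` by the second unit `b`; in other words `a ↦ G a / G 1` is a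
character with values `±1`. -/
theorem IsEven.G_mul (hQ : Q.IsEven) {a b : ℤ} (ha : IsCoprime a n) (hb : IsCoprime b n) :
    Q.G (a * b) * Q.G 1 = Q.G a * Q.G b := by
  obtain ⟨δ, -, hδ⟩ := hQ.G_eq ha
  obtain ⟨m, hm, hma⟩ := Q.exists_nat_rep ha
  obtain ⟨r, hr, hrb⟩ := Q.exists_nat_rep hb
  obtain ⟨P, ζ, hζ, hP⟩ := Q.exists_poly
  have h1 := hP 1
  rw [pow_one, Nat.cast_one] at h1
  rw [← Q.G_congr hma] at hδ
  have hz : Polynomial.aeval ζ (P.comp (Polynomial.X ^ m) - Polynomial.C δ * P) = 0 := by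
    rw [map_sub, Polynomial.aeval_comp, map_mul, map_pow, Polynomial.aeval_X, ← h1, ← hP, hδ]
    simp
  have hz' := aeval_pow_eq_zero_of_coprime Q.n_pos hζ hr hz
  rw [map_sub, Polynomial.aeval_comp, map_mul, map_pow, Polynomial.aeval_X, ← pow_mul, ← hP, ← hP,
    sub_eq_zero] at hz'
  have h2 : Q.G (a * b) = Q.G ((r * m : ℕ) : ℤ) := by
    refine Q.G_congr ?_
    push_cast at hma hrb ⊢
    rw [hma, hrb, mul_comm]
  rw [h2, hz', ← Q.G_congr hma, ← Q.G_congr hrb, hδ]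
  simp
  ring

theorem IsEven.G_sq (hQ : Q.IsEven) {a : ℤ} (ha : IsCoprime a n) : Q.G a ^ 2 = Q.G 1 ^ 2 := by
  obtain ⟨δ, hδ, h⟩ := hQ.G_eq ha
  rcases hδ with rfl | rfl <;> simp [h]

/-! ### The Weil representation at matrices with invertible lower left entry. -/

variable [DecidableEq A]

/-- The matrix in `SL₂(ℤ)` of a word in `S` (`true`) and `T` (`false`). -/
def _root_.slWord (w : List Bool) : Matrix.SpecialLinearGroup (Fin 2) ℤ :=
  w.foldr (fun b g => (if b then ModularGroup.S else ModularGroup.T) * g) 1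

@[simp] theorem _root_.slWord_nil : slWord [] = 1 := rfl
@[simp] theorem _root_.slWord_true (w : List Bool) :
    slWord (true :: w) = ModularGroup.S * slWord w := rfl
@[simp] theorem _root_.slWord_false (w : List Bool) :
    slWord (false :: w) = ModularGroup.T * slWord w := rfl

theorem _root_.slWord_append (v w : List Bool) : slWord (v ++ w) = slWord v * slWord w := by
  induction v with
  | nil => simp
  | cons b v ih => cases b <;> simp [ih, mul_assoc]

theorem _root_.exists_slWord (g : Matrix.SpecialLinearGroup (Fin 2) ℤ) : ∃ w, slWord w = g := by
  have hg : g ∈ Subgroup.closure {ModularGroup.S, ModularGroup.T} := by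
    rw [SpecialLinearGroup.SL2Z_generators]; trivial
  -- `S⁻¹ = S³` and `T⁻¹ = STST S³` are positive words, so words without inverses reach the whole
  -- group.
  have hS : slWord [true, true, true] = ModularGroup.S⁻¹ := by
    ext i j; fin_cases i <;> fin_cases j <;> rfl
  have hT : slWord [true, false, true, false, true, true, true] = ModularGroup.T⁻¹ := by
    ext i j; fin_cases i <;> fin_cases j <;> rfl
  induction hg using Subgroup.closure_induction'' with
  | one => exact ⟨[], rfl⟩
  | mem x hx =>
    rcases hx with rfl | rfl
    · exact ⟨[true], by simp⟩
    · exact ⟨[false], by simp⟩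
  | inv_mem x hx =>
    rcases hx with rfl | rfl
    · exact ⟨_, hS⟩
    · exact ⟨_, hT⟩
  | mul x y _ _ hx hy =>
    obtain ⟨v, rfl⟩ := hx
    obtain ⟨w, rfl⟩ := hy
    exact ⟨v ++ w, slWord_append v w⟩

theorem _root_.slWord_true_apply (w : List Bool) :
    slWord (true :: w) 0 0 = -slWord w 1 0 ∧ slWord (true :: w) 0 1 = -slWord w 1 1 ∧
    slWord (true :: w) 1 0 = slWord w 0 0 ∧ slWord (true :: w) 1 1 = slWord w 0 1 := by
  simp [Matrix.SpecialLinearGroup.coe_mul, ModularGroup.coe_S, Matrix.mul_apply, Fin.sum_univ_two]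

theorem _root_.slWord_false_apply (w : List Bool) :
    slWord (false :: w) 0 0 = slWord w 0 0 + slWord w 1 0 ∧
    slWord (false :: w) 0 1 = slWord w 0 1 + slWord w 1 1 ∧
    slWord (false :: w) 1 0 = slWord w 1 0 ∧ slWord (false :: w) 1 1 = slWord w 1 1 := by
  simp [Matrix.SpecialLinearGroup.coe_mul, ModularGroup.coe_T, Matrix.mul_apply, Fin.sum_univ_two]

theorem _root_.slWord_det (w : List Bool) :
    slWord w 0 0 * slWord w 1 1 - slWord w 0 1 * slWord w 1 0 = 1 := by
  have := (slWord w).det_coe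
  rwa [Matrix.det_fin_two] at this

variable (Q)

/-- The explicit formula for the Weil representation at words whose lower left entry is prime
to the level. -/
def WeilFormula : Prop := ∀ w : List Bool, ∀ c' : ℤ,
  ((slWord w 1 0 * c' : ℤ) : ZMod n) = (1 : ℤ) →
  Q.W w = (Q.G (slWord w 1 0) / Q.G 1 ^ 2) • Q.K (slWord w 0 0) (slWord w 1 1) c'

theorem Tm_mul_left_injective {M N : Matrix A A ℂ} (h : Q.Tm * M = Q.Tm * N) : M = N := by
  ext x y
  have := congrFun (congrFun h x) y
  rw [Tm, Matrix.diagonal_mul, Matrix.diagonal_mul] at this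
  exact mul_left_cancel₀ (Q.ψ_ne_zero x) this

theorem Sm_mul_Sm_mul (M : Matrix A A ℂ) (x y : A) :
    (Q.Sm * (Q.Sm * M)) x y = Fintype.card A / Q.G 1 ^ 2 * M (-x) y := by
  rw [← Matrix.mul_assoc, Q.Sm_mul_Sm, Matrix.mul_apply, Finset.sum_eq_single (-x)]
  · simp
  · intro z _ hz
    rw [Matrix.of_apply, if_neg, zero_mul]
    intro h
    exact hz (by rw [← eq_neg_iff_add_eq_zero] at h; rw [h, neg_neg])
  · simp

theorem Sm_mul_left_injective {M N : Matrix A A ℂ} (h : Q.Sm * M = Q.Sm * N) : M = N := by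
  ext x y
  have h2 : Q.Sm * (Q.Sm * M) = Q.Sm * (Q.Sm * N) := by rw [h]
  have h3 := congrFun (congrFun h2 (-x)) y
  rw [Q.Sm_mul_Sm_mul, Q.Sm_mul_Sm_mul, neg_neg] at h3
  refine mul_left_cancel₀ ?_ h3
  exact div_ne_zero card_ne_zero (pow_ne_zero 2 Q.G_one_ne_zero)

variable {Q}

/-- Induction on the word. A prefix may have a non-invertible lower left entry `c`, where `K` makes
no sense. The induction therefore carries a second claim: for such `c` the formula holds after one
more multiplication by `S`, which moves the invertible entry `a` into the lower left corner. -/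
theorem IsEven.weilFormula_of_local (hQ : Q.IsEven)
    (hloc : ∀ a c : ℤ, IsCoprime a c → ¬ IsCoprime c n → IsCoprime a n ∧ IsCoprime (a + c) n) :
    Q.WeilFormula := by
  have hG1 := Q.G_one_ne_zero
  have step : ∀ a b c d a' c' : ℤ, ((c * c' : ℤ) : ZMod n) = (1 : ℤ) →
      ((a * a' : ℤ) : ZMod n) = (1 : ℤ) → a * d - b * c = 1 →
      Q.Sm * ((Q.G c / Q.G 1 ^ 2) • Q.K a d c') = (Q.G a / Q.G 1 ^ 2) • Q.K (-c) b a' := by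
    intro a b c d a' c' hc ha hdet
    have hcc := zmod_unit_iff.1 ⟨_, hc⟩
    have haa := zmod_unit_iff.1 ⟨_, ha⟩
    rw [Matrix.mul_smul, Q.Sm_mul_K hc ha hdet, smul_smul]
    congr 1
    have h1 := hQ.G_mul haa hcc
    have h2 := hQ.G_sq hcc
    field_simp
    refine mul_right_cancel₀ hG1 ?_
    linear_combination Q.G c * h1 + Q.G a * h2
  have main : ∀ w : List Bool,
      (∀ c' : ℤ, ((slWord w 1 0 * c' : ℤ) : ZMod n) = (1 : ℤ) →
        Q.W w = (Q.G (slWord w 1 0) / Q.G 1 ^ 2) • Q.K (slWord w 0 0) (slWord w 1 1) c') ∧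
      (¬ IsCoprime (slWord w 1 0) n → ∀ a' : ℤ,
        ((slWord w 0 0 * a' : ℤ) : ZMod n) = (1 : ℤ) →
        Q.Sm * Q.W w = (Q.G (slWord w 0 0) / Q.G 1 ^ 2) • Q.K (-slWord w 1 0) (slWord w 0 1) a') := by
    intro w
    induction w with
    | nil =>
      refine ⟨fun c' h => ?_, fun _ a' h => ?_⟩
      -- The lower left entry of the identity is `0`, which is invertible only modulo `1`; then `A`
      -- is trivial.
      · have h0 : ((0 : ℤ) : ZMod n) = (1 : ℤ) := by simpa using h
        have hψ : ∀ x, Q.ψ x = 1 := fun x => by simpa using (Q.ψ_zpow_congr h0 x).symm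
        have hB : ∀ x y, Q.B x y = 1 := fun x y => by simpa using (Q.B_zpow_congr h0 x y).symm
        have hA : ∀ x : A, x = 0 := fun x => Q.nondeg x fun y => hB x y
        have hc : Fintype.card A = 1 := Fintype.card_eq_one_iff.2 ⟨0, hA⟩
        ext x y
        simp [K, hψ, hB, G, hc, (hA x).trans (hA y).symm]
      · have h1 : (a' : ZMod n) = (1 : ℤ) := by simpa using h
        simp only [slWord_nil, W_nil, mul_one, Matrix.SpecialLinearGroup.coe_one, Matrix.one_apply_eq]
        rw [Q.Sm_eq_K, Q.K_congr (a₂ := 0) (d₂ := 0) (c₂ := a') (by simp) (by simp [h1]) (by simp)]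
        simp only [ne_eq, one_ne_zero, not_false_eq_true, Matrix.one_apply_ne, neg_zero, zero_ne_one]
        congr 1
        field_simp
    | cons s w ih =>
      obtain ⟨ih1, ih2⟩ := ih
      have hdet := slWord_det w
      have hcop : IsCoprime (slWord w 0 0) (slWord w 1 0) :=
        ⟨slWord w 1 1, -slWord w 0 1, by linarith⟩
      cases s with
      | true =>
        obtain ⟨e00, e01, e10, e11⟩ := slWord_true_apply w
        rw [e00, e01, e10, e11, W_true]
        refine ⟨fun a' ha => ?_, fun hna c' hc => ?_⟩
        · by_cases hc : IsCoprime (slWord w 1 0) (n : ℤ)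
          · obtain ⟨c', hc'⟩ := zmod_unit_iff.2 hc
            rw [ih1 c' hc', step _ _ _ _ _ _ hc' ha hdet]
          · exact ih2 hc a' ha
        -- Now `a` is not invertible, so `c` is. The two leading factors `S` compose to a multiple
        -- of `x ↦ -x`, and the formula for `w` applies.
        · have hc0 : IsCoprime (slWord w 1 0) (n : ℤ) := by
            by_contra hcon
            exact hna (hloc _ _ hcop hcon).1
          obtain ⟨c₁, hc₁⟩ := zmod_unit_iff.2 hc0
          have hcc : (c' : ZMod n) = -c₁ := by
            push_cast at hc hc₁
            linear_combination (-c₁ : ZMod n) * hc - c' * hc₁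
          rw [ih1 c₁ hc₁]
          ext x y
          rw [Q.Sm_mul_Sm_mul, Matrix.smul_apply, Matrix.smul_apply, K, K, Q.ψ_neg, Q.B_neg,
            Q.B_zpow_congr (i := -c') (j := c₁) (by push_cast; rw [hcc]; ring),
            Q.ψ_zpow_congr (i := -slWord w 0 0 * c') (j := slWord w 0 0 * c₁)
              (by push_cast; rw [hcc]; ring),
            Q.ψ_zpow_congr (i := -slWord w 1 1 * c') (j := slWord w 1 1 * c₁)
              (by push_cast; rw [hcc]; ring), inv_zpow, zpow_neg, inv_inv]
          have hcard : (Fintype.card A : ℂ) * Q.G (slWord w 1 0)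
              = Q.G (-slWord w 1 0) * Q.G 1 ^ 2 := by
            rw [← Q.G_mul_G_neg hc₁, ← hQ.G_sq hc0]; ring
          simp only [smul_eq_mul]
          field_simp
          linear_combination (Q.ψ x ^ (slWord w 0 0 * c₁) * Q.B x y ^ c₁ *
            Q.ψ y ^ (slWord w 1 1 * c₁)) * hcard
      | false =>
        obtain ⟨e00, e01, e10, e11⟩ := slWord_false_apply w
        rw [e00, e01, e10, e11, W_false]
        refine ⟨fun c' hc => ?_, fun hnc b' hb => ?_⟩
        · rw [ih1 c' hc, Matrix.mul_smul, Q.Tm_mul_K hc]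
        -- Neither formula yields `S T w` directly. By the braid relation `T S T (S T w) = S w`,
        -- which is known, and `T`, `S` are injective; so it suffices that the expected kernel, with
        -- lower left entry `a + c`, satisfies this equation.
        · have ha := hloc _ _ hcop hnc
          obtain ⟨a', ha'⟩ := zmod_unit_iff.2 ha.1
          have h2 := ih2 hnc a' ha'
          set a := slWord w 0 0
          set c := slWord w 1 0
          have hbr : Q.Tm * (Q.Sm * (Q.Tm * (Q.Sm * (Q.Tm * Q.W w)))) = Q.Sm * Q.W w := by
            have := congrArg (· * Q.W w) Q.braid
            simpa only [Matrix.mul_assoc] using this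
          refine Q.Tm_mul_left_injective (Q.Sm_mul_left_injective (Q.Tm_mul_left_injective ?_))
          rw [hbr, h2, Matrix.mul_smul, Q.Tm_mul_K hb,
            step (-c + (a + c)) (-slWord w 1 1 + (slWord w 0 1 + slWord w 1 1)) (a + c)
              (slWord w 0 1 + slWord w 1 1) a' b' hb
              (by rw [neg_add_cancel_comm_assoc]; exact ha') (by linear_combination hdet),
            Matrix.mul_smul, Q.Tm_mul_K (c := a) ha']
          congr 2
          · ring_nf
          · ring
          · ring
  exact fun w => (main w).1

end FinQuad

/-! ### Orthogonal splitting and reduction to prime power level. -/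

namespace FinQuad

/-- The `m`-torsion subgroup. -/
def tors (A : Type*) [AddCommGroup A] (m : ℕ) : AddSubgroup A :=
  (zsmulAddGroupHom (α := A) (m : ℤ)).ker

theorem mem_tors {A : Type*} [AddCommGroup A] {m : ℕ} {x : A} :
    x ∈ tors A m ↔ (m : ℤ) • x = 0 := Iff.rfl

variable {A : Type*} [AddCommGroup A] {n n₁ n₂ : ℕ}

theorem B_eq_one_of_coprime (Q : FinQuad A n) (h : n₁.Coprime n₂) {x y : A} (hx : x ∈ tors A n₁)
    (hy : y ∈ tors A n₂) : Q.B x y = 1 := by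
  have h1 : Q.B x y ^ n₁ = 1 := by
    rw [← zpow_natCast, ← Q.B_zsmul, mem_tors.1 hx, Q.B_zero]
  have h2 : Q.B x y ^ n₂ = 1 := by
    rw [← zpow_natCast, ← Q.B_zsmul_right, mem_tors.1 hy, Q.B_comm, Q.B_zero]
  exact (pow_eq_one_iff_of_coprime h).1 ⟨h1, h2⟩

/-- `A` is the direct sum of its torsion subgroups for coprime factors of its level. -/
def splitEquiv (Q : FinQuad A n) (hn : n = n₁ * n₂) (h : n₁.Coprime n₂) :
    tors A n₁ × tors A n₂ ≃ A := by
  refine Equiv.ofBijective (fun p => (p.1 : A) + p.2) ⟨?_, ?_⟩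
  · rintro ⟨x, y⟩ ⟨x', y'⟩ hxy
    have hxy' : (x : A) - x' = y' - y := by
      have : (x : A) + y = x' + y' := hxy
      rw [sub_eq_sub_iff_add_eq_add, this, add_comm]
    obtain ⟨u, v, huv⟩ := Nat.isCoprime_iff_coprime.2 h
    have h0 : (x : A) - x' = 0 := by
      have h1 : (n₁ : ℤ) • ((x : A) - x') = 0 := mem_tors.1 (x - x').2
      have h2 : (n₂ : ℤ) • ((x : A) - x') = 0 := by rw [hxy']; exact mem_tors.1 (y' - y).2
      rw [← one_zsmul ((x : A) - x'), ← huv, add_zsmul, mul_zsmul, mul_zsmul, h1, h2]; simp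
    rw [h0] at hxy'
    exact Prod.ext (Subtype.ext (sub_eq_zero.1 h0)) (Subtype.ext (sub_eq_zero.1 hxy'.symm).symm)
  · intro z
    obtain ⟨u, v, huv⟩ := Nat.isCoprime_iff_coprime.2 h
    have hz := Q.zsmul_eq_zero z
    rw [hn] at hz
    push_cast at hz
    refine ⟨(⟨(v * n₂) • z, ?_⟩, ⟨(u * n₁) • z, ?_⟩), ?_⟩
    · rw [mem_tors, ← mul_zsmul, show (n₁ : ℤ) * (v * n₂) = v * (n₁ * n₂) by ring, mul_zsmul, hz,
        zsmul_zero]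
    · rw [mem_tors, ← mul_zsmul, show (n₂ : ℤ) * (u * n₁) = u * (n₁ * n₂) by ring, mul_zsmul, hz,
        zsmul_zero]
    · change (v * n₂) • z + (u * n₁) • z = z
      rw [← add_zsmul, add_comm, huv, one_zsmul]

theorem splitEquiv_apply (Q : FinQuad A n) (hn : n = n₁ * n₂) (h : n₁.Coprime n₂)
    (p : tors A n₁ × tors A n₂) : Q.splitEquiv hn h p = (p.1 : A) + p.2 := rfl

/-- The quadratic module on a torsion subgroup for a coprime factor of the level. -/
def sub (Q : FinQuad A n) (hn : n = n₁ * n₂) (h : n₁.Coprime n₂) : FinQuad (tors A n₁) n₁ where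
  ψ x := Q.ψ x
  B x y := Q.B x y
  ψ_add x y := Q.ψ_add x y
  B_add x y z := Q.B_add x y z
  B_comm x y := Q.B_comm x y
  ψ_neg x := Q.ψ_neg x
  ψ_pow x := by
    have h1 : Q.ψ x ^ (n₁ * n₁) = 1 := by
      have := Q.ψ_zsmul n₁ x
      rw [mem_tors.1 x.2, Q.ψ_zero] at this
      rw [this]; norm_cast
    have h2 : Q.ψ x ^ (n₁ * n₂) = 1 :=
      (congrArg (Q.ψ x ^ ·) hn).symm.trans (Q.ψ_pow x)
    rw [pow_mul] at h1 h2
    exact (pow_eq_one_iff_of_coprime h).1 ⟨h1, h2⟩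
  nondeg x hx := by
    refine Subtype.ext (Q.nondeg _ fun z => ?_)
    obtain ⟨⟨y, y'⟩, rfl⟩ := (Q.splitEquiv hn h).surjective z
    rw [splitEquiv_apply, Q.B_add_right, hx, Q.B_eq_one_of_coprime h x.2 y'.2, one_mul]
  n_pos := Nat.pos_of_ne_zero fun h0 => Q.n_pos.ne' (by rw [hn, h0, zero_mul])

variable [Fintype A] [DecidableEq A] (Q : FinQuad A n)

section split

variable (hn : n = n₁ * n₂) (hn' : n = n₂ * n₁) (h : n₁.Coprime n₂)
  [Fintype (tors A n₁)] [Fintype (tors A n₂)]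

theorem ψ_split (x : tors A n₁) (y : tors A n₂) :
    Q.ψ (x + y) = (Q.sub hn h).ψ x * (Q.sub hn' h.symm).ψ y := by
  rw [Q.ψ_add, Q.B_eq_one_of_coprime h x.2 y.2, mul_one]; rfl

theorem B_split (x x' : tors A n₁) (y y' : tors A n₂) :
    Q.B (x + y) (x' + y') = (Q.sub hn h).B x x' * (Q.sub hn' h.symm).B y y' := by
  rw [Q.B_add, Q.B_add_right, Q.B_add_right, Q.B_eq_one_of_coprime h x.2 y'.2,
    Q.B_eq_one_of_coprime h.symm y.2 x'.2, mul_one, one_mul]; rfl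

theorem G_split (m : ℤ) : Q.G m = (Q.sub hn h).G m * (Q.sub hn' h.symm).G m := by
  rw [G, G, G, Finset.sum_mul_sum, ← Fintype.sum_prod_type']
  refine (Fintype.sum_equiv (Q.splitEquiv hn h) _ _ fun p => ?_).symm
  rw [splitEquiv_apply, Q.ψ_split hn hn' h, mul_zpow]

theorem W_split (w : List Bool) (x x' : tors A n₁) (y y' : tors A n₂) :
    Q.W w (x + y) (x' + y') = (Q.sub hn h).W w x x' * (Q.sub hn' h.symm).W w y y' := by
  induction w generalizing x y with
  | nil =>
    simp only [W_nil, Matrix.one_apply]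
    have : ((x : A) + y = x' + y') ↔ (x = x' ∧ y = y') := by
      rw [← Prod.mk.injEq]
      exact (Q.splitEquiv hn h).injective.eq_iff (a := (x, y)) (b := (x', y'))
    simp only [this]
    split_ifs <;> simp_all
  | cons b w ih =>
    cases b with
    | true =>
      simp only [W_true, Matrix.mul_apply, Finset.sum_mul_sum]
      rw [← Fintype.sum_prod_type']
      refine (Fintype.sum_equiv (Q.splitEquiv hn h) _ _ fun p => ?_).symm
      rw [splitEquiv_apply, ih, Sm, Sm, Sm, Q.B_split hn hn' h, Q.G_split hn hn' h, mul_inv,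
        mul_inv]
      ring
    | false =>
      simp only [W_false, Tm, Matrix.diagonal_mul]
      rw [ih, Q.ψ_split hn hn' h]
      ring

variable {Q}

theorem WeilFormula.of_split (h₁ : (Q.sub hn h).WeilFormula)
    (h₂ : (Q.sub hn' h.symm).WeilFormula) : Q.WeilFormula := by
  intro w c' hc
  have hcop := zmod_unit_iff.1 ⟨_, hc⟩
  have hd := (ZMod.intCast_eq_intCast_iff_dvd_sub _ _ n).1 hc
  have k₁ := h₁ w c' ((ZMod.intCast_eq_intCast_iff_dvd_sub _ _ n₁).2
    (dvd_trans ⟨n₂, by rw [hn]; push_cast; ring⟩ hd))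
  have k₂ := h₂ w c' ((ZMod.intCast_eq_intCast_iff_dvd_sub _ _ n₂).2
    (dvd_trans ⟨n₁, by rw [hn]; push_cast; ring⟩ hd))
  ext z z'
  obtain ⟨⟨x, y⟩, rfl⟩ := (Q.splitEquiv hn h).surjective z
  obtain ⟨⟨x', y'⟩, rfl⟩ := (Q.splitEquiv hn h).surjective z'
  rw [splitEquiv_apply, splitEquiv_apply, Q.W_split hn hn' h, k₁, k₂]
  simp only [Matrix.smul_apply, smul_eq_mul, K]
  rw [Q.ψ_split hn hn' h, Q.ψ_split hn hn' h, Q.B_split hn hn' h, Q.G_split hn hn' h,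
    Q.G_split hn hn' h]
  simp only [mul_zpow]
  ring

theorem card_split (Q : FinQuad A n) (hn : n = n₁ * n₂) (h : n₁.Coprime n₂) :
    (Fintype.card A : ℂ) = Fintype.card (tors A n₁) * Fintype.card (tors A n₂) := by
  rw [← Nat.cast_mul, ← Fintype.card_prod, Fintype.card_congr (Q.splitEquiv hn h)]

/-- Gauss sums and cardinalities are multiplicative in the splitting, so the second sign is the
quotient of the first two. -/
theorem IsEven.of_split (hQ : Q.IsEven) (h₁ : (Q.sub hn h).IsEven) :
    (Q.sub hn' h.symm).IsEven := by
  obtain ⟨ε, hε, e⟩ := hQ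
  obtain ⟨δ, hδ, d⟩ := h₁
  refine ⟨ε * δ, ?_, ?_⟩
  · rcases hε with rfl | rfl <;> rcases hδ with rfl | rfl <;> simp
  · rw [Q.G_split hn hn' h, mul_pow, d, card_split Q hn h] at e
    have hc : (Fintype.card (tors A n₁) : ℂ) ≠ 0 := card_ne_zero
    refine mul_left_cancel₀ hc ?_
    have hδ2 : (δ : ℂ) * δ = 1 := by rcases hδ with rfl | rfl <;> simp
    push_cast
    linear_combination (δ : ℂ) * e - Fintype.card (tors A n₁) * (Q.sub hn' h.symm).G 1 ^ 2 * hδ2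

end split

/-- For odd `n` the class `-1` is a sum `a² + b²` modulo `n`. The rotation by `(a, b)` of `A × A`
changes the sign of the form, so `G 1 ^ 2 = G (-1) ^ 2`, while `G 1 * G (-1) = |A|`. -/
theorem isEven_of_odd (hn : Odd n) : Q.IsEven := by
  have hcop : Nat.Coprime n 4 := by
    rw [show 4 = 2 ^ 2 by norm_num]
    exact Nat.Coprime.pow_right 2 (Nat.coprime_two_right.2 hn)
  have hn0 : NeZero (n * 4) := ⟨by have := Q.n_pos; positivity⟩
  -- Dirichlet's theorem gives a prime that is `-1` modulo `n` and `1` modulo `4`; by Fermat it is a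
  -- sum of two squares.
  obtain ⟨u, hu1, hu2⟩ := Nat.chineseRemainder hcop (n - 1) 1
  have hu : IsUnit ((u : ℕ) : ZMod (n * 4)) := by
    rw [ZMod.isUnit_iff_coprime]
    refine Nat.Coprime.mul_right ?_ ?_
    · have h1 : Nat.gcd u n = Nat.gcd (n - 1) n := Nat.ModEq.gcd_eq hu1
      rw [Nat.Coprime, h1]
      exact (Nat.coprime_self_sub_left (Nat.one_le_iff_ne_zero.2 Q.n_pos.ne')).2 (by simp)
    · have h1 : Nat.gcd u 4 = Nat.gcd 1 4 := Nat.ModEq.gcd_eq hu2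
      rw [Nat.Coprime, h1]; simp
  obtain ⟨P, -, hP, hPu⟩ := Nat.forall_exists_prime_gt_and_eq_mod hu 0
  have hPu' := (ZMod.natCast_eq_natCast_iff _ _ _).1 hPu
  have hPn : ((P : ℤ) : ZMod n) = (-1 : ℤ) := by
    have h2 : P ≡ n - 1 [MOD n] := (hPu'.of_mul_right 4).trans hu1
    have := (ZMod.natCast_eq_natCast_iff _ _ _).2 h2
    rw [Int.cast_natCast, this, Nat.cast_sub Q.n_pos]; simp
  have hP4 : P % 4 ≠ 3 := by
    have h2 : P ≡ 1 [MOD 4] := (hPu'.of_mul_left n).trans hu2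
    rw [h2]; norm_num
  have := Fact.mk hP
  obtain ⟨a, b, hab⟩ := Nat.Prime.sq_add_sq hP4
  have hab' : ((a : ZMod n) ^ 2 + (b : ZMod n) ^ 2) = -1 := by
    have : ((P : ℤ) : ZMod n) = (a : ZMod n) ^ 2 + (b : ZMod n) ^ 2 := by rw [← hab]; push_cast; rfl
    rw [← this, hPn]; push_cast; rfl
  have rot : Q.G 1 ^ 2 = Q.G (-1) ^ 2 := by
    rw [sq, sq, G, G, Finset.sum_mul_sum, Finset.sum_mul_sum, ← Fintype.sum_prod_type',
      ← Fintype.sum_prod_type']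
    let e : A × A ≃ A × A :=
      { toFun := fun p => ((a : ℤ) • p.1 - (b : ℤ) • p.2, (b : ℤ) • p.1 + (a : ℤ) • p.2)
        invFun := fun p => (-((a : ℤ) • p.1 + (b : ℤ) • p.2), -(-((b : ℤ) • p.1) + (a : ℤ) • p.2))
        left_inv := fun p => by
          have h1 : ∀ x : A, ((a : ℤ) * a + b * b) • x = -x := fun x => by
            rw [Q.zsmul_congr (j := -1) (by push_cast; linear_combination hab') x]; simp
          have h2 := h1 p.1
          have h3 := h1 p.2
          refine Prod.ext ?_ ?_
          · change -((a : ℤ) • ((a : ℤ) • p.1 - (b : ℤ) • p.2)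
              + (b : ℤ) • ((b : ℤ) • p.1 + (a : ℤ) • p.2)) = p.1
            rw [neg_eq_iff_eq_neg, ← h2]
            module
          · change -(-((b : ℤ) • ((a : ℤ) • p.1 - (b : ℤ) • p.2))
              + (a : ℤ) • ((b : ℤ) • p.1 + (a : ℤ) • p.2)) = p.2
            rw [neg_eq_iff_eq_neg, ← h3]
            module
        right_inv := fun p => by
          have h1 : ∀ x : A, ((a : ℤ) * a + b * b) • x = -x := fun x => by
            rw [Q.zsmul_congr (j := -1) (by push_cast; linear_combination hab') x]; simp
          have h2 := h1 p.1
          have h3 := h1 p.2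
          refine Prod.ext ?_ ?_
          · change (a : ℤ) • (-((a : ℤ) • p.1 + (b : ℤ) • p.2))
              - (b : ℤ) • (-(-((b : ℤ) • p.1) + (a : ℤ) • p.2)) = p.1
            rw [← neg_inj, ← h2]
            module
          · change (b : ℤ) • (-((a : ℤ) • p.1 + (b : ℤ) • p.2))
              + (a : ℤ) • (-(-((b : ℤ) • p.1) + (a : ℤ) • p.2)) = p.2
            rw [← neg_inj, ← h3]
            module }
    refine (Fintype.sum_equiv e _ _ fun p => ?_).symm
    obtain ⟨x, y⟩ := p
    change Q.ψ x ^ (-1 : ℤ) * Q.ψ y ^ (-1 : ℤ)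
      = Q.ψ ((a : ℤ) • x - (b : ℤ) • y) ^ (1 : ℤ) * Q.ψ ((b : ℤ) • x + (a : ℤ) • y) ^ (1 : ℤ)
    rw [zpow_one, zpow_one, sub_eq_add_neg, Q.ψ_add, Q.ψ_add, Q.ψ_neg, Q.B_comm _ (-_), Q.B_neg,
      Q.B_zsmul, Q.B_zsmul_right, Q.B_zsmul, Q.B_zsmul_right, Q.ψ_zsmul, Q.ψ_zsmul, Q.ψ_zsmul,
      Q.ψ_zsmul, Q.B_comm y x, ← zpow_mul]
    have hB := zpow_ne_zero ((a : ℤ) * b) (Q.B_ne_zero x y)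
    have hx : ∀ x, Q.ψ x ^ (-1 : ℤ) = Q.ψ x ^ ((a : ℤ) * a) * Q.ψ x ^ ((b : ℤ) * b) := fun x => by
      rw [← zpow_add₀ (Q.ψ_ne_zero x)]
      refine Q.ψ_zpow_congr ?_ x
      push_cast; linear_combination -hab'
    rw [hx x, hx y]
    field_simp
  have hcard := Q.G_mul_G_neg (m := 1) (m' := 1) (by simp)
  have h4 : (Q.G 1 ^ 2) ^ 2 = (Fintype.card A : ℂ) ^ 2 := by
    rw [← hcard, mul_pow, ← rot]; ring
  rcases sq_eq_sq_iff_eq_or_eq_neg.1 h4 with h5 | h5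
  · exact ⟨1, .inl rfl, by simp [h5]⟩
  · exact ⟨-1, .inr rfl, by simp [h5]⟩

end FinQuad

/-- For `n = p ^ r` the local condition holds: if `p ∣ c` and `a`, `c` are coprime, then `p` divides
neither `a` nor `a + c`. Of two coprime factors one is odd, so `isEven_of_odd` applies to its part,
and the other part inherits `IsEven` from the whole. -/
theorem FinQuad.IsEven.weilFormula {n : ℕ} {A : Type*} [AddCommGroup A] [Fintype A] [DecidableEq A]
    {Q : FinQuad A n} (hQ : Q.IsEven) : Q.WeilFormula := by
  classical
  induction n using Nat.recOnPosPrimePosCoprime generalizing A with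
  | zero => exact absurd Q.n_pos (lt_irrefl 0)
  | one =>
    refine hQ.weilFormula_of_local fun a c _ hc => absurd ?_ hc
    simpa using isCoprime_one_right
  | prime_pow p r hp hr =>
    refine hQ.weilFormula_of_local fun a c hac hc => ?_
    have hp' : Prime (p : ℤ) := Nat.prime_iff_prime_int.1 hp
    have key : ∀ z : ℤ, IsCoprime z ((p ^ r : ℕ) : ℤ) ↔ ¬ (p : ℤ) ∣ z := fun z => by
      push_cast
      rw [IsCoprime.pow_right_iff hr, isCoprime_comm, (Prime.irreducible hp').coprime_iff_not_dvd]
    rw [key, not_not] at hc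
    rw [key, key]
    have ha : ¬ (p : ℤ) ∣ a := fun h => hp'.not_isUnit (hac.isUnit_of_dvd' h hc)
    exact ⟨ha, fun h => ha ((dvd_add_left hc).1 h)⟩
  | coprime a b ha hb hab iha ihb =>
    have key : ∀ (a b : ℕ), Odd a → a.Coprime b → ∀ {Q : FinQuad A (a * b)}, Q.IsEven →
        (∀ {A : Type _} [AddCommGroup A] [Fintype A] [DecidableEq A] {Q : FinQuad A a},
          Q.IsEven → Q.WeilFormula) →
        (∀ {A : Type _} [AddCommGroup A] [Fintype A] [DecidableEq A] {Q : FinQuad A b},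
          Q.IsEven → Q.WeilFormula) → Q.WeilFormula := by
      intro a b hodd hab Q hQ iha ihb
      have h1 : (Q.sub rfl hab).IsEven := isEven_of_odd _ hodd
      exact WeilFormula.of_split rfl (mul_comm a b) hab (iha h1)
        (ihb (hQ.of_split rfl (mul_comm a b) hab h1))
    rcases Nat.even_or_odd a with hev | hodd
    · have hbo : Odd b := by
        rw [← Nat.not_even_iff_odd]
        intro hbe
        have := Nat.dvd_gcd hev.two_dvd hbe.two_dvd
        rw [hab] at this
        omega
      have e := mul_comm a b
      revert Q
      rw [e]
      intro Q hQ
      exact key b a hbo hab.symm hQ ihb iha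
    · exact key a b hodd hab hQ iha ihb

/-! ### The discriminant form of an even lattice. -/

namespace EvenLattice

theorem e_add (x y : ℂ) : e (x + y) = e x * e y := by
  rw [e, e, e, ← Complex.exp_add, mul_add]

theorem e_zero : e 0 = 1 := by simp [e]

theorem e_ne_zero (x : ℂ) : e x ≠ 0 := Complex.exp_ne_zero _

theorem e_neg (x : ℂ) : e (-x) = (e x)⁻¹ := by rw [e, e, ← Complex.exp_neg, mul_neg]

theorem e_sub (x y : ℂ) : e (x - y) = e x / e y := by
  rw [sub_eq_add_neg, e_add, e_neg, div_eq_mul_inv]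

theorem e_eq_one_iff {x : ℂ} : e x = 1 ↔ ∃ m : ℤ, x = m := by
  rw [e, Complex.exp_eq_one_iff]
  have h : (2 * Real.pi * Complex.I : ℂ) ≠ 0 := Complex.two_pi_I_ne_zero
  refine exists_congr fun m => ⟨fun hm => ?_, fun hm => by rw [hm]; ring⟩
  exact mul_left_cancel₀ h (by rw [hm]; ring)

theorem e_int (m : ℤ) : e m = 1 := e_eq_one_iff.2 ⟨m, rfl⟩

theorem e_zmul (m : ℤ) (x : ℂ) : e (m * x) = e x ^ m := by
  rw [e, e, ← Complex.exp_int_mul]; ring_nf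

theorem e_nmul (m : ℕ) (x : ℂ) : e (m * x) = e x ^ m := by
  have := e_zmul m x
  simpa using this

theorem e_add_int (x : ℂ) (m : ℤ) : e (x + m) = e x := by rw [e_add, e_int, mul_one]

theorem norm_e (x : ℂ) : ‖e x‖ = Real.exp (-(2 * Real.pi * x.im)) := by
  rw [e, Complex.norm_exp]; congr 1; simp

theorem norm_e_rat (q : ℚ) : ‖e q‖ = 1 := by rw [norm_e]; simp

variable {V : Type*} [AddCommGroup V] [Module ℚ V] (L : EvenLattice V)

theorem finite_module (L : EvenLattice V) : Module.Finite ℚ V := by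
  obtain ⟨S, hS⟩ := L.fg
  refine ⟨⟨S, ?_⟩⟩
  rw [← top_le_iff, ← L.span_eq_top, Submodule.span_le, ← hS]
  exact Submodule.span_le_restrictScalars ℤ ℚ _

theorem polar_isSymm : LinearMap.BilinForm.IsSymm L.q.polarBilin :=
  ⟨fun x y => by simp [QuadraticMap.polarBilin_apply_apply, QuadraticMap.polar_comm]⟩

theorem polar_comm (x y : V) : L.q.polarBilin x y = L.q.polarBilin y x := by
  simp [QuadraticMap.polarBilin_apply_apply, QuadraticMap.polar_comm]

theorem q_add (x y : V) : L.q (x + y) = L.q x + L.q y + L.q.polarBilin x y := by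
  rw [QuadraticMap.polarBilin_apply_apply, QuadraticMap.polar]; ring

theorem mem_dual {x : V} : x ∈ L.dual ↔ ∀ y ∈ L.lattice, ∃ m : ℤ, L.q.polarBilin x y = m := by
  refine forall₂_congr fun y _ => ?_
  rw [Submodule.mem_one]
  exact exists_congr fun m => by simp [eq_comm]

/-- The dual of the dual lattice is the lattice. -/
theorem mem_lattice_of_dual {x : V} (h : ∀ y ∈ L.dual, ∃ m : ℤ, L.q.polarBilin x y = m) :
    x ∈ L.lattice := by
  have hfin : Module.Finite ℤ L.lattice := Module.Finite.iff_fg.2 L.fg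
  have : Module.IsTorsionFree ℤ L.lattice := by
    have : Module.IsTorsionFree ℤ V := Module.IsTorsionFree.trans_faithfulSMul ℤ ℚ V
    infer_instance
  let b₀ := Module.Free.chooseBasis ℤ L.lattice
  have hspan : Submodule.span ℤ (Set.range fun i => (b₀ i : V)) = L.lattice := by
    have h1 := congrArg (Submodule.map L.lattice.subtype) b₀.span_eq
    rw [Submodule.map_span, Submodule.map_top, Submodule.range_subtype, ← Set.range_comp] at h1
    exact h1
  have hli : LinearIndependent ℚ fun i => (b₀ i : V) := by
    rw [← LinearIndependent.iff_fractionRing ℤ ℚ]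
    exact b₀.linearIndependent.map' L.lattice.subtype (Submodule.ker_subtype _)
  have hsp : ⊤ ≤ Submodule.span ℚ (Set.range fun i => (b₀ i : V)) := by
    rw [← L.span_eq_top]
    refine Submodule.span_le.2 fun y hy => ?_
    have hy' : y ∈ Submodule.span ℤ (Set.range fun i => (b₀ i : V)) := by rw [hspan]; exact hy
    exact Submodule.span_le_restrictScalars ℤ ℚ _ hy'
  let b := Module.Basis.mk hli hsp
  have hb : Submodule.span ℤ (Set.range b) = L.lattice := by
    rw [Module.Basis.coe_mk, hspan]
  have h2 := LinearMap.BilinForm.dualSubmodule_dualSubmodule_of_basis (R := ℤ) L.q.polarBilin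
    L.nondegenerate L.polar_isSymm b
  rw [hb] at h2
  rw [← h2]
  intro y hy
  obtain ⟨m, hm⟩ := h y hy
  rw [Submodule.mem_one]
  exact ⟨m, by simp [hm]⟩

/-- The infimum is attained because the set is non-empty: `|D| x ∈ L` for `x ∈ L'`, hence `|D|² q(x)
∈ ℤ`. -/
theorem level_spec_aux : 0 < L.level ∧ ∀ x ∈ L.dual, ∃ m : ℤ, (L.level : ℚ) * L.q x = m := by
  have : {N : ℕ | 0 < N ∧ ∀ x ∈ L.dual, ∃ m : ℤ, (N : ℚ) * L.q x = m}.Nonempty := by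
    refine ⟨Nat.card L.Disc ^ 2, pow_pos Nat.card_pos 2, fun x hx => ?_⟩
    have h1 : Nat.card L.Disc • (Submodule.Quotient.mk ⟨x, hx⟩ : L.Disc) = 0 :=
      card_nsmul_eq_zero'
    rw [← Submodule.Quotient.mk_smul, Submodule.Quotient.mk_eq_zero] at h1
    have h2 : Nat.card L.Disc • x ∈ L.lattice := h1
    obtain ⟨m, hm⟩ := L.even _ h2
    refine ⟨m, ?_⟩
    rw [← hm, ← Nat.cast_smul_eq_nsmul ℚ, QuadraticMap.map_smul]
    push_cast
    rw [smul_eq_mul, sq]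
  exact Nat.sInf_mem this

theorem level_pos : 0 < L.level := L.level_spec_aux.1

theorem rep_mem (μ : L.Disc) : L.rep μ ∈ L.dual := (Quotient.out μ : L.dual).2

theorem mk_rep (μ : L.Disc) : (Submodule.Quotient.mk ⟨L.rep μ, L.rep_mem μ⟩ : L.Disc) = μ :=
  Quotient.out_eq μ

theorem e_qD_mk (x : L.dual) : e (L.qD (Submodule.Quotient.mk x)) = e (L.q (x : V)) := by
  obtain ⟨m, hm⟩ := L.mem_qCoset x
  rw [hm]; push_cast; rw [e_add_int]

theorem e_bD_mk (x y : L.dual) :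
    e (L.bD (Submodule.Quotient.mk x) (Submodule.Quotient.mk y)) = e (L.q.polarBilin (x : V) y) := by
  have hx := L.rep_sub_mem x
  have hy := L.rep_sub_mem y
  obtain ⟨a, ha⟩ := L.mem_dual.1 x.2 _ hy
  obtain ⟨b, hb⟩ := L.mem_dual.1 (L.rep_mem (Submodule.Quotient.mk y)) _ hx
  have : L.q.polarBilin (x : V) y
      = L.bD (Submodule.Quotient.mk x) (Submodule.Quotient.mk y) + ((a + b : ℤ) : ℚ) := by
    push_cast
    rw [← ha, ← hb, bD, L.polar_comm (L.rep (Submodule.Quotient.mk y)), map_sub, map_sub,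
      LinearMap.sub_apply]
    ring
  rw [this, Rat.cast_add, Rat.cast_intCast, e_add_int]

/-- The discriminant form of an even lattice as a finite quadratic module. -/
def discQuad (n : ℕ) (hn : L.level ∣ n) (hn0 : 0 < n) : FinQuad L.Disc n where
  ψ μ := e (L.qD μ)
  B μ ν := e (L.bD μ ν)
  ψ_add μ ν := by
    obtain ⟨x, rfl⟩ := Submodule.Quotient.mk_surjective _ μ
    obtain ⟨y, rfl⟩ := Submodule.Quotient.mk_surjective _ ν
    rw [← Submodule.Quotient.mk_add, e_qD_mk, e_qD_mk, e_qD_mk, e_bD_mk, Submodule.coe_add, q_add,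
      ← e_add, ← e_add]
    push_cast; rfl
  B_add μ ν κ := by
    obtain ⟨x, rfl⟩ := Submodule.Quotient.mk_surjective _ μ
    obtain ⟨y, rfl⟩ := Submodule.Quotient.mk_surjective _ ν
    obtain ⟨z, rfl⟩ := Submodule.Quotient.mk_surjective _ κ
    rw [← Submodule.Quotient.mk_add, e_bD_mk, e_bD_mk, e_bD_mk, Submodule.coe_add, map_add,
      LinearMap.add_apply, ← e_add]
    push_cast; rfl
  B_comm μ ν := by rw [bD, bD, polar_comm]
  ψ_neg μ := by
    obtain ⟨x, rfl⟩ := Submodule.Quotient.mk_surjective _ μ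
    rw [← Submodule.Quotient.mk_neg, e_qD_mk, e_qD_mk, Submodule.coe_neg, QuadraticMap.map_neg]
  ψ_pow μ := by
    obtain ⟨m, hm⟩ := L.level_spec_aux.2 _ (L.rep_mem μ)
    obtain ⟨r, rfl⟩ := hn
    rw [← e_nmul, e_eq_one_iff]
    refine ⟨r * m, ?_⟩
    have hm' : ((L.level : ℂ)) * L.qD μ = m := by exact_mod_cast congrArg (Rat.cast (K := ℂ)) hm
    push_cast
    rw [← hm']; ring
  nondeg μ h := by
    have h1 : L.rep μ ∈ L.lattice := by
      refine L.mem_lattice_of_dual fun y hy => ?_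
      have h2 := h (Submodule.Quotient.mk ⟨y, hy⟩)
      rw [← L.mk_rep μ, e_bD_mk, e_eq_one_iff] at h2
      obtain ⟨m, hm⟩ := h2
      exact ⟨m, by exact_mod_cast hm⟩
    rw [← L.mk_rep μ, Submodule.Quotient.mk_eq_zero]
    exact h1
  n_pos := hn0

/-- The radical vanishes, so the rank is `b⁺ + b⁻`, which has the parity of `b⁺ - b⁻`. The theorem
distinguishes by rank, the analysis by signature. -/
theorem even_rank_iff : Even L.rank ↔ Even L.sig := by
  have := L.finite_module
  have h := QuadraticForm.sigPos_add_sigNeg_add_radical (Q := L.q)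
  have hr : L.q.radical = ⊥ := by
    rw [eq_bot_iff]
    intro x hx
    have : ∀ y, L.q.polarBilin x y = 0 := fun y => by
      have := (QuadraticMap.mem_radical_iff'.1 hx).2 y
      rw [QuadraticMap.polarBilin_apply_apply, QuadraticMap.polar, this,
        (QuadraticMap.mem_radical_iff'.1 hx).1]
      ring
    exact L.nondegenerate.1 x this
  rw [hr, finrank_bot, add_zero] at h
  rw [rank, sig, ← h, ← Int.even_coe_nat, Nat.cast_add, Int.even_add, Int.even_sub]

end EvenLattice

/-! ### Automorphy factors on the principal branch -/

theorem Complex.arg_mem_Ioo_of_im_pos {z : ℂ} (h : 0 < z.im) : 0 < z.arg ∧ z.arg < Real.pi := by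
  refine ⟨lt_of_le_of_ne (Complex.arg_nonneg_iff.2 h.le) fun h0 => ?_,
    Complex.arg_lt_pi_iff.2 (.inr h.ne')⟩
  exact h.ne' (Complex.arg_eq_zero_iff.1 h0.symm).2

theorem Complex.im_mul_nonpos_of_arg {a b : ℂ} (ha0 : a ≠ 0) (hb0 : b ≠ 0)
    (h₁ : Real.pi < a.arg + b.arg) (h₂ : a.arg + b.arg < 2 * Real.pi) : (a * b).im ≤ 0 := by
  have h1 : Real.sin (a.arg + b.arg) < 0 := by
    rw [← Real.sin_sub_two_pi]
    exact Real.sin_neg_of_neg_of_neg_pi_lt (by linarith) (by linarith)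
  have h2 : (a * b).im = ‖a‖ * ‖b‖ * Real.sin (a.arg + b.arg) := by
    rw [Real.sin_add, Complex.mul_im, Complex.sin_arg, Complex.sin_arg, Complex.cos_arg ha0,
      Complex.cos_arg hb0]
    have := norm_ne_zero_iff.2 ha0
    have := norm_ne_zero_iff.2 hb0
    field_simp
    ring
  rw [h2]
  exact mul_nonpos_of_nonneg_of_nonpos (by positivity) h1.le

/-- The arguments lie between `0` and `π`; a sum above `π` would put the product outside the upper
half plane, so no branch is crossed. -/
theorem Complex.mul_cpow_of_im_pos {a b : ℂ} (ha : 0 < a.im) (hb : 0 < b.im) (hab : 0 < (a * b).im)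
    (k : ℂ) : (a * b) ^ k = a ^ k * b ^ k := by
  have ha0 : a ≠ 0 := fun h => by simp [h] at ha
  have hb0 : b ≠ 0 := fun h => by simp [h] at hb
  obtain ⟨a1, a2⟩ := Complex.arg_mem_Ioo_of_im_pos ha
  obtain ⟨b1, b2⟩ := Complex.arg_mem_Ioo_of_im_pos hb
  have hmem : a.arg + b.arg ∈ Set.Ioc (-Real.pi) Real.pi := by
    refine ⟨by linarith [Real.pi_pos], ?_⟩
    by_contra! hc
    exact absurd hab (not_lt.2 (Complex.im_mul_nonpos_of_arg ha0 hb0 hc (by linarith)))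
  rw [Complex.cpow_def_of_ne_zero (mul_ne_zero ha0 hb0), Complex.cpow_def_of_ne_zero ha0,
    Complex.cpow_def_of_ne_zero hb0, ← Complex.exp_add, (Complex.log_mul_eq_add_log_iff ha0 hb0).2
    hmem, add_mul]

/-- On the upper half plane `log (-1 / z) = π i - log z` for principal logarithms. -/
theorem Complex.neg_one_div_cpow_mul {z : ℂ} (hz : 0 < z.im) (k : ℂ) :
    (-1 / z) ^ k * z ^ k = Complex.exp (Real.pi * Complex.I * k) := by
  have hz0 : z ≠ 0 := fun h => by simp [h] at hz
  have hz1 : -1 / z ≠ 0 := div_ne_zero (neg_ne_zero.2 one_ne_zero) hz0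
  obtain ⟨a1, a2⟩ := Complex.arg_mem_Ioo_of_im_pos hz
  have h1 : Complex.exp (Real.pi * Complex.I - Complex.log z) = -1 / z := by
    rw [Complex.exp_sub, Complex.exp_pi_mul_I, Complex.exp_log hz0]
  have h2 : Complex.log (-1 / z) = Real.pi * Complex.I - Complex.log z := by
    rw [← h1, Complex.log_exp] <;> simp [Complex.log_im] <;> linarith
  rw [Complex.cpow_def_of_ne_zero hz1, Complex.cpow_def_of_ne_zero hz0, ← Complex.exp_add, h2]
  ring_nf

theorem Complex.im_neg_one_div_pos {z : ℂ} (hz : 0 < z.im) : 0 < (-1 / z).im := by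
  have hz0 : z ≠ 0 := fun h => by simp [h] at hz
  rw [neg_div, Complex.neg_im, one_div, Complex.inv_im, neg_div, neg_neg]
  exact div_pos hz (Complex.normSq_pos.2 hz0)

/-! ### Vector valued forms and their transformation under `SL₂(ℤ)`. -/

namespace FinQuad

variable {A : Type*} [AddCommGroup A] {n : ℕ} [Fintype A] [DecidableEq A] (Q : FinQuad A n)

/-- The transformation laws under `T` and `S` in weight `k`, up to a scalar `s` in the latter. -/
structure IsWeil (s : ℂ) (k : ℝ) (F : ℂ → A → ℂ) : Prop where
  map_T : ∀ z : ℂ, 0 < z.im → ∀ x, F (z + 1) x = Q.ψ x * F z x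
  map_S : ∀ z : ℂ, 0 < z.im → F (-1 / z) = (z ^ (k : ℂ)) • s • (Q.Sm.mulVec (F z))

variable {Q}

/-- A non-zero vector valued modular form exists only for the normalisation of `S` by the
Gauss sum. -/
theorem IsWeil.scalar_eq_one {s : ℂ} (hs : s ≠ 0) {k : ℝ} {F : ℂ → A → ℂ} (hF : Q.IsWeil s k F)
    {z : ℂ} (hz : 0 < z.im) (hFz : F z ≠ 0) : s = 1 := by
  have hz0 : z ≠ 0 := fun h => by simp [h] at hz
  have him1 : 0 < (z + 1).im := by simpa using hz
  have hz1 : z + 1 ≠ 0 := fun h => by simp [h] at him1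
  have hT : ∀ z : ℂ, 0 < z.im → F (z + 1) = Q.Tm.mulVec (F z) := fun z hz => by
    ext x; rw [hF.map_T z hz, Tm, Matrix.mulVec_diagonal]
  have him2 := Complex.im_neg_one_div_pos him1
  have him3 : 0 < (-1 / (z + 1) + 1).im := by simpa using him2
  have hprod : (-1 / (z + 1) + 1) * (z + 1) = z := by field_simp; ring
  -- `TSTST` and `S` act equally on `z`. The first path uses `S` twice and the second once; the
  -- automorphy factors and matrices agree, so comparison gives `s² = s`.
  have e1 : -1 / (-1 / (z + 1) + 1) + 1 = -1 / z := by
    have : -1 / (z + 1) + 1 = z / (z + 1) := by field_simp; ring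
    rw [this]; field_simp; ring
  have h1 := hF.map_S z hz
  rw [← e1, hT _ (Complex.im_neg_one_div_pos him3), hF.map_S _ him3, hT _ him2, hF.map_S _ him1,
    hT _ hz] at h1
  simp only [Matrix.mulVec_smul, Matrix.mulVec_mulVec, smul_smul] at h1
  rw [Q.braid] at h1
  have hpow := Complex.mul_cpow_of_im_pos him3 him1 (by rw [hprod]; exact hz) (k : ℂ)
  rw [hprod] at hpow
  have hzk : z ^ (k : ℂ) ≠ 0 := by simp [hz0]
  have hcoef : ((-1 / (z + 1) + 1) ^ (k : ℂ) * (s * ((z + 1) ^ (k : ℂ) * s))) =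
      z ^ (k : ℂ) * s * s := by rw [hpow]; ring
  obtain ⟨x, hx⟩ : ∃ x, Q.Sm.mulVec (F z) x ≠ 0 := by
    by_contra! hc
    have h0 : Q.Sm.mulVec (F z) = 0 := funext hc
    have h2 : Q.Sm.mulVec (Q.Sm.mulVec (F z)) = 0 := by rw [h0, Matrix.mulVec_zero]
    refine hFz (funext fun x => ?_)
    have h3 := congrFun h2 (-x)
    rw [Matrix.mulVec_mulVec, Q.Sm_mul_Sm, Matrix.mulVec, dotProduct,
      Finset.sum_eq_single x] at h3
    · have : (Fintype.card A : ℂ) / Q.G 1 ^ 2 ≠ 0 :=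
        div_ne_zero card_ne_zero (pow_ne_zero 2 Q.G_one_ne_zero)
      simpa [this] using h3
    · intro y _ hy
      rw [Matrix.of_apply, if_neg, zero_mul]
      intro h; exact hy (neg_add_eq_zero.1 h).symm
    · simp
  have h4 := congrFun h1 x
  simp only [Pi.smul_apply, smul_eq_mul] at h4
  have h5 : z ^ (k : ℂ) * s * Q.Sm.mulVec (F z) x * (s - 1) = 0 := by
    have : ((-1 / (z + 1) + 1) ^ (k : ℂ) * (s * ((z + 1) ^ (k : ℂ) * s))) * Q.Sm.mulVec (F z) x
      = z ^ (k : ℂ) * s * Q.Sm.mulVec (F z) x := by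
        convert h4 using 1
    rw [hcoef] at this
    linear_combination this
  have h6 : z ^ (k : ℂ) * s * Q.Sm.mulVec (F z) x ≠ 0 := mul_ne_zero (mul_ne_zero hzk hs) hx
  exact sub_eq_zero.1 ((mul_eq_zero.1 h5).resolve_left h6)

/-- Apply `S` twice: the point returns, while `Sm * Sm` is a multiple of `x ↦ -x`. -/
theorem IsWeil.map_neg {k : ℝ} {F : ℂ → A → ℂ} (hF : Q.IsWeil 1 k F) {z : ℂ} (hz : 0 < z.im)
    (x : A) : F z x = Complex.exp (Real.pi * Complex.I * k) *
      (Fintype.card A / Q.G 1 ^ 2) * F z (-x) := by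
  have hz0 : z ≠ 0 := fun h => by simp [h] at hz
  have h1 := hF.map_S _ (Complex.im_neg_one_div_pos hz)
  have e1 : -1 / (-1 / z) = z := by field_simp
  rw [e1, hF.map_S z hz] at h1
  have h2 := congrFun h1 x
  simp only [one_smul, Matrix.mulVec_smul, Matrix.mulVec_mulVec, Pi.smul_apply, smul_eq_mul] at h2
  have h3 : (Q.Sm * Q.Sm).mulVec (F z) x = Fintype.card A / Q.G 1 ^ 2 * F z (-x) := by
    rw [Q.Sm_mul_Sm, Matrix.mulVec, dotProduct, Finset.sum_eq_single (-x)]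
    · simp
    · intro y _ hy
      rw [Matrix.of_apply, if_neg, zero_mul]
      intro h; exact hy (by rw [eq_neg_iff_add_eq_zero, add_comm]; exact h)
    · simp
  rw [h2, h3, ← mul_assoc, Complex.neg_one_div_cpow_mul hz]
  ring

theorem _root_.slWord_im_pos (w : List Bool) {z : ℂ} (hz : 0 < z.im) :
    0 < ((slWord w 0 0 * z + slWord w 0 1) / (slWord w 1 0 * z + slWord w 1 1)).im ∧
      (slWord w 1 0 * z + slWord w 1 1 : ℂ) ≠ 0 := by
  have h := UpperHalfPlane.specialLinearGroup_apply (slWord w) ⟨z, hz⟩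
  have h2 := (slWord w • (⟨z, hz⟩ : ℍ)).im_pos
  rw [h] at h2
  refine ⟨by simpa using h2, fun h0 => ?_⟩
  rw [UpperHalfPlane.im] at h2
  simp [h0] at h2

/-- In integral weight `(cz + d)^κ` is a cocycle without branch ambiguity, so the laws for `S` and
`T` multiply along a word. -/
theorem IsWeil.map_word {k : ℝ} {κ : ℤ} (hκ : k = κ) {F : ℂ → A → ℂ} (hF : Q.IsWeil 1 k F)
    (w : List Bool) {z : ℂ} (hz : 0 < z.im) :
    F ((slWord w 0 0 * z + slWord w 0 1) / (slWord w 1 0 * z + slWord w 1 1)) =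
      ((slWord w 1 0 * z + slWord w 1 1 : ℂ) ^ κ) • (Q.W w).mulVec (F z) := by
  subst hκ
  induction w with
  | nil => simp
  | cons b w ih =>
    obtain ⟨him, hne⟩ := slWord_im_pos w hz
    cases b with
    | true =>
      obtain ⟨e00, e01, e10, e11⟩ := slWord_true_apply w
      have hne' := (slWord_im_pos (true :: w) hz).2
      rw [e00, e01, e10, e11, W_true]
      rw [e10, e11] at hne'
      push_cast
      have e : (-(slWord w 1 0 : ℂ) * z + -(slWord w 1 1 : ℂ)) / (slWord w 0 0 * z + slWord w 0 1)
          = -1 / ((slWord w 0 0 * z + slWord w 0 1) / (slWord w 1 0 * z + slWord w 1 1)) := by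
        field_simp; ring
      rw [e, hF.map_S _ him, ih, one_smul, Matrix.mulVec_smul, smul_smul, Matrix.mulVec_mulVec]
      congr 1
      rw [Complex.ofReal_intCast, Complex.cpow_intCast, ← mul_zpow, div_mul_cancel₀ _ hne]
    | false =>
      obtain ⟨e00, e01, e10, e11⟩ := slWord_false_apply w
      rw [e00, e01, e10, e11, W_false]
      push_cast
      have e : ((slWord w 0 0 + slWord w 1 0 : ℂ) * z + (slWord w 0 1 + slWord w 1 1)) /
          (slWord w 1 0 * z + slWord w 1 1)
          = (slWord w 0 0 * z + slWord w 0 1) / (slWord w 1 0 * z + slWord w 1 1) + 1 := by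
        field_simp; ring
      ext x
      rw [e, hF.map_T _ him, ih, Pi.smul_apply, Pi.smul_apply, ← Matrix.mulVec_mulVec, Tm,
        Matrix.mulVec_diagonal, smul_eq_mul, smul_eq_mul]
      ring

/-- The transformation of a vector valued modular form of integral weight under a matrix whose
lower left entry is prime to the level. -/
theorem IsWeil.map_of_coprime (hQ : Q.IsEven) {k : ℝ} {κ : ℤ} (hκ : k = κ) {F : ℂ → A → ℂ}
    (hF : Q.IsWeil 1 k F) {a b c d c' : ℤ} (hdet : a * d - b * c = 1)
    (hc : ((c * c' : ℤ) : ZMod n) = (1 : ℤ)) {z : ℂ} (hz : 0 < z.im) :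
    F ((a * z + b) / (c * z + d)) =
      (((c * z + d : ℂ) ^ κ) * (Q.G c / Q.G 1 ^ 2)) • (Q.K a d c').mulVec (F z) := by
  obtain ⟨w, hw⟩ := exists_slWord ⟨!![a, b; c, d], by rw [Matrix.det_fin_two_of, hdet]⟩
  have h := hF.map_word hκ w hz
  have h2 := hQ.weilFormula w c'
  rw [hw] at h h2
  rw [h2 (by simpa using hc), Matrix.smul_mulVec, smul_smul] at h
  simpa using h

end FinQuad

/-! ### Cusp forms, Milgram's formula and the parity of the weight. -/

namespace EvenLattice

variable {V : Type*} [AddCommGroup V] [Module ℚ V] {L : EvenLattice V}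

/-- The extension of a vector valued function to the complex plane by `ofComplex`. -/
def ext (f : L.VVFun) : ℂ → L.Disc → ℂ := fun z => f (ofComplex z)

theorem ext_coe (f : L.VVFun) (τ : ℍ) : ext f τ = f τ := by
  rw [ext, UpperHalfPlane.ofComplex_apply]

theorem ofComplex_add_real {z : ℂ} (hz : 0 < z.im) (r : ℝ) :
    ofComplex (z + r) = r +ᵥ ofComplex z := by
  have h : 0 < (z + r).im := by simpa using hz
  ext1
  rw [UpperHalfPlane.ofComplex_apply_of_im_pos h, UpperHalfPlane.coe_vadd,
    UpperHalfPlane.ofComplex_apply_of_im_pos hz]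
  change z + r = r + z
  ring

theorem ofComplex_neg_one_div {z : ℂ} (hz : 0 < z.im) :
    ofComplex (-1 / z) = ModularGroup.S • ofComplex z := by
  ext1
  rw [UpperHalfPlane.modular_S_smul,
    UpperHalfPlane.ofComplex_apply_of_im_pos (Complex.im_neg_one_div_pos hz)]
  change -1 / z = (-(ofComplex z : ℂ))⁻¹
  rw [UpperHalfPlane.ofComplex_apply_of_im_pos hz]
  change -1 / z = (-z)⁻¹
  rw [inv_neg, neg_div, one_div]

theorem sqrt_card_mul_self : ((Real.sqrt (Nat.card L.Disc) : ℝ) : ℂ) * (Real.sqrt (Nat.card L.Disc) : ℝ)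
    = Fintype.card L.Disc := by
  rw [← Complex.ofReal_mul, Real.mul_self_sqrt (Nat.cast_nonneg _), Nat.card_eq_fintype_card]
  simp

theorem sqrt_card_ne_zero : ((Real.sqrt (Nat.card L.Disc) : ℝ) : ℂ) ≠ 0 := fun h => by
  have := sqrt_card_mul_self (L := L)
  rw [h, zero_mul] at this
  exact FinQuad.card_ne_zero this.symm

theorem weilS_weilSInv (v : L.Disc → ℂ) : L.weilS (L.weilSInv v) = v := by
  classical
  let Q := L.discQuad L.level dvd_rfl L.level_pos
  ext μ
  have h1 : ∑ ν, e (-(L.bD ν μ : ℂ)) * ∑ κ, e (L.bD κ ν : ℂ) * v κ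
      = ∑ κ, (∑ ν, Q.B (κ - μ) ν) * v κ := by
    simp_rw [Finset.mul_sum, Finset.sum_mul]
    rw [Finset.sum_comm]
    refine Finset.sum_congr rfl fun κ _ => Finset.sum_congr rfl fun ν _ => ?_
    rw [sub_eq_add_neg, Q.B_add, Q.B_neg, Q.B_comm μ ν, e_neg]
    change (Q.B ν μ)⁻¹ * (Q.B κ ν * v κ) = _
    ring
  simp_rw [Q.sum_B, sub_eq_zero] at h1
  simp only [ite_mul, zero_mul, Finset.sum_ite_eq', Finset.mem_univ, if_true] at h1
  have h2 : L.weilS (L.weilSInv v) μ = (e (-(L.sig : ℂ) / 8) * e ((L.sig : ℂ) / 8)) /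
      (((Real.sqrt (Nat.card L.Disc) : ℝ) : ℂ) * (Real.sqrt (Nat.card L.Disc) : ℝ)) *
      ∑ ν, e (-(L.bD ν μ : ℂ)) * ∑ κ, e (L.bD κ ν : ℂ) * v κ := by
    rw [weilS]
    simp only [weilSInv]
    simp_rw [mul_left_comm (e (-(L.bD _ μ : ℂ))), ← Finset.mul_sum]
    field_simp
  have hc : (Fintype.card L.Disc : ℂ) ≠ 0 := FinQuad.card_ne_zero
  rw [h2, h1, sqrt_card_mul_self, ← e_add, neg_div, neg_add_cancel, e_zero]
  field_simp

variable {k : ℝ} {f : L.VVFun}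

theorem IsCuspForm.map_T (hf : L.IsCuspForm k f) (τ : ℍ) (μ : L.Disc) :
    f ((1 : ℝ) +ᵥ τ) μ = e (L.qD μ) * f τ μ := by
  have h := congrFun (congrFun hf.slash_T τ) μ
  simp only [slashT, weilT] at h
  rw [← h, ← mul_assoc, ← e_add]
  push_cast
  rw [neg_mul, one_mul, add_neg_cancel, e_zero, one_mul]

theorem IsCuspForm.map_S (hf : L.IsCuspForm k f) (τ : ℍ) :
    f (ModularGroup.S • τ) = (τ : ℂ) ^ (k : ℂ) • L.weilS (f τ) := by
  have h := congrFun hf.slash_S τ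
  simp only [slashS] at h
  have hτ : (τ : ℂ) ^ (k : ℂ) ≠ 0 := by simp [τ.ne_zero]
  have h2 : L.weilSInv (f (ModularGroup.S • τ)) = (τ : ℂ) ^ (k : ℂ) • f τ := by
    rw [← h, smul_smul, Complex.cpow_neg, mul_inv_cancel₀ hτ, one_smul]
  rw [← weilS_weilSInv (f (ModularGroup.S • τ)), h2]
  ext μ
  simp only [weilS, Pi.smul_apply, smul_eq_mul, Finset.mul_sum]
  refine Finset.sum_congr rfl fun ν _ => ?_
  ring

section

variable (n : ℕ) (hn : L.level ∣ n) (hn0 : 0 < n)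

/-- The scalar is the one that Milgram's formula asserts to be `1`; it is carried along until
`IsCuspForm.milgram`. -/
theorem weilS_eq (v : L.Disc → ℂ) [DecidableEq L.Disc] :
    L.weilS v = (e (-(L.sig : ℂ) / 8) / (Real.sqrt (Nat.card L.Disc) : ℂ) *
      (L.discQuad n hn hn0).G 1) • (L.discQuad n hn hn0).Sm.mulVec v := by
  have hG := (L.discQuad n hn hn0).G_one_ne_zero
  ext μ
  rw [weilS, Pi.smul_apply, smul_eq_mul, Matrix.mulVec, dotProduct, mul_assoc, Finset.mul_sum,
    Finset.mul_sum, Finset.mul_sum]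
  refine Finset.sum_congr rfl fun ν _ => ?_
  rw [FinQuad.Sm, FinQuad.B_comm, e_neg]
  change _ = _ * (_ * (_ * (e (L.bD ν μ : ℂ))⁻¹ * v ν))
  field_simp

theorem IsCuspForm.isWeil_aux [DecidableEq L.Disc] (hf : L.IsCuspForm k f) :
    (L.discQuad n hn hn0).IsWeil (e (-(L.sig : ℂ) / 8) / (Real.sqrt (Nat.card L.Disc) : ℂ) *
      (L.discQuad n hn hn0).G 1) k (ext f) where
  map_T z hz x := by
    have := ofComplex_add_real hz 1
    rw [Complex.ofReal_one] at this
    rw [ext, this, hf.map_T]; rfl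
  map_S z hz := by
    rw [ext, ofComplex_neg_one_div hz, hf.map_S, UpperHalfPlane.ofComplex_apply_of_im_pos hz,
      L.weilS_eq n hn hn0, ext, UpperHalfPlane.ofComplex_apply_of_im_pos hz]

/-- Milgram's formula, as a consequence of the existence of a non-zero cusp form. -/
theorem IsCuspForm.milgram (hf : L.IsCuspForm k f) (hf0 : f ≠ 0) :
    e (-(L.sig : ℂ) / 8) / (Real.sqrt (Nat.card L.Disc) : ℂ) * (L.discQuad n hn hn0).G 1 = 1 := by
  classical
  obtain ⟨τ, hτ⟩ := Function.ne_iff.1 hf0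
  refine (hf.isWeil_aux n hn hn0).scalar_eq_one ?_ τ.im_pos ?_
  · exact mul_ne_zero (div_ne_zero (e_ne_zero _) sqrt_card_ne_zero) (FinQuad.G_one_ne_zero _)
  · rw [UpperHalfPlane.coe, ext_coe]; exact hτ

theorem IsCuspForm.isWeil [DecidableEq L.Disc] (hf : L.IsCuspForm k f) (hf0 : f ≠ 0) :
    (L.discQuad n hn hn0).IsWeil 1 k (ext f) := by
  rw [← hf.milgram n hn hn0 hf0]
  exact hf.isWeil_aux n hn hn0

theorem IsCuspForm.G_one (hf : L.IsCuspForm k f) (hf0 : f ≠ 0) :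
    (L.discQuad n hn hn0).G 1 = (Real.sqrt (Nat.card L.Disc) : ℂ) * e ((L.sig : ℂ) / 8) := by
  have h := hf.milgram n hn hn0 hf0
  have hs := sqrt_card_ne_zero (L := L)
  rw [neg_div, e_neg] at h
  have := e_ne_zero ((L.sig : ℂ) / 8)
  field_simp at h
  linear_combination h

theorem IsCuspForm.G_one_sq (hf : L.IsCuspForm k f) (hf0 : f ≠ 0) :
    (L.discQuad n hn hn0).G 1 ^ 2 = Fintype.card L.Disc * e ((L.sig : ℂ) / 4) := by
  rw [hf.G_one n hn hn0 hf0, mul_pow, sq, sqrt_card_mul_self, ← e_nmul]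
  congr 2
  push_cast; ring

end

theorem e_half (x : ℂ) : e (x / 2) = Complex.exp (Real.pi * Complex.I * x) := by
  rw [e]; ring_nf

/-- The weight and half the signature agree modulo `1`. -/
theorem IsCuspForm.exists_int (hf : L.IsCuspForm k f) (hf0 : f ≠ 0) :
    ∃ m : ℤ, k = m + (L.sig : ℝ) / 2 := by
  classical
  obtain ⟨τ, hτ⟩ := Function.ne_iff.1 hf0
  obtain ⟨μ, hμ⟩ := Function.ne_iff.1 hτ
  have hw := hf.isWeil L.level dvd_rfl L.level_pos hf0
  -- Parity at `μ` and at `-μ`, combined at a non-zero value, says that the constant `e(k/2 -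
  -- sig/4)` has square `1`.
  have h1 := hw.map_neg τ.im_pos μ
  have h2 := hw.map_neg τ.im_pos (-μ)
  rw [neg_neg] at h2
  rw [h2, UpperHalfPlane.coe, ext_coe, hf.G_one_sq L.level dvd_rfl L.level_pos hf0] at h1
  have hc : (Fintype.card L.Disc : ℂ) ≠ 0 := FinQuad.card_ne_zero
  have he := e_ne_zero ((L.sig : ℂ) / 4)
  have hμ' : f τ μ ≠ 0 := hμ
  field_simp at h1
  rw [← e_half, ← e_nmul, ← e_nmul] at h1
  have h3 : e (((2 : ℕ) : ℂ) * (k / 2) - ((2 : ℕ) : ℂ) * (L.sig / 4)) = 1 := by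
    rw [e_sub, ← h1, div_self (e_ne_zero _)]
  obtain ⟨m, hm⟩ := e_eq_one_iff.1 h3
  refine ⟨m, ?_⟩
  have : (k : ℂ) = m + L.sig / 2 := by rw [← hm]; push_cast; ring
  exact_mod_cast this

end EvenLattice

/-! ### The Hecke operator as a sum of explicit translates. -/

theorem Complex.ofReal_mul_cpow {r : ℝ} (hr : 0 < r) {z : ℂ} (hz : z ≠ 0) (k : ℂ) :
    ((r : ℂ) * z) ^ k = (r : ℂ) ^ k * z ^ k := by
  have hr' : (r : ℂ) ≠ 0 := by exact_mod_cast hr.ne'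
  rw [Complex.cpow_def_of_ne_zero (mul_ne_zero hr' hz), Complex.cpow_def_of_ne_zero hr',
    Complex.cpow_def_of_ne_zero hz, Complex.log_ofReal_mul hr hz, ← Complex.exp_add,
    Complex.ofReal_log hr.le, add_mul]

namespace EvenLattice

variable {V : Type*} [AddCommGroup V] [Module ℚ V] {L : EvenLattice V} {k : ℝ} {f : L.VVFun}

theorem sum_mul_sum_fiber (p : ℕ) (a h : L.Disc → ℂ) [DecidableEq L.Disc] :
    ∑ μ, a μ * ∑ ν with p • ν = μ, h ν = ∑ ν, a (p • ν) * h ν := by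
  refine Eq.trans ?_ (Finset.sum_fiberwise (s := Finset.univ) (g := fun ν : L.Disc => p • ν) _)
  refine Finset.sum_congr rfl fun μ _ => ?_
  rw [Finset.mul_sum]
  refine Finset.sum_congr rfl fun ν hν => ?_
  rw [(Finset.mem_filter.1 hν).2]

theorem e_bD_nsmul (p : ℕ) (μ ν : L.Disc) : e (L.bD (p • μ) ν) = e (L.bD μ (p • ν)) := by
  let Q := L.discQuad L.level dvd_rfl L.level_pos
  have h1 := Q.B_zsmul p μ ν
  have h2 := Q.B_zsmul_right p μ ν
  rw [natCast_zsmul] at h1 h2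
  exact h1.trans h2.symm

theorem IsCuspForm.weilSInv_S (hf : L.IsCuspForm k f) (τ : ℍ) :
    L.weilSInv (f (ModularGroup.S • τ)) = (τ : ℂ) ^ (k : ℂ) • f τ := by
  have h := congrFun hf.slash_S τ
  simp only [slashS] at h
  have hτ : (τ : ℂ) ^ (k : ℂ) ≠ 0 := by simp [τ.ne_zero]
  rw [← h, smul_smul, Complex.cpow_neg, mul_inv_cancel₀ hτ, one_smul]

theorem im_div_sq_pos {p : ℕ} (hp : 0 < p) {z : ℂ} (hz : 0 < z.im) : 0 < (z / (p : ℂ) ^ 2).im := by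
  have : z / (p : ℂ) ^ 2 = ((1 / (p : ℝ) ^ 2 : ℝ) : ℂ) * z := by push_cast; ring
  rw [this, Complex.im_ofReal_mul]
  positivity

theorem im_mul_sq_pos {p : ℕ} (hp : 0 < p) {z : ℂ} (hz : 0 < z.im) : 0 < ((p : ℂ) ^ 2 * z).im := by
  have : (p : ℂ) ^ 2 * z = (((p : ℝ) ^ 2 : ℝ) : ℂ) * z := by push_cast; ring
  rw [this, Complex.im_ofReal_mul]
  positivity

/-- `p² (-1/τ)` is the image of `τ/p²` under `S`, and multiplication by `p` is self-adjoint for the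
bilinear form, so the sum over the fibre becomes evaluation at `pμ`. -/
theorem IsCuspForm.slashS_heckeAlpha (hf : L.IsCuspForm k f) {p : ℕ} (hp : 0 < p) (τ : ℍ)
    (μ : L.Disc) : L.slashS k (L.heckeAlpha p f) τ μ =
      (p : ℂ) ^ (-2 * (k : ℂ)) * ext f ((τ : ℂ) / (p : ℂ) ^ 2) (p • μ) := by
  classical
  have hp' : (p : ℂ) ≠ 0 := by exact_mod_cast hp.ne'
  have him := im_div_sq_pos hp τ.im_pos
  have e1 : ofComplex ((p : ℂ) ^ 2 * (ModularGroup.S • τ : ℍ))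
      = ModularGroup.S • ofComplex ((τ : ℂ) / (p : ℂ) ^ 2) := by
    rw [← ofComplex_neg_one_div him]
    congr 1
    rw [UpperHalfPlane.modular_S_smul]
    change (p : ℂ) ^ 2 * (-(τ : ℂ))⁻¹ = _
    have := τ.ne_zero
    field_simp
  have h1 : L.weilSInv (L.heckeAlpha p f (ModularGroup.S • τ)) μ
      = L.weilSInv (f (ModularGroup.S • ofComplex ((τ : ℂ) / (p : ℂ) ^ 2))) (p • μ) := by
    simp only [weilSInv, heckeAlpha, e1]
    congr 1
    have := sum_mul_sum_fiber p (fun ν => e (L.bD ν μ : ℂ))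
      (f (ModularGroup.S • ofComplex ((τ : ℂ) / (p : ℂ) ^ 2)))
    simp only [e_bD_nsmul] at this
    congr!
  rw [slashS, Pi.smul_apply, smul_eq_mul, h1, hf.weilSInv_S, Pi.smul_apply, smul_eq_mul,
    UpperHalfPlane.ofComplex_apply_of_im_pos him]
  change _ * ((τ / (p : ℂ) ^ 2) ^ (k : ℂ) * f _ _) = _
  have e2 : (τ / (p : ℂ) ^ 2) ^ (k : ℂ) = (p : ℂ) ^ (-2 * (k : ℂ)) * (τ : ℂ) ^ (k : ℂ) := by
    have h3 : (τ / (p : ℂ) ^ 2) = (((p : ℝ) ^ (-2 : ℝ) : ℝ) : ℂ) * τ := by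
      rw [Real.rpow_neg (Nat.cast_nonneg p), Real.rpow_two]; push_cast; ring
    rw [h3, Complex.ofReal_mul_cpow (by positivity) τ.ne_zero, Complex.ofReal_cpow (by positivity),
      ← Complex.ofReal_cpow (by positivity), ← Complex.ofReal_cpow (by positivity),
      ← Real.rpow_mul (by positivity)]
    congr 1
    rw [Complex.ofReal_cpow (by positivity)]
    push_cast; rfl
  have hτ : (τ : ℂ) ^ (k : ℂ) ≠ 0 := by simp [τ.ne_zero]
  rw [e2, Complex.cpow_neg, ext, UpperHalfPlane.ofComplex_apply_of_im_pos him]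
  field_simp

theorem IsCuspForm.slashT_slashS_heckeAlpha (hf : L.IsCuspForm k f) {p : ℕ} (hp : 0 < p) (m : ℤ)
    (τ : ℍ) (μ : L.Disc) : L.slashT m (L.slashS k (L.heckeAlpha p f)) τ μ =
      (p : ℂ) ^ (-2 * (k : ℂ)) *
        (e (-(m * L.qD μ)) * ext f (((τ : ℂ) + m) / (p : ℂ) ^ 2) (p • μ)) := by
  rw [slashT, weilT, hf.slashS_heckeAlpha hp, UpperHalfPlane.coe_vadd]
  have h1 : (((m : ℝ) : ℂ) + τ) = τ + m := by push_cast; ring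
  rw [h1]
  push_cast
  rw [neg_mul]
  ring

/-- The transformation of `f` under the matrices `(-j, -y; p, -b)` with `level ∣ b`, up to the
constant `ω`. -/
def MidFormula (L : EvenLattice V) (k : ℝ) (f : L.VVFun) (p : ℕ) (j b : ℤ) (ω : ℂ) : Prop :=
  ∀ c' : ℤ, ((p * c' : ℤ) : ZMod L.level) = (1 : ℤ) → ∀ z : ℂ, 0 < z.im → ∀ x,
    ext f (-1 / ((p : ℂ) ^ 2 * z) - j / p) x = ((p : ℂ) * z) ^ (k : ℂ) *
      ((L.discQuad L.level dvd_rfl L.level_pos).G 1)⁻¹ * ω *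
      ∑ y, e (L.qD x) ^ (-j * c') * e (L.bD x y) ^ (-c') * ext f (z + b / p) y

section

variable (L)

/-- The discriminant form as a finite quadratic module at its own level. -/
abbrev discQ : FinQuad L.Disc L.level := L.discQuad L.level dvd_rfl L.level_pos

end

theorem modular_S_coe (τ : ℍ) : ((ModularGroup.S • τ : ℍ) : ℂ) = -1 / (τ : ℂ) := by
  rw [UpperHalfPlane.modular_S_smul]
  change (-(τ : ℂ))⁻¹ = _
  rw [inv_neg, neg_div, one_div]

/-- The phase of `T^(-pj)` cancels the factor `ψ(pν)^(-j c')` of the kernel because `p c' ≡ 1`; a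
pure Fourier kernel in `ν` remains. -/
theorem IsCuspForm.mid_term (hf : L.IsCuspForm k f) {p : ℕ} (hp : 0 < p)
    {c' : ℤ} (hc : ((p * c' : ℤ) : ZMod L.level) = (1 : ℤ)) {j : ℕ} {b : ℤ} {ω : ℂ}
    (h : MidFormula L k f p j b ω) (τ : ℍ) (ν : L.Disc) :
    L.slashT (-((p * j : ℕ) : ℤ)) (L.slashS k (L.heckeAlpha p f)) (ModularGroup.S • τ) ν =
      (p : ℂ) ^ (-2 * (k : ℂ)) * (((p : ℂ) * τ) ^ (k : ℂ) * (L.discQ.G 1)⁻¹ * ω) *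
        ∑ y, (L.discQ.B ν y)⁻¹ * ext f (τ + b / p) y := by
  have hp' : (p : ℂ) ≠ 0 := by exact_mod_cast hp.ne'
  have harg : ((((ModularGroup.S • τ : ℍ) : ℂ) + ((-((p * j : ℕ) : ℤ) : ℤ) : ℂ)) / (p : ℂ) ^ 2)
      = -1 / ((p : ℂ) ^ 2 * τ) - ((j : ℤ) : ℂ) / p := by
    rw [modular_S_coe]
    have := τ.ne_zero
    push_cast
    field_simp
    ring
  have e1 : e (-(((-((p * j : ℕ) : ℤ) : ℤ) : ℂ) * L.qD ν)) = L.discQ.ψ ν ^ ((p : ℤ) * j) := by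
    rw [← neg_mul, ← Int.cast_neg, e_zmul, neg_neg]
    push_cast; rfl
  have e2 : e (L.qD (p • ν)) ^ (-(j : ℤ) * c') = L.discQ.ψ ν ^ (-((p : ℤ) * j)) := by
    change L.discQ.ψ (p • ν) ^ _ = _
    rw [← natCast_zsmul, FinQuad.ψ_zsmul, ← zpow_mul]
    refine FinQuad.ψ_zpow_congr _ ?_ ν
    push_cast at hc ⊢
    linear_combination (-(p : ZMod L.level) * j) * hc
  have e3 : ∀ y, e (L.bD (p • ν) y) ^ (-c') = (L.discQ.B ν y)⁻¹ := fun y => by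
    change L.discQ.B (p • ν) y ^ _ = _
    rw [← natCast_zsmul, FinQuad.B_zsmul, ← zpow_mul, ← zpow_neg_one]
    refine FinQuad.B_zpow_congr _ ?_ ν y
    push_cast at hc ⊢
    linear_combination -hc
  rw [hf.slashT_slashS_heckeAlpha hp, harg, h c' hc τ τ.im_pos, e1]
  simp_rw [e3]
  have h0 := zpow_ne_zero ((p : ℤ) * j) (L.discQ.ψ_ne_zero ν)
  have h1 : ∑ y, e (L.qD (p • ν)) ^ (-(j : ℤ) * c') * (L.discQ.B ν y)⁻¹ * ext f (τ + b / p) y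
      = (L.discQ.ψ ν ^ ((p : ℤ) * j))⁻¹ * ∑ y, (L.discQ.B ν y)⁻¹ * ext f (τ + b / p) y := by
    rw [Finset.mul_sum]
    refine Finset.sum_congr rfl fun y _ => ?_
    rw [e2, zpow_neg, mul_assoc]
  rw [h1]
  field_simp

theorem sum_e_neg_bD (v : L.Disc → ℂ) (μ : L.Disc) :
    ∑ ν, e (-(L.bD ν μ : ℂ)) * ∑ y, (L.discQ.B ν y)⁻¹ * v y = Fintype.card L.Disc * v (-μ) := by
  classical
  have : ∀ ν y, e (-(L.bD ν μ : ℂ)) * ((L.discQ.B ν y)⁻¹ * v y)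
      = L.discQ.B (-(μ + y)) ν * v y := fun ν y => by
    rw [FinQuad.B_neg, FinQuad.B_add, FinQuad.B_comm _ μ, FinQuad.B_comm _ y, mul_inv, e_neg,
      mul_assoc]
    rfl
  simp_rw [Finset.mul_sum, this]
  rw [Finset.sum_comm]
  simp_rw [← Finset.sum_mul, FinQuad.sum_B, neg_eq_zero, add_comm μ, ← eq_neg_iff_add_eq_zero]
  simp

theorem im_add_ratio_pos {z : ℂ} (hz : 0 < z.im) (b : ℤ) (p : ℕ) : 0 < (z + b / p).im := by
  have : (z + b / p) = z + ((b / p : ℝ) : ℂ) := by push_cast; rfl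
  rw [this, Complex.add_im, Complex.ofReal_im, add_zero]
  exact hz

/-- The last `S⁻¹` inverts the Fourier kernel left by `mid_term` and returns the component at `-μ`.
The parity relation `map_neg` leads back to `μ` and absorbs `|D|`, the Gauss sums and `(-1/τ)^k
τ^k`. -/
theorem IsCuspForm.slashSInv_mid (hf : L.IsCuspForm k f) (hf0 : f ≠ 0) {p : ℕ} (hp : p.Prime)
    (hpL : ¬ p ∣ L.level) {j : ℕ} {b : ℤ} {ω : ℂ} (h : MidFormula L k f p j b ω) (τ : ℍ)
    (μ : L.Disc) :
    L.slashSInv k (L.slashT (-((p * j : ℕ) : ℤ)) (L.slashS k (L.heckeAlpha p f))) τ μ =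
      (p : ℂ) ^ (-(k : ℂ)) * (ω * ext f ((τ : ℂ) + b / p) μ) := by
  classical
  have hp' : (p : ℂ) ≠ 0 := by exact_mod_cast hp.ne_zero
  have hcop : IsCoprime (p : ℤ) (L.level : ℤ) :=
    Nat.isCoprime_iff_coprime.2 ((Nat.Prime.coprime_iff_not_dvd hp).2 hpL)
  obtain ⟨c', hc⟩ := zmod_unit_iff.2 hcop
  have hs : e (-(L.sig : ℂ) / 8) / (Real.sqrt (Nat.card L.Disc) : ℂ) = (L.discQ.G 1)⁻¹ :=
    eq_inv_of_mul_eq_one_left (hf.milgram _ dvd_rfl L.level_pos hf0)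
  have hneg := (hf.isWeil _ dvd_rfl L.level_pos hf0).map_neg (im_add_ratio_pos τ.im_pos b p) μ
  have e4 : ((p : ℂ) * τ) ^ (k : ℂ) = (p : ℂ) ^ (k : ℂ) * (τ : ℂ) ^ (k : ℂ) := by
    have := Complex.ofReal_mul_cpow (r := p) (by exact_mod_cast hp.pos) τ.ne_zero k
    simpa using this
  have e5 : (p : ℂ) ^ (-2 * (k : ℂ)) * (p : ℂ) ^ (k : ℂ) = (p : ℂ) ^ (-(k : ℂ)) := by
    rw [← Complex.cpow_add _ _ hp']; ring_nf
  have e7 := Complex.neg_one_div_cpow_mul τ.im_pos (k : ℂ)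
  have h2 : ∀ C : ℂ, ∑ ν, e (-(L.bD ν μ : ℂ)) * (C * ∑ y, (L.discQ.B ν y)⁻¹ *
      ext f (τ + b / p) y) = C * (Fintype.card L.Disc * ext f (τ + b / p) (-μ)) := fun C => by
    rw [← sum_e_neg_bD, Finset.mul_sum]
    exact Finset.sum_congr rfl fun ν _ => mul_left_comm _ _ _
  rw [slashSInv, Pi.smul_apply, smul_eq_mul, weilS, hs]
  simp_rw [hf.mid_term hp.pos hc h τ]
  rw [h2, e4, hneg, ← e7, ← e5]
  generalize (-1 / (τ : ℂ)) ^ (k : ℂ) = X1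
  field_simp

theorem IsCuspForm.heckeAlpha_apply {p : ℕ} {p' : ℤ}
    (hp : ((p * p' : ℤ) : ZMod L.level) = (1 : ℤ)) (τ : ℍ) (μ : L.Disc) :
    L.heckeAlpha p f τ μ = ext f ((p : ℂ) ^ 2 * τ) (p' • μ) := by
  classical
  let Q := L.discQuad L.level dvd_rfl L.level_pos
  rw [heckeAlpha, Finset.sum_eq_single (p' • μ)]
  · rfl
  · intro ν hν hne
    refine absurd ?_ hne
    have h1 : p • ν = μ := (Finset.mem_filter.1 hν).2
    rw [← h1, ← natCast_zsmul, ← mul_zsmul, mul_comm, Q.zsmul_congr hp, one_zsmul]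
  · intro h
    refine absurd ?_ h
    rw [Finset.mem_filter]
    refine ⟨Finset.mem_univ _, ?_⟩
    rw [← natCast_zsmul, ← mul_zsmul, Q.zsmul_congr hp, one_zsmul]

/-- The Hecke operator in terms of explicit translates. -/
theorem IsCuspForm.hecke_apply (hf : L.IsCuspForm k f) (hf0 : f ≠ 0) {p : ℕ} (hp : p.Prime)
    (hpL : ¬ p ∣ L.level) {p' : ℤ} (hp' : ((p * p' : ℤ) : ZMod L.level) = (1 : ℤ))
    {b : ℕ → ℤ} {ω : ℕ → ℂ} (h : ∀ j ∈ Finset.Ico 1 p, MidFormula L k f p j (b j) (ω j))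
    (τ : ℍ) (μ : L.Disc) :
    L.hecke k p f τ μ = (p : ℂ) ^ (2 * (k : ℂ) - 2) * ext f ((p : ℂ) ^ 2 * τ) (p' • μ) +
      (p : ℂ) ^ (-2 : ℂ) * ∑ m ∈ Finset.range (p ^ 2),
        e (-(m * L.qD μ)) * ext f (((τ : ℂ) + m) / (p : ℂ) ^ 2) (p • μ) +
      (p : ℂ) ^ ((k : ℂ) - 2) * ∑ j ∈ Finset.Ico 1 p, ω j * ext f ((τ : ℂ) + b j / p) μ := by
  have hp0 : (p : ℂ) ≠ 0 := by exact_mod_cast hp.ne_zero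
  rw [hecke]
  simp only [Pi.smul_apply, Pi.add_apply, Finset.sum_apply, smul_eq_mul]
  rw [IsCuspForm.heckeAlpha_apply hp', mul_add, mul_add]
  have e1 : (p : ℂ) ^ (2 * (k : ℂ) - 2) * (p : ℂ) ^ (-2 * (k : ℂ)) = (p : ℂ) ^ (-2 : ℂ) := by
    rw [← Complex.cpow_add _ _ hp0]; ring_nf
  have e2 : (p : ℂ) ^ (2 * (k : ℂ) - 2) * (p : ℂ) ^ (-(k : ℂ)) = (p : ℂ) ^ ((k : ℂ) - 2) := by
    rw [← Complex.cpow_add _ _ hp0]; ring_nf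
  congr 1
  · congr 1
    rw [← e1, Finset.mul_sum, Finset.mul_sum]
    refine Finset.sum_congr rfl fun m _ => ?_
    rw [hf.slashT_slashS_heckeAlpha hp.pos]
    push_cast; ring
  · rw [← e2, Finset.mul_sum, Finset.mul_sum]
    refine Finset.sum_congr rfl fun j hj => ?_
    rw [hf.slashSInv_mid hf0 hp hpL (h j hj)]
    ring

end EvenLattice

/-! ### Transformation formulas of the Jacobi theta function. -/

theorem Complex.neg_I_mul_half_cpow {z : ℂ} (hz : 0 < z.im) :
    (-Complex.I * (z / 2)) ^ (1 / 2 : ℂ) = (1 - Complex.I) / 2 * z ^ (1 / 2 : ℂ) := by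
  have hz0 : z ≠ 0 := fun h => by simp [h] at hz
  have hI : (-Complex.I / 2) ≠ 0 := by simp
  have him : (-Complex.I / 2).im < 0 := by
    have : (-Complex.I / 2) = ((-1 / 2 : ℝ) : ℂ) * Complex.I := by push_cast; ring
    rw [this, Complex.re_ofReal_mul |> fun _ => Complex.im_ofReal_mul]; norm_num
  obtain ⟨a1, a2⟩ := Complex.arg_mem_Ioo_of_im_pos hz
  have b1 := Complex.arg_neg_iff.2 him
  have b2 := Complex.neg_pi_lt_arg (-Complex.I / 2)
  have hlog := (Complex.log_mul_eq_add_log_iff hI hz0).2 ⟨by linarith, by linarith⟩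
  have e1 : -Complex.I * (z / 2) = -Complex.I / 2 * z := by ring
  have e2 : (-Complex.I / 2) ^ (1 / 2 : ℂ) = (1 - Complex.I) / 2 := by
    have h : (-Complex.I / 2) = ((1 - Complex.I) / 2) ^ 2 := by
      linear_combination (-1 / 4 : ℂ) * Complex.I_sq
    have hre : 0 < ((1 - Complex.I) / 2).re := by
      have : ((1 - Complex.I) / 2) = ((1 / 2 : ℝ) : ℂ) * (1 - Complex.I) := by push_cast; ring
      rw [this, Complex.re_ofReal_mul]; norm_num
    rw [h, one_div, Complex.sq_cpow_two_inv hre]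
  rw [e1, ← e2, Complex.cpow_def_of_ne_zero (mul_ne_zero hI hz0), hlog, add_mul, Complex.exp_add,
    ← Complex.cpow_def_of_ne_zero hI, ← Complex.cpow_def_of_ne_zero hz0]

theorem hasSum_jacobiTheta {z : ℂ} (hz : 0 < z.im) :
    HasSum (fun n : ℤ => Complex.exp (Real.pi * Complex.I * (n : ℂ) ^ 2 * z)) (jacobiTheta z) := by
  have := hasSum_jacobiTheta₂_term 0 hz
  rw [← jacobiTheta_eq_jacobiTheta₂] at this
  simpa [jacobiTheta₂_term] using this

theorem Complex.im_div_two_pos {z : ℂ} (hz : 0 < z.im) : 0 < (z / 2).im := by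
  have : z / 2 = ((1 / 2 : ℝ) : ℂ) * z := by push_cast; ring
  rw [this, Complex.im_ofReal_mul]
  positivity

theorem Complex.im_two_mul_pos {z : ℂ} (hz : 0 < z.im) : 0 < (2 * z).im := by
  have : 2 * z = ((2 : ℝ) : ℂ) * z := by push_cast; ring
  rw [this, Complex.im_ofReal_mul]
  positivity

/-- The extra factor `exp(π i n² / 2)` is `1` for even `n` and `i` for odd `n`, and the even terms
form `θ(2z)`. -/
theorem jacobiTheta_half_add_one {z : ℂ} (hz : 0 < z.im) : jacobiTheta ((z + 1) / 2) =
    Complex.I * jacobiTheta (z / 2) + (1 - Complex.I) * jacobiTheta (2 * z) := by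
  have hz1 : 0 < (z + 1).im := by simpa using hz
  have h1 := hasSum_jacobiTheta (Complex.im_div_two_pos hz)
  have h2 := hasSum_jacobiTheta (Complex.im_two_mul_pos hz)
  have h3 := hasSum_jacobiTheta (Complex.im_div_two_pos hz1)
  let g : ℤ → ℂ := fun n => if Even n then
    Complex.exp (Real.pi * Complex.I * (n : ℂ) ^ 2 * (z / 2)) else 0
  have hinj : Function.Injective (fun n : ℤ => 2 * n) := fun a b h => by
    have : 2 * a = 2 * b := h
    omega
  have h4 : HasSum g (jacobiTheta (2 * z)) := by
    rw [← hinj.hasSum_iff]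
    · convert h2 using 1
      funext n
      simp only [g, Function.comp_apply, if_pos (even_two_mul n)]
      push_cast
      ring_nf
    · intro n hn
      refine if_neg fun h => hn ?_
      obtain ⟨m, hm⟩ := h
      exact ⟨m, by simp only; omega⟩
  refine h3.unique (((h1.mul_left Complex.I).add (h4.mul_left (1 - Complex.I))).congr_fun fun n => ?_)
  have e1 : Complex.exp (Real.pi * Complex.I * (n : ℂ) ^ 2 * ((z + 1) / 2)) =
      Complex.exp (Real.pi / 2 * Complex.I) ^ (n ^ 2) *
        Complex.exp (Real.pi * Complex.I * (n : ℂ) ^ 2 * (z / 2)) := by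
    rw [← Complex.exp_int_mul, ← Complex.exp_add]
    push_cast
    ring_nf
  rw [e1, Complex.exp_pi_div_two_mul_I]
  simp only [g]
  have hI4 : Complex.I ^ (4 : ℤ) = 1 := Complex.I_pow_four
  split_ifs with h
  · obtain ⟨m, rfl⟩ := h
    have : Complex.I ^ ((m + m) ^ 2) = 1 := by
      rw [show (m + m) ^ 2 = 4 * m ^ 2 by ring, zpow_mul, hI4, one_zpow]
    rw [this]; ring
  · obtain ⟨m, rfl⟩ := Int.not_even_iff_odd.1 h
    have : Complex.I ^ ((2 * m + 1) ^ 2) = Complex.I := by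
      rw [show (2 * m + 1) ^ 2 = 4 * (m ^ 2 + m) + 1 by ring, zpow_add₀ Complex.I_ne_zero,
        zpow_mul, hI4, one_zpow, zpow_one, one_mul]
    rw [this]; ring

theorem jacobiTheta_neg_two_div {z : ℂ} (hz : 0 < z.im) :
    jacobiTheta (-2 / z) = (1 - Complex.I) / 2 * z ^ (1 / 2 : ℂ) * jacobiTheta (z / 2) := by
  have h := jacobiTheta_S_smul ⟨z / 2, Complex.im_div_two_pos hz⟩
  rw [UpperHalfPlane.modular_S_smul] at h
  change jacobiTheta ((-(z / 2))⁻¹) = (-Complex.I * (z / 2)) ^ (1 / 2 : ℂ) * jacobiTheta (z / 2) at h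
  rw [Complex.neg_I_mul_half_cpow hz] at h
  rw [← h]
  congr 1
  rw [inv_neg, inv_div, neg_div]

theorem jacobiTheta_neg_one_div_two_mul {z : ℂ} (hz : 0 < z.im) :
    jacobiTheta (-1 / z / 2) = (1 - Complex.I) * z ^ (1 / 2 : ℂ) * jacobiTheta (2 * z) := by
  have hz4 : 0 < (4 * z).im := by
    have := Complex.im_two_mul_pos (Complex.im_two_mul_pos hz)
    rwa [← mul_assoc, show (2 * 2 : ℂ) = 4 by norm_num] at this
  have hz0 : z ≠ 0 := fun h => by simp [h] at hz
  have h := jacobiTheta_neg_two_div hz4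
  rw [show -2 / (4 * z) = -1 / z / 2 by field_simp; norm_num, show 4 * z / 2 = 2 * z by ring] at h
  rw [h]
  have h4 : (4 * z) ^ (1 / 2 : ℂ) = 2 * z ^ (1 / 2 : ℂ) := by
    have h1 := Complex.ofReal_mul_cpow (r := 4) (by norm_num) hz0 (1 / 2)
    have h2 : ((4 : ℝ) : ℂ) ^ (1 / 2 : ℂ) = 2 := by
      have := Complex.sq_cpow_two_inv (x := 2) (by norm_num)
      rw [one_div]
      convert this using 2
      norm_num
    rw [h2] at h1
    simpa using h1
  rw [h4]; ring

/-- The quadratic Gauss sum modulo `p`. -/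
def quadGauss (p : ℕ) [NeZero p] (a : ZMod p) : ℂ := ∑ r : ZMod p, ZMod.stdAddChar (a * r ^ 2)

theorem quadGauss_completeSquare {p : ℕ} [NeZero p] {j b : ZMod p} (h : j * (4 * b) = 1)
    (n : ZMod p) : ∑ r : ZMod p, (ZMod.stdAddChar (-j * r ^ 2 + n * r) : ℂ) =
      ZMod.stdAddChar (b * n ^ 2) * quadGauss p (-j) := by
  rw [quadGauss, Finset.mul_sum]
  rw [← Fintype.sum_equiv (Equiv.addRight (2 * b * n)) _ _ fun _ => rfl]
  refine Finset.sum_congr rfl fun r _ => ?_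
  rw [← AddChar.map_add_eq_mul]
  congr 1
  simp only [Equiv.coe_addRight]
  linear_combination (-(b * n ^ 2) - n * r) * h

theorem stdAddChar_intCast {p : ℕ} [NeZero p] (a : ℤ) :
    (ZMod.stdAddChar (a : ZMod p) : ℂ) = EvenLattice.e (a / p) := by
  rw [ZMod.stdAddChar_coe, EvenLattice.e]
  ring_nf

theorem sum_fin_natCast_zmod {p : ℕ} [NeZero p] (h : ZMod p → ℂ) :
    ∑ r : Fin p, h ((r : ℕ) : ZMod p) = ∑ r, h r := by
  obtain ⟨q, rfl⟩ := Nat.exists_eq_succ_of_ne_zero (NeZero.ne p)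
  refine Finset.sum_congr rfl fun r _ => ?_
  congr 1
  exact Fin.cast_val_eq_self r

/-- Poisson summation, in the form of the functional equation of the two-variable theta function. -/
theorem jacobiTheta_shift {z : ℂ} (hz : 0 < z.im) (x : ℂ) :
    ∑' m : ℤ, Complex.exp (Real.pi * Complex.I * (m + x) ^ 2 * (-2 / z)) =
      (1 - Complex.I) / 2 * z ^ (1 / 2 : ℂ) * jacobiTheta₂ x (z / 2) := by
  have hz0 : z ≠ 0 := fun h => by simp [h] at hz
  have h := jacobiTheta₂_functional_equation x (z / 2)
  rw [← Complex.neg_I_mul_half_cpow hz, h]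
  have hne : (-Complex.I * (z / 2)) ^ (1 / 2 : ℂ) ≠ 0 := by simp [hz0]
  rw [← mul_assoc, ← mul_assoc, mul_one_div_cancel hne, one_mul, ← jacobiTheta₂_neg_left,
    jacobiTheta₂, ← tsum_mul_left]
  refine tsum_congr fun m => ?_
  rw [jacobiTheta₂_term, ← Complex.exp_add]
  congr 1
  field_simp
  ring

/-- Split the summation index as `r + p m`. The rational part `-j/p` of the argument contributes
only a character in `r`; Poisson summation in `m` gives `θ₂(r/p, z/2)`; and in each of its terms the
sum over `r` is a Gauss sum after completing the square. -/
theorem jacobiTheta_mid {p : ℕ} [NeZero p] {j b : ℤ} (h : ((j * (4 * b) : ℤ) : ZMod p) = (1 : ℤ))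
    {z : ℂ} (hz : 0 < z.im) : jacobiTheta (2 * (-1 / ((p : ℂ) ^ 2 * z) - j / p)) =
      (1 - Complex.I) / 2 * z ^ (1 / 2 : ℂ) * quadGauss p (-j) *
        jacobiTheta ((z + ((4 * b : ℤ) : ℂ) / p) / 2) := by
  have hp : (p : ℂ) ≠ 0 := by exact_mod_cast NeZero.ne p
  have hz0 : z ≠ 0 := fun h => by simp [h] at hz
  have him : 0 < (2 * (-1 / ((p : ℂ) ^ 2 * z) - j / p)).im := by
    refine Complex.im_two_mul_pos ?_
    have h1 : (j / p : ℂ) = ((j / p : ℝ) : ℂ) := by push_cast; rfl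
    rw [Complex.sub_im, h1, Complex.ofReal_im, sub_zero]
    exact Complex.im_neg_one_div_pos (EvenLattice.im_mul_sq_pos (NeZero.pos p) hz)
  have him2 : 0 < ((z + ((4 * b : ℤ) : ℂ) / p) / 2).im :=
    Complex.im_div_two_pos (EvenLattice.im_add_ratio_pos hz _ _)
  have h1 := hasSum_jacobiTheta him
  rw [← (Int.divModEquiv p).symm.hasSum_iff, ← (Equiv.prodComm _ _).hasSum_iff] at h1
  have h2 : jacobiTheta (2 * (-1 / ((p : ℂ) ^ 2 * z) - j / p)) =
      ∑ r : Fin p, (ZMod.stdAddChar (((-j * (r : ℤ) ^ 2 : ℤ)) : ZMod p) : ℂ) *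
        ((1 - Complex.I) / 2 * z ^ (1 / 2 : ℂ) * jacobiTheta₂ ((r : ℕ) / p) (z / 2)) := by
    rw [← h1.tsum_eq, h1.summable.tsum_prod, tsum_fintype]
    refine Finset.sum_congr rfl fun r _ => ?_
    rw [← jacobiTheta_shift hz, ← tsum_mul_left]
    refine tsum_congr fun m => ?_
    simp only [Function.comp_apply, Equiv.prodComm_apply, Prod.swap_prod_mk,
      Int.divModEquiv_symm_apply]
    rw [stdAddChar_intCast, EvenLattice.e, ← Complex.exp_add]
    rw [Complex.exp_eq_exp_iff_exists_int]
    refine ⟨-j * (m ^ 2 * p + 2 * m * r), ?_⟩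
    push_cast
    field_simp
    ring
  have h3 := hasSum_sum (s := (Finset.univ : Finset (Fin p))) (fun r _ =>
    (hasSum_jacobiTheta₂_term ((r : ℕ) / p : ℂ) (Complex.im_div_two_pos hz)).mul_left
      (ZMod.stdAddChar (((-j * (r : ℤ) ^ 2 : ℤ)) : ZMod p) : ℂ))
  have h4 := (hasSum_jacobiTheta him2).mul_left (quadGauss p (-j))
  have h5 := h3.unique (by
    convert h4 using 1
    funext n
    have h6 := quadGauss_completeSquare (p := p) (j := (j : ZMod p)) (b := (b : ZMod p))
      (by exact_mod_cast h) (n : ZMod p)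
    rw [← sum_fin_natCast_zmod] at h6
    have h7 : ∀ r : Fin p, (ZMod.stdAddChar (((-j * (r : ℤ) ^ 2 : ℤ)) : ZMod p) : ℂ) *
        jacobiTheta₂_term n ((r : ℕ) / p : ℂ) (z / 2) =
        Complex.exp (Real.pi * Complex.I * n ^ 2 * (z / 2)) *
          ZMod.stdAddChar (-(j : ZMod p) * ((r : ℕ) : ZMod p) ^ 2 + (n : ZMod p) * ((r : ℕ) : ZMod p)) := by
      intro r
      have : (-(j : ZMod p) * ((r : ℕ) : ZMod p) ^ 2 + (n : ZMod p) * ((r : ℕ) : ZMod p)) =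
        ((-j * (r : ℤ) ^ 2 : ℤ) : ZMod p) + ((n * r : ℤ) : ZMod p) := by push_cast; ring
      rw [this, AddChar.map_add_eq_mul, stdAddChar_intCast (n * r), jacobiTheta₂_term,
        EvenLattice.e, mul_left_comm, ← Complex.exp_add]
      congr 2
      push_cast
      ring
    have h8 : (ZMod.stdAddChar ((b : ZMod p) * (n : ZMod p) ^ 2) : ℂ) = EvenLattice.e
        ((b * n ^ 2 : ℤ) / p) := by
      rw [← stdAddChar_intCast]; push_cast; rfl
    rw [Finset.sum_congr rfl fun r _ => h7 r, ← Finset.mul_sum, h6, h8, EvenLattice.e, ← mul_assoc,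
      ← Complex.exp_add, mul_comm]
    congr 2
    push_cast
    field_simp
    ring)
  rw [h2, mul_assoc _ (quadGauss p _), ← h5, Finset.mul_sum]
  exact Finset.sum_congr rfl fun r _ => mul_left_comm _ _ _

theorem exists_jacobiTheta_ne_zero : ∃ y : ℝ, 0 < y ∧ ∀ z : ℂ, y < z.im → jacobiTheta z ≠ 0 := by
  refine ⟨1, one_pos, fun z hz h => ?_⟩
  have h1 := norm_jacobiTheta_sub_one_le (one_pos.trans hz)
  rw [h, zero_sub, norm_neg, norm_one] at h1
  -- With `q = exp(-π Im z)` one has `|θ - 1| ≤ 2q/(1 - q)`, which is less than `1` as soon as `q <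
  -- 1/3`.
  have h2 : Real.exp (-Real.pi * z.im) ≤ 1 / 4 := by
    have h3 : Real.exp (-Real.pi * z.im) ≤ Real.exp (-3) := by
      refine Real.exp_le_exp.2 ?_
      nlinarith [Real.pi_gt_three]
    refine h3.trans ?_
    rw [Real.exp_neg, ← one_div]
    refine one_div_le_one_div_of_le (by norm_num) ?_
    linarith [Real.add_one_le_exp (3 : ℝ)]
  have h3 := Real.exp_pos (-Real.pi * z.im)
  have h4 : 0 < 1 - Real.exp (-Real.pi * z.im) := by linarith
  rw [div_mul_eq_mul_div, le_div_iff₀ h4] at h1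
  linarith

/-- A holomorphic identity on the upper half plane may be divided by a theta function. -/
theorem eqOn_of_mul_jacobiTheta {F G : ℂ → ℂ} {w : ℂ → ℂ}
    (hF : DifferentiableOn ℂ F {z | 0 < z.im}) (hG : DifferentiableOn ℂ G {z | 0 < z.im})
    {c : ℝ} {r : ℝ} (hr : 0 < r) (hw : ∀ z, (w z).im = r * z.im + c)
    (h : ∀ z : ℂ, 0 < z.im → F z * jacobiTheta (w z) = G z * jacobiTheta (w z)) {z : ℂ}
    (hz : 0 < z.im) : F z = G z := by
  obtain ⟨y, hy, hne⟩ := exists_jacobiTheta_ne_zero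
  have hopen : IsOpen {z : ℂ | 0 < z.im} := isOpen_lt continuous_const Complex.continuous_im
  have hconn : IsPreconnected {z : ℂ | 0 < z.im} := (convex_halfSpace_im_gt 0).isPreconnected
  have h0 : 0 < (y + |c|) / r := by positivity
  -- Cancellation is possible high up, where theta has no zeros; the identity theorem extends the
  -- equality downwards.
  have hev : ∀ z : ℂ, (y + |c|) / r < z.im → F z = G z := fun z hz => by
    refine mul_right_cancel₀ (hne (w z) ?_) (h z (h0.trans hz))
    rw [hw]
    rw [div_lt_iff₀ hr] at hz
    linarith [neg_abs_le c]
  have hmem : ((y + |c|) / r + 1 : ℝ) * Complex.I ∈ {z : ℂ | 0 < z.im} := by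
    simp only [Set.mem_ofPred_eq, Complex.im_ofReal_mul, Complex.I_im, mul_one]
    linarith
  refine (hF.analyticOnNhd hopen).eqOn_of_preconnected_of_eventuallyEq (hG.analyticOnNhd hopen)
    hconn hmem ?_ hz
  have hopen2 : IsOpen {z : ℂ | (y + |c|) / r < z.im} :=
    isOpen_lt continuous_const Complex.continuous_im
  filter_upwards [hopen2.mem_nhds (by simp :
    ((y + |c|) / r + 1 : ℝ) * Complex.I ∈ _)] with z hz using hev z hz

/-! ### Orthogonal sums and the theta form of weight one half. -/

namespace FinQuad

section prod

variable {A B : Type*} [AddCommGroup A] [AddCommGroup B] {n : ℕ}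

/-- The orthogonal sum of two finite quadratic modules. -/
def prod (Q : FinQuad A n) (R : FinQuad B n) : FinQuad (A × B) n where
  ψ x := Q.ψ x.1 * R.ψ x.2
  B x y := Q.B x.1 y.1 * R.B x.2 y.2
  ψ_add x y := by rw [Prod.fst_add, Prod.snd_add, Q.ψ_add, R.ψ_add]; ring
  B_add x y z := by rw [Prod.fst_add, Prod.snd_add, Q.B_add, R.B_add]; ring
  B_comm x y := by rw [Q.B_comm, R.B_comm]
  ψ_neg x := by rw [Prod.fst_neg, Prod.snd_neg, Q.ψ_neg, R.ψ_neg]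
  ψ_pow x := by rw [mul_pow, Q.ψ_pow, R.ψ_pow, one_mul]
  nondeg x h := by
    refine Prod.ext (Q.nondeg _ fun y => ?_) (R.nondeg _ fun y => ?_)
    · simpa [R.B_comm x.2, R.B_zero] using h (y, 0)
    · simpa [Q.B_comm x.1, Q.B_zero] using h (0, y)
  n_pos := Q.n_pos

variable [Fintype A] [Fintype B] (Q : FinQuad A n) (R : FinQuad B n)

theorem prod_G (m : ℤ) : (Q.prod R).G m = Q.G m * R.G m := by
  simp only [G, prod, mul_zpow]
  rw [Fintype.sum_prod_type, Finset.sum_mul_sum]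

variable [DecidableEq A] [DecidableEq B] {Q R}

theorem IsWeil.prod {k l : ℝ} {F : ℂ → A → ℂ} {H : ℂ → B → ℂ} (hF : Q.IsWeil 1 k F)
    (hH : R.IsWeil 1 l H) : (Q.prod R).IsWeil 1 (k + l) (fun z x => F z x.1 * H z x.2) where
  map_T z hz x := by
    rw [hF.map_T z hz, hH.map_T z hz, FinQuad.prod]; ring
  map_S z hz := by
    have hz0 : z ≠ 0 := fun h => by simp [h] at hz
    ext x
    rw [hF.map_S z hz, hH.map_S z hz]
    simp only [one_smul, Pi.smul_apply, smul_eq_mul, Complex.ofReal_add]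
    have h1 : (Q.prod R).Sm.mulVec (fun x => F z x.1 * H z x.2) x =
        Q.Sm.mulVec (F z) x.1 * R.Sm.mulVec (H z) x.2 := by
      simp only [Matrix.mulVec, dotProduct, Sm, prod_G]
      rw [Fintype.sum_prod_type, Finset.sum_mul_sum]
      refine Finset.sum_congr rfl fun _ _ => Finset.sum_congr rfl fun _ _ => ?_
      rw [FinQuad.prod, mul_inv, mul_inv]
      ring
    rw [h1, Complex.cpow_add _ _ hz0]
    ring

end prod

theorem _root_.zmod_two_cases (r : ZMod 2) : r = 0 ∨ r = 1 := by
  revert r; decide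

theorem _root_.sum_zmod_two (f : ZMod 2 → ℂ) : ∑ r, f r = f 0 + f 1 := Fin.sum_univ_two f

/-- The finite quadratic module of the lattice `ℤ` with `q(x) = x²`. -/
def theta (n : ℕ) (hn : 4 ∣ n) (hn0 : 0 < n) : FinQuad (ZMod 2) n where
  ψ r := if r = 0 then 1 else Complex.I
  B r s := if r = 0 ∨ s = 0 then 1 else -1
  ψ_add r s := by
    rcases zmod_two_cases r with rfl | rfl <;> rcases zmod_two_cases s with rfl | rfl <;>
      simp [show (1 + 1 : ZMod 2) = 0 from rfl]
  B_add r s t := by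
    rcases zmod_two_cases r with rfl | rfl <;> rcases zmod_two_cases s with rfl | rfl <;>
      rcases zmod_two_cases t with rfl | rfl <;> simp [show (1 + 1 : ZMod 2) = 0 from rfl]
  B_comm r s := by simp only [or_comm]
  ψ_neg r := by simp only [neg_eq_zero]
  ψ_pow r := by
    obtain ⟨m, rfl⟩ := hn
    split_ifs
    · exact one_pow _
    · rw [pow_mul, Complex.I_pow_four, one_pow]
  nondeg r h := by
    by_contra hr
    have := h 1
    simp [hr] at this
    norm_num at this
  n_pos := hn0

theorem theta_G_one (n : ℕ) (hn : 4 ∣ n) (hn0 : 0 < n) :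
    (theta n hn hn0).G 1 = 1 + Complex.I := by
  rw [G, sum_zmod_two]
  simp [theta]

/-- The vector valued theta function of the lattice `ℤ` with `q(x) = x²`. -/
def thetaVec (z : ℂ) (r : ZMod 2) : ℂ :=
  if r = 0 then jacobiTheta (2 * z) else jacobiTheta (z / 2) - jacobiTheta (2 * z)

theorem sum_thetaVec (z : ℂ) : ∑ r, thetaVec z r = jacobiTheta (z / 2) := by
  rw [sum_zmod_two, thetaVec, thetaVec, if_pos rfl, if_neg (by decide)]
  ring

theorem isWeil_thetaVec (n : ℕ) (hn : 4 ∣ n) (hn0 : 0 < n) :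
    (theta n hn hn0).IsWeil 1 (1 / 2) thetaVec where
  map_T z hz r := by
    have h2 : jacobiTheta (2 * (z + 1)) = jacobiTheta (2 * z) := by
      rw [← jacobiTheta_two_add (2 * z)]; ring_nf
    simp only [thetaVec, theta, h2, jacobiTheta_half_add_one hz]
    split_ifs
    · ring
    · ring
  map_S z hz := by
    have hI : (1 + Complex.I)⁻¹ = (1 - Complex.I) / 2 := by
      refine inv_eq_of_mul_eq_one_right ?_
      linear_combination (-1 / 2 : ℂ) * Complex.I_sq
    have e1 : 2 * (-1 / z) = -2 / z := by ring
    ext r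
    have h1 : (theta n hn hn0).Sm.mulVec (thetaVec z) r = (1 - Complex.I) / 2 *
        (thetaVec z 0 + (if r = 0 then 1 else -1) * thetaVec z 1) := by
      have : (theta n hn hn0).Sm.mulVec (thetaVec z) r = (theta n hn hn0).Sm r 0 * thetaVec z 0 +
        (theta n hn hn0).Sm r 1 * thetaVec z 1 := by
        rw [Matrix.mulVec, dotProduct, sum_zmod_two]
      rw [this, Sm, Sm, theta_G_one, hI]
      simp only [theta]
      by_cases hr : r = 0
      · simp [hr]; ring
      · simp [hr]; ring
    simp only [one_smul, Pi.smul_apply, smul_eq_mul, h1]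
    simp only [thetaVec, e1, jacobiTheta_neg_two_div hz, jacobiTheta_neg_one_div_two_mul hz]
    rw [if_neg (by decide : ¬ (1 : ZMod 2) = 0)]
    push_cast
    split_ifs
    · simp; ring
    · ring

end FinQuad

/-! ### The middle cosets for even signature, and the product with theta. -/

namespace EvenLattice

variable {V : Type*} [AddCommGroup V] [Module ℚ V] {L : EvenLattice V} {k : ℝ} {f : L.VVFun}

theorem IsCuspForm.differentiableOn_ext (hf : L.IsCuspForm k f) (μ : L.Disc) :
    DifferentiableOn ℂ (fun z => ext f z μ) {z | 0 < z.im} :=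
  UpperHalfPlane.mdifferentiable_iff.1 (hf.holo μ)

/-- This is the action of `(-j, -y; p, -b)`, of determinant `j b + y p = 1`, at the point `z + b/p`.
-/
theorem mid_point {p : ℕ} (hp : 0 < p) {j b y : ℤ} (h : j * b + y * p = 1) {z : ℂ}
    (hz : 0 < z.im) : ((-j : ℤ) * (z + b / p) + (-y : ℤ)) / ((p : ℤ) * (z + b / p) + (-b : ℤ)) =
      -1 / ((p : ℂ) ^ 2 * z) - j / p := by
  have hp' : (p : ℂ) ≠ 0 := by exact_mod_cast hp.ne'
  have hz0 : z ≠ 0 := fun h => by simp [h] at hz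
  have h' : (j : ℂ) * b + y * p = 1 := by exact_mod_cast h
  have hden : (((p : ℤ) : ℂ) * (z + b / p) + (-b : ℤ)) = p * z := by
    push_cast; field_simp; ring
  rw [hden]
  push_cast
  field_simp
  linear_combination -h'

theorem mid_den {p : ℕ} (hp : 0 < p) (b : ℤ) (z : ℂ) :
    (((p : ℤ) : ℂ) * (z + b / p) + (-b : ℤ)) = p * z := by
  have hp' : (p : ℂ) ≠ 0 := by exact_mod_cast hp.ne'
  push_cast; field_simp; ring

theorem IsCuspForm.isEven (hf : L.IsCuspForm k f) (hf0 : f ≠ 0) (hs : Even L.sig) :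
    L.discQ.IsEven := by
  obtain ⟨m, hm⟩ := hs
  rw [FinQuad.IsEven, hf.G_one_sq _ dvd_rfl L.level_pos hf0, hm]
  have h1 : e (((m + m : ℤ) : ℂ) / 4) = (-1) ^ m := by
    rw [show ((m + m : ℤ) : ℂ) / 4 = m * (1 / 2 : ℂ) by push_cast; ring, e_zmul, e]
    congr 1
    rw [← Complex.exp_pi_mul_I]; ring_nf
  rcases Int.even_or_odd m with h | h
  · exact ⟨1, .inl rfl, by rw [h1, h.neg_one_zpow]; push_cast; ring⟩
  · exact ⟨-1, .inr rfl, by rw [h1, h.neg_one_zpow]; push_cast; ring⟩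

/-- Apply the Weil formula to the matrix of `mid_point`. Its lower right entry `-b` is divisible by
the level, so the factor of `K` in `ψ y` disappears. -/
theorem IsCuspForm.midFormula_even (hf : L.IsCuspForm k f) (hf0 : f ≠ 0) (hs : Even L.sig)
    {p : ℕ} (hp : 0 < p) {j b : ℤ} (hb : (L.level : ℤ) ∣ b) (hj : (p : ℤ) ∣ 1 - j * b) :
    MidFormula L k f p j b (L.discQ.G p / L.discQ.G 1) := by
  classical
  intro c' hc z hz x
  obtain ⟨y, hy⟩ := hj
  obtain ⟨κ, hκ⟩ := hf.exists_int hf0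
  obtain ⟨m, hm⟩ := hs
  have hκ' : k = ((κ + m : ℤ) : ℝ) := by rw [hκ, hm]; push_cast; ring
  have h := (hf.isWeil _ dvd_rfl L.level_pos hf0).map_of_coprime (hf.isEven hf0 ⟨m, hm⟩) hκ'
    (a := -j) (b := -y) (c := p) (d := -b) (c' := c') (by linarith) hc (im_add_ratio_pos hz b p)
  rw [mid_point hp (by linarith) hz, mid_den hp] at h
  rw [h, Pi.smul_apply, smul_eq_mul, hκ', Complex.ofReal_intCast, Complex.cpow_intCast]
  have hG := L.discQ.G_one_ne_zero
  have h2 : ∀ y, L.discQ.K (-j) (-b) c' x y = e (L.qD x) ^ (-j * c') * e (L.bD x y) ^ (-c') :=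
    fun y => by
      have : L.discQ.ψ y ^ (-b * c') = 1 := by
        rw [← zpow_zero (L.discQ.ψ y)]
        refine L.discQ.ψ_zpow_congr ?_ y
        rw [Int.cast_zero, ZMod.intCast_zmod_eq_zero_iff_dvd]
        exact Dvd.dvd.mul_right ((dvd_neg).2 hb) _
      rw [FinQuad.K, this, mul_one]; rfl
  simp only [Matrix.mulVec, dotProduct, h2]
  field_simp

section odd

variable (L)

/-- The discriminant form of the orthogonal sum of `L` and `ℤ` with `q(x) = x²`. -/
def thetaQ : FinQuad (L.Disc × ZMod 2) (4 * L.level) :=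
  (L.discQuad (4 * L.level) (dvd_mul_left _ _) (by have := L.level_pos; positivity)).prod
    (FinQuad.theta _ (dvd_mul_right _ _) (by have := L.level_pos; positivity))

variable {L}

theorem thetaQ_G_one : L.thetaQ.G 1 = L.discQ.G 1 * (1 + Complex.I) := by
  rw [thetaQ, FinQuad.prod_G, FinQuad.theta_G_one]; rfl

/-- The factor `(1 + i)² = 2i` of the theta part supplies `e(1/4)`, which raises the signature to
the even number `2m`. -/
theorem IsCuspForm.thetaQ_G_one_sq (hf : L.IsCuspForm k f) (hf0 : f ≠ 0) {m : ℤ}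
    (hm : L.sig = 2 * m - 1) : L.thetaQ.G 1 ^ 2 = (-1) ^ m * (2 * Fintype.card L.Disc) := by
  rw [thetaQ_G_one, mul_pow, hf.G_one_sq _ dvd_rfl L.level_pos hf0, hm]
  have h1 : e (((2 * m - 1 : ℤ) : ℂ) / 4) * Complex.I = (-1) ^ m := by
    have h2 : (-1 : ℂ) = e (1 / 2) := by rw [e, ← Complex.exp_pi_mul_I]; ring_nf
    have h3 : Complex.I = e (1 / 4) := by
      rw [e]
      conv_lhs => rw [← Complex.exp_pi_div_two_mul_I]
      ring_nf
    have h4 : e (1 / 2 : ℂ) ^ m = e (m * (1 / 2)) := (e_zmul _ _).symm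
    rw [h2, h4, h3, ← e_add]
    congr 1
    push_cast; ring
  rw [← h1]
  linear_combination (Fintype.card L.Disc * e (((2 * m - 1 : ℤ) : ℂ) / 4)) * Complex.I_sq

theorem IsCuspForm.isEven_thetaQ (hf : L.IsCuspForm k f) (hf0 : f ≠ 0) (hs : Odd L.sig) :
    L.thetaQ.IsEven := by
  obtain ⟨m, hm⟩ := hs
  have hm' : L.sig = 2 * (m + 1) - 1 := by omega
  have hc : (Fintype.card (L.Disc × ZMod 2) : ℂ) = 2 * Fintype.card L.Disc := by
    rw [Fintype.card_prod, ZMod.card]; push_cast; ring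
  rw [FinQuad.IsEven, hf.thetaQ_G_one_sq hf0 hm', hc]
  rcases Int.even_or_odd (m + 1) with h | h
  · exact ⟨1, .inl rfl, by rw [h.neg_one_zpow]; push_cast; ring⟩
  · exact ⟨-1, .inr rfl, by rw [h.neg_one_zpow]; push_cast; ring⟩

theorem IsCuspForm.isWeil_thetaQ (hf : L.IsCuspForm k f) (hf0 : f ≠ 0) [DecidableEq L.Disc] :
    L.thetaQ.IsWeil 1 (k + 1 / 2) (fun z x => ext f z x.1 * FinQuad.thetaVec z x.2) :=
  (hf.isWeil _ _ _ hf0).prod (FinQuad.isWeil_thetaVec _ _ _)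

theorem thetaQ_K {j b c c' : ℤ} (hb : ((4 * L.level : ℕ) : ℤ) ∣ b)
    (hc : ((c : ℤ) : ZMod L.level) = c') (x : L.Disc) (y : L.Disc × ZMod 2) :
    L.thetaQ.K (-j) (-b) c (x, 0) y = e (L.qD x) ^ (-j * c') * e (L.bD x y.1) ^ (-c') := by
  have h1 : L.thetaQ.ψ y ^ (-b * c) = 1 := by
    rw [← zpow_zero (L.thetaQ.ψ y)]
    refine L.thetaQ.ψ_zpow_congr ?_ y
    rw [Int.cast_zero, ZMod.intCast_zmod_eq_zero_iff_dvd]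
    exact Dvd.dvd.mul_right ((dvd_neg).2 hb) _
  have h2 : L.thetaQ.ψ (x, 0) = L.discQ.ψ x := by
    simp [thetaQ, FinQuad.prod, FinQuad.theta]; rfl
  have h3 : L.thetaQ.B (x, 0) y = L.discQ.B x y.1 := by
    simp [thetaQ, FinQuad.prod, FinQuad.theta]; rfl
  rw [FinQuad.K, h1, mul_one, h2, h3, L.discQ.ψ_zpow_congr (j := -j * c') (by push_cast; rw [hc]),
    L.discQ.B_zpow_congr (j := -c') (by push_cast; rw [hc])]
  rfl

/-- The `(x, 0)` component for `L ⊕ ℤ`, in integral weight `k + 1/2`. At theta index `0` the kernel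
ignores the theta index of `y`, so the theta components are just added up. -/
theorem IsCuspForm.mid_mul_theta (hf : L.IsCuspForm k f) (hf0 : f ≠ 0) (hs : Odd L.sig)
    {p : ℕ} (hp : 0 < p) {j b : ℤ} (hb : ((4 * L.level : ℕ) : ℤ) ∣ b) (hj : (p : ℤ) ∣ 1 - j * b)
    {c c' : ℤ} (hc : ((p * c : ℤ) : ZMod (4 * L.level)) = (1 : ℤ))
    (hcc : ((c : ℤ) : ZMod L.level) = c') {z : ℂ} (hz : 0 < z.im) (x : L.Disc) :
    ext f (-1 / ((p : ℂ) ^ 2 * z) - j / p) x *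
      jacobiTheta (2 * (-1 / ((p : ℂ) ^ 2 * z) - j / p)) =
    ((p : ℂ) * z) ^ ((k : ℂ) + 1 / 2) * (L.thetaQ.G p / L.thetaQ.G 1 ^ 2) *
      (∑ y, e (L.qD x) ^ (-j * c') * e (L.bD x y) ^ (-c') * ext f (z + b / p) y) *
        jacobiTheta ((z + b / p) / 2) := by
  classical
  obtain ⟨y, hy⟩ := hj
  obtain ⟨κ, hκ⟩ := hf.exists_int hf0
  obtain ⟨m, hm⟩ := hs
  have hκ' : k + 1 / 2 = ((κ + m + 1 : ℤ) : ℝ) := by rw [hκ, hm]; push_cast; ring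
  have h := (hf.isWeil_thetaQ hf0).map_of_coprime (hf.isEven_thetaQ hf0 ⟨m, hm⟩) hκ'
    (a := -j) (b := -y) (c := p) (d := -b) (c' := c) (by linarith) hc (im_add_ratio_pos hz b p)
  rw [mid_point hp (by linarith) hz, mid_den hp] at h
  have hκc : (k : ℂ) + 1 / 2 = ((κ + m + 1 : ℤ) : ℂ) := by
    have := congrArg Complex.ofReal hκ'
    push_cast at this ⊢
    exact this
  have h3 := congrFun h (x, 0)
  simp only [Pi.smul_apply, smul_eq_mul, Matrix.mulVec, dotProduct, thetaQ_K hb hcc] at h3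
  rw [FinQuad.thetaVec, if_pos rfl] at h3
  rw [h3, hκc, Complex.cpow_intCast, ← FinQuad.sum_thetaVec, Fintype.sum_prod_type]
  refine Eq.trans ?_ (mul_assoc _ _ _).symm
  rw [Finset.sum_mul_sum]
  congr 1
  refine Finset.sum_congr rfl fun _ _ => Finset.sum_congr rfl fun _ _ => ?_
  ring

end odd

end EvenLattice

/-! ### Quadratic Gauss sums modulo `p`. -/

/-- The finite quadratic module `ℤ / p` with `q(x) = x² / p`. -/
def FinQuad.zmod (p : ℕ) [Fact p.Prime] (hp : p ≠ 2) : FinQuad (ZMod p) p where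
  ψ r := ZMod.stdAddChar (r ^ 2)
  B r s := ZMod.stdAddChar (2 * r * s)
  ψ_add r s := by
    rw [← AddChar.map_add_eq_mul, ← AddChar.map_add_eq_mul]; congr 1; ring
  B_add r s t := by rw [← AddChar.map_add_eq_mul]; congr 1; ring
  B_comm r s := by congr 1; ring
  ψ_neg r := by rw [neg_sq]
  ψ_pow r := by
    rw [← AddChar.map_nsmul_eq_pow, nsmul_eq_mul, ZMod.natCast_self, zero_mul,
      AddChar.map_zero_eq_one]
  nondeg r h := by
    by_contra hr
    have h2 : (2 : ZMod p) ≠ 0 := by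
      have := (ZMod.natCast_eq_zero_iff 2 p).not.2 fun h =>
        hp ((Nat.prime_dvd_prime_iff_eq Fact.out Nat.prime_two).1 h)
      simpa using this
    have h3 : (2 : ZMod p) * r ≠ 0 := mul_ne_zero h2 hr
    have h4 := ZMod.isPrimitive_stdAddChar p h3
    exact h4 (by ext s; simpa using h s)
  n_pos := (Fact.out : p.Prime).pos

theorem FinQuad.zmod_G (p : ℕ) [Fact p.Prime] (hp : p ≠ 2) (a : ℤ) :
    (FinQuad.zmod p hp).G a = quadGauss p a := by
  rw [G, quadGauss]
  refine Finset.sum_congr rfl fun r _ => ?_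
  simp only [zmod]
  rw [← AddChar.map_zsmul_eq_zpow, zsmul_eq_mul]

theorem quadGauss_mul_neg {p : ℕ} [Fact p.Prime] (hp : p ≠ 2) {a : ZMod p} (ha : a ≠ 0) :
    quadGauss p a * quadGauss p (-a) = p := by
  obtain ⟨m, rfl⟩ := ZMod.intCast_surjective a
  obtain ⟨m', hm'⟩ := ZMod.intCast_surjective ((m : ZMod p)⁻¹)
  have h := (FinQuad.zmod p hp).G_mul_G_neg (m := m) (m' := m')
    (by push_cast; rw [hm', mul_inv_cancel₀ ha])
  rw [FinQuad.zmod_G, FinQuad.zmod_G, ZMod.card] at h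
  exact_mod_cast h

theorem quadGauss_ne_zero {p : ℕ} [Fact p.Prime] (hp : p ≠ 2) {a : ZMod p} (ha : a ≠ 0) :
    quadGauss p a ≠ 0 := fun h => by
  have := quadGauss_mul_neg hp ha
  rw [h, zero_mul] at this
  exact (Fact.out : p.Prime).ne_zero (by exact_mod_cast this.symm)

theorem quadGauss_mul_sq {p : ℕ} [Fact p.Prime] (a : ZMod p) {u : ZMod p} (hu : u ≠ 0) :
    quadGauss p (a * u ^ 2) = quadGauss p a := by
  rw [quadGauss, quadGauss]
  refine Fintype.sum_equiv (Equiv.mulLeft₀ u hu) _ _ fun r => ?_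
  simp only [Equiv.mulLeft₀_apply]
  congr 1; ring

theorem norm_quadGauss_sq {p : ℕ} [Fact p.Prime] (hp : p ≠ 2) {a : ZMod p} (ha : a ≠ 0) :
    ‖quadGauss p a‖ ^ 2 = p := by
  have h : quadGauss p (-a) = starRingEnd ℂ (quadGauss p a) := by
    rw [quadGauss, quadGauss, map_sum]
    refine Finset.sum_congr rfl fun r _ => ?_
    rw [neg_mul, AddChar.map_neg_eq_conj]
  have h2 := quadGauss_mul_neg hp ha
  rw [h, Complex.mul_conj, Complex.normSq_eq_norm_sq] at h2
  exact_mod_cast h2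

/-- Extended to `u = 0` and summed over `u` first, the double sum is `p` times the number of square
roots of `-n`, which is one more than the quadratic character; the term `u = 0` accounts for this
one. -/
theorem sum_quadGauss_mul {p : ℕ} [Fact p.Prime] (hp : p ≠ 2) (n : ZMod p) :
    ∑ u : ZMod p with u ≠ 0, quadGauss p u * (ZMod.stdAddChar (n * u) : ℂ)
      = p * quadraticChar (ZMod p) (-n) := by
  have h1 : ∑ u : ZMod p, quadGauss p u * (ZMod.stdAddChar (n * u) : ℂ)
      = ∑ r : ZMod p, if r ^ 2 = -n then (p : ℂ) else 0 := by
    simp_rw [quadGauss, Finset.sum_mul]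
    rw [Finset.sum_comm]
    refine Finset.sum_congr rfl fun r _ => ?_
    have h2 := AddChar.sum_mulShift (R' := ℂ) (r ^ 2 + n) (ZMod.isPrimitive_stdAddChar p)
    rw [ZMod.card] at h2
    simp only [← eq_neg_iff_add_eq_zero, Nat.cast_ite, Nat.cast_zero] at h2
    rw [← h2]
    refine Finset.sum_congr rfl fun u _ => ?_
    rw [← AddChar.map_add_eq_mul]; congr 1; ring
  have h3 := quadraticChar_card_sqrts (F := ZMod p) (by rwa [ZMod.ringChar_zmod_n]) (-n)
  have h4 : ∑ r : ZMod p, (if r ^ 2 = -n then (p : ℂ) else 0) =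
      p * (quadraticChar (ZMod p) (-n) + 1) := by
    rw [← Finset.sum_filter, Finset.sum_const, nsmul_eq_mul, mul_comm]
    congr 1
    have h5 : ((Finset.univ.filter fun r : ZMod p => r ^ 2 = -n).card : ℤ)
        = quadraticChar (ZMod p) (-n) + 1 := by
      rw [← h3]; congr 2; ext r; simp
    exact_mod_cast congrArg (Int.cast (R := ℂ)) h5
  rw [h4, ← Finset.sum_filter_add_sum_filter_not Finset.univ (fun u : ZMod p => u ≠ 0)] at h1
  have h6 : ∑ u : ZMod p with ¬ u ≠ 0, quadGauss p u * (ZMod.stdAddChar (n * u) : ℂ) = p := by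
    simp only [not_not, Finset.filter_eq', Finset.mem_univ, if_true, Finset.sum_singleton]
    simp [quadGauss, ZMod.card]
  rw [h6] at h1
  linear_combination h1

/-! ### The middle cosets for odd signature. -/

namespace EvenLattice

variable {V : Type*} [AddCommGroup V] [Module ℚ V] {L : EvenLattice V} {k : ℝ} {f : L.VVFun}

/-- Insert `jacobiTheta_mid` on the left of `mid_mul_theta` and divide by the common theta function.
The constant is the one for `L ⊕ ℤ` divided by the Gauss sum of theta; the factor `4` in the divisor
of `b` serves both the level of `L ⊕ ℤ` and the translate `4b'/p` in theta. -/
theorem IsCuspForm.midFormula_odd (hf : L.IsCuspForm k f) (hf0 : f ≠ 0) (hs : Odd L.sig)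
    {p : ℕ} [Fact p.Prime] (hp2 : p ≠ 2) (hpL : ¬ p ∣ L.level) {j b : ℤ}
    (hb : ((4 * L.level : ℕ) : ℤ) ∣ b) (hj : (p : ℤ) ∣ 1 - j * b) :
    MidFormula L k f p j b
      (L.thetaQ.G p / L.thetaQ.G 1 * ((p : ℂ) ^ (1 / 2 : ℂ) / quadGauss p (-j))) := by
  intro c' hc z hz x
  have hp := (Fact.out : p.Prime)
  have hpc : (p : ℂ) ≠ 0 := by exact_mod_cast hp.ne_zero
  have hcop : IsCoprime (p : ℤ) ((4 * L.level : ℕ) : ℤ) := by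
    refine Nat.isCoprime_iff_coprime.2 (Nat.Coprime.mul_right ?_ ?_)
    · have := (Nat.coprime_primes hp Nat.prime_two).2 hp2
      exact (this.pow_right 2)
    · exact (Nat.Prime.coprime_iff_not_dvd hp).2 hpL
  obtain ⟨c, hcc⟩ := zmod_unit_iff.2 hcop
  have hc1 : ((c : ℤ) : ZMod L.level) = c' := by
    have h1 : ((p * c : ℤ) : ZMod L.level) = (1 : ℤ) := by
      rw [ZMod.intCast_eq_intCast_iff_dvd_sub] at hcc ⊢
      refine dvd_trans ?_ hcc
      push_cast
      exact dvd_mul_left _ _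
    push_cast at h1 hc ⊢
    linear_combination (c' : ZMod L.level) * h1 - (c : ZMod L.level) * hc
  obtain ⟨b', hb'⟩ : ∃ b', b = 4 * b' := by
    obtain ⟨m, rfl⟩ := hb
    exact ⟨L.level * m, by push_cast; ring⟩
  have hjb : ((j * (4 * b') : ℤ) : ZMod p) = (1 : ℤ) := by
    rw [ZMod.intCast_eq_intCast_iff_dvd_sub, ← hb']
    exact hj
  have hj0 : (-j : ZMod p) ≠ 0 := fun h => by
    rw [neg_eq_zero] at h
    push_cast at hjb
    rw [h, zero_mul] at hjb
    exact zero_ne_one hjb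
  have hg := quadGauss_ne_zero hp2 hj0
  have hG := L.discQ.G_one_ne_zero
  have hI : (1 + Complex.I) ≠ 0 := fun h => by
    have := congrArg Complex.re h
    simp at this
  have hII : (1 - Complex.I) * (1 + Complex.I) = 2 := by
    linear_combination - Complex.I_sq
  have him : ∀ z : ℂ, 0 < z.im → 0 < (-1 / ((p : ℂ) ^ 2 * z) - j / p).im := fun z hz => by
    have h1 : (j / p : ℂ) = ((j / p : ℝ) : ℂ) := by push_cast; rfl
    rw [Complex.sub_im, h1, Complex.ofReal_im, sub_zero]
    exact Complex.im_neg_one_div_pos (im_mul_sq_pos hp.pos hz)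
  have himp : ∀ z : ℂ, 0 < z.im → 0 < ((p : ℂ) * z).im := fun z hz => by
    have : (p : ℂ) * z = ((p : ℝ) : ℂ) * z := by push_cast; rfl
    rw [this, Complex.im_ofReal_mul]
    exact mul_pos (by exact_mod_cast hp.pos) hz
  have hne : ∀ z : ℂ, 0 < z.im → z ≠ 0 := fun z hz h => by simp [h] at hz
  refine eqOn_of_mul_jacobiTheta (F := fun z => ext f (-1 / ((p : ℂ) ^ 2 * z) - j / p) x)
    (G := fun z => ((p : ℂ) * z) ^ (k : ℂ) * (L.discQ.G 1)⁻¹ * (L.thetaQ.G p / L.thetaQ.G 1 *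
      ((p : ℂ) ^ (1 / 2 : ℂ) / quadGauss p (-j))) *
      ∑ y, e (L.qD x) ^ (-j * c') * e (L.bD x y) ^ (-c') * ext f (z + b / p) y)
    (w := fun z => (z + b / p) / 2) (c := 0) (r := 1 / 2) ?_ ?_ (by norm_num) ?_ ?_ hz
  · refine (hf.differentiableOn_ext x).comp (t := {z : ℂ | 0 < z.im}) (f := fun z : ℂ => -1 / ((p : ℂ) ^ 2 * z) - j / p) ?_
      fun z hz => him z hz
    refine DifferentiableOn.sub_const (DifferentiableOn.div (differentiableOn_const _) ?_ ?_) _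
    · fun_prop
    · intro z hz
      exact mul_ne_zero (pow_ne_zero 2 hpc) (hne z hz)
  · refine DifferentiableOn.mul (DifferentiableOn.mul_const (DifferentiableOn.mul_const
      (DifferentiableOn.cpow_const (by fun_prop) ?_) _) _) ?_
    · intro z hz
      exact Complex.mem_slitPlane_iff.2 (.inr (himp z hz).ne')
    · refine DifferentiableOn.fun_sum fun y _ => DifferentiableOn.const_mul ?_ _
      refine (hf.differentiableOn_ext y).comp (t := {z : ℂ | 0 < z.im}) (f := fun z : ℂ => z + b / p) (by fun_prop) ?_
      intro z hz
      exact im_add_ratio_pos hz b p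
  · intro z
    have : (z + b / p) / 2 = ((1 / 2 : ℝ) : ℂ) * z + ((b / p / 2 : ℝ) : ℂ) := by push_cast; ring
    rw [this, Complex.add_im, Complex.im_ofReal_mul, Complex.ofReal_im]
  · intro z hz
    have h1 := hf.mid_mul_theta hf0 hs hp.pos hb hj hcc hc1 hz x
    have h2 := jacobiTheta_mid hjb hz
    rw [← hb'] at h2
    have hpz : (p : ℂ) * z ≠ 0 := mul_ne_zero hpc (hne z hz)
    have h3 : ((p : ℂ) * z) ^ ((k : ℂ) + 1 / 2) =
        ((p : ℂ) * z) ^ (k : ℂ) * ((p : ℂ) ^ (1 / 2 : ℂ) * z ^ (1 / 2 : ℂ)) := by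
      rw [Complex.cpow_add _ _ hpz]
      congr 1
      have := Complex.ofReal_mul_cpow (r := p) (by exact_mod_cast hp.pos) (hne z hz) (1 / 2)
      simpa using this
    have hz2 : z ^ (1 / 2 : ℂ) ≠ 0 := by simp [hne z hz]
    rw [h2, h3, thetaQ_G_one] at h1
    rw [thetaQ_G_one]
    generalize (∑ y, e (L.qD x) ^ (-j * c') * e (L.bD x y) ^ (-c') * ext f (z + b / p) y) = S at *
    generalize ext f (-1 / ((p : ℂ) ^ 2 * z) - j / p) x = X at *
    generalize jacobiTheta ((z + b / p) / 2) = Θ at *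
    field_simp at h1 ⊢
    linear_combination (1 / 2 : ℂ) * h1 -
      (1 / 2 : ℂ) * X * quadGauss p (-j) * L.discQ.G 1 ^ 2 * (1 + Complex.I) * Θ * hII

end EvenLattice

/-! ### The quotient of Gauss sums at a prime as a quadratic symbol. -/

theorem Finset.exists_sum_pow_prime_eq {ι R : Type*} [CommRing R] {p : ℕ} (hp : p.Prime)
    (s : Finset ι) (g : ι → R) : ∃ r, (∑ x ∈ s, g x) ^ p = ∑ x ∈ s, g x ^ p + p * r := by
  classical
  induction s using Finset.induction_on with
  | empty => exact ⟨0, by simp [hp.ne_zero]⟩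
  | insert a s ha ih =>
    obtain ⟨r, hr⟩ := ih
    obtain ⟨t, ht⟩ := exists_add_pow_prime_eq hp (g a) (∑ x ∈ s, g x)
    refine ⟨r + g a * (∑ x ∈ s, g x) * t, ?_⟩
    rw [Finset.sum_insert ha, Finset.sum_insert ha, ht, hr]
    ring

theorem exists_int_of_isIntegral_mul {p : ℕ} (hp : p ≠ 0) {s : ℂ} (hs : IsIntegral ℤ s) {a : ℤ}
    (h : p * s = a) : ∃ m : ℤ, a = p * m := by
  have hp' : (p : ℂ) ≠ 0 := by exact_mod_cast hp
  have h1 : s = algebraMap ℚ ℂ (a / p : ℚ) := by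
    rw [eq_ratCast]; push_cast; field_simp; linear_combination h
  rw [h1, isIntegral_algebraMap_iff (algebraMap ℚ ℂ).injective] at hs
  obtain ⟨m, hm⟩ := IsIntegrallyClosed.isIntegral_iff.1 hs
  refine ⟨m, ?_⟩
  have hp2 : (p : ℚ) ≠ 0 := by exact_mod_cast hp
  rw [eq_intCast] at hm
  have h2 : (a : ℚ) = p * m := by rw [hm]; field_simp
  exact_mod_cast h2

/-- Modulo `p`, in the algebraic integers, `G 1 ^ p ≡ G p`. Multiplication by `G 1` gives
`M^((p+1)/2) ≡ δ M` for the sign `δ = G p / G 1`, so Euler's criterion yields `δ = (M / p)`. -/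
theorem FinQuad.IsEven.G_prime {A : Type*} [AddCommGroup A] [Fintype A] {n : ℕ} {Q : FinQuad A n}
    (hQ : Q.IsEven) {p : ℕ} [Fact p.Prime] (hp2 : p ≠ 2) (hpn : IsCoprime (p : ℤ) n) {M : ℤ}
    (hM : Q.G 1 ^ 2 = M) (hpM : ¬ (p : ℤ) ∣ M) : Q.G p = jacobiSym M p * Q.G 1 := by
  have hp := (Fact.out : p.Prime)
  obtain ⟨δ, hδ, hG⟩ := hQ.G_eq hpn
  have hint : ∀ x, IsIntegral ℤ (Q.ψ x) := fun x =>
    IsIntegral.of_pow Q.n_pos (by rw [Q.ψ_pow]; exact isIntegral_one)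
  let g : A → integralClosure ℤ ℂ := fun x => ⟨Q.ψ x, hint x⟩
  obtain ⟨r, hr⟩ := Finset.exists_sum_pow_prime_eq hp Finset.univ g
  have hr' : Q.G 1 ^ p = Q.G p + p * (r : ℂ) := by
    have := congrArg (Subtype.val) hr
    push_cast at this
    simpa [G, g] using this
  have hG1 : IsIntegral ℤ (Q.G 1) := by
    rw [G]
    exact IsIntegral.sum _ fun x _ => by simpa using hint x
  obtain ⟨h, hh⟩ := hp.odd_of_ne_two hp2
  have h1 : (p : ℂ) * (r * Q.G 1) = ((M ^ (h + 1) - δ * M : ℤ) : ℂ) := by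
    have h2 : Q.G 1 ^ p * Q.G 1 = (M : ℂ) ^ (h + 1) := by
      rw [← hM, ← pow_mul, hh]; ring
    push_cast
    rw [hr', hG] at h2
    linear_combination h2 - (δ : ℂ) * hM
  obtain ⟨m, hm⟩ := exists_int_of_isIntegral_mul hp.ne_zero (r.2.mul hG1) h1
  have h3 : (p : ℤ) ∣ M ^ h - δ := by
    have : (p : ℤ) ∣ M * (M ^ h - δ) := ⟨m, by rw [← hm]; ring⟩
    exact ((Nat.prime_iff_prime_int.1 hp).dvd_or_dvd this).resolve_left hpM
  have h4 : ((legendreSym p M : ℤ) : ZMod p) = (δ : ZMod p) := by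
    rw [legendreSym.eq_pow, show p / 2 = h by omega]
    rw [← ZMod.intCast_zmod_eq_zero_iff_dvd] at h3
    push_cast at h3
    linear_combination h3
  have h5 : legendreSym p M = δ := by
    rw [ZMod.intCast_eq_intCast_iff_dvd_sub] at h4
    have hp3 : 3 ≤ p := by have := hp.two_le; omega
    have h0 : (M : ZMod p) ≠ 0 := fun h => hpM ((ZMod.intCast_zmod_eq_zero_iff_dvd _ _).1 h)
    obtain ⟨q, hq⟩ := h4
    have hq0 : q = 0 := by
      rcases legendreSym.eq_one_or_neg_one p h0 with h | h <;> rcases hδ with rfl | rfl <;>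
        rw [h] at hq <;> by_contra hne <;> rcases lt_or_gt_of_ne hne with h6 | h6 <;> nlinarith
    rw [hq0] at hq
    linarith
  rw [hG, ← h5, jacobiSym.legendreSym.to_jacobiSym]

namespace EvenLattice

variable {V : Type*} [AddCommGroup V] [Module ℚ V] {L : EvenLattice V} {k : ℝ} {f : L.VVFun}

theorem not_dvd_card {p : ℕ} (hp : p.Prime) (hpL : ¬ p ∣ L.level) : ¬ p ∣ Nat.card L.Disc := by
  intro h
  have : Fact p.Prime := ⟨hp⟩
  obtain ⟨x, hx⟩ := exists_prime_addOrderOf_dvd_card' p h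
  refine hpL ?_
  rw [← hx]
  refine addOrderOf_dvd_of_nsmul_eq_zero ?_
  rw [← natCast_zsmul]
  exact L.discQ.zsmul_eq_zero x

/-- For odd level `G 1 ^ 2 = ± |D|` by `isEven_of_odd`, so `e(sig/4) = ± 1` and the signature is
even. -/
theorem IsCuspForm.even_level (hf : L.IsCuspForm k f) (hf0 : f ≠ 0) (hs : Odd L.sig) :
    Even L.level := by
  classical
  by_contra hodd
  rw [Nat.not_even_iff_odd] at hodd
  obtain ⟨ε, hε, h⟩ := L.discQ.isEven_of_odd hodd
  rw [hf.G_one_sq _ dvd_rfl L.level_pos hf0, mul_comm] at h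
  have hc : (Fintype.card L.Disc : ℂ) ≠ 0 := FinQuad.card_ne_zero
  have h1 := mul_right_cancel₀ hc h
  have h2 : e (((2 : ℕ) : ℂ) * (L.sig / 4)) = 1 := by
    rw [e_nmul, h1]
    rcases hε with rfl | rfl <;> norm_num
  obtain ⟨m, hm⟩ := e_eq_one_iff.1 h2
  have h3 : L.sig = 2 * m := by
    have : (L.sig : ℂ) = 2 * m := by rw [← hm]; push_cast; ring
    exact_mod_cast this
  exact (Int.not_even_iff_odd.2 hs) ⟨m, by omega⟩

theorem IsCuspForm.ne_two (hf : L.IsCuspForm k f) (hf0 : f ≠ 0) (hs : Odd L.sig) {p : ℕ}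
    (hpL : ¬ p ∣ L.level) : p ≠ 2 := by
  rintro rfl
  exact hpL (hf.even_level hf0 hs).two_dvd

theorem IsCuspForm.thetaQ_G (hf : L.IsCuspForm k f) (hf0 : f ≠ 0) {m : ℤ}
    (hm : L.sig = 2 * m - 1) {p : ℕ} (hp : p.Prime) (hpL : ¬ p ∣ L.level) :
    L.thetaQ.G p / L.thetaQ.G 1 =
      (jacobiSym ((if Even m then 1 else -1) * (2 * Nat.card L.Disc)) p : ℤ) := by
  have : Fact p.Prime := ⟨hp⟩
  have hs : Odd L.sig := ⟨m - 1, by omega⟩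
  have hp2 := hf.ne_two hf0 hs hpL
  have hcop : IsCoprime (p : ℤ) ((4 * L.level : ℕ) : ℤ) := by
    refine Nat.isCoprime_iff_coprime.2 (Nat.Coprime.mul_right ?_ ?_)
    · have := (Nat.coprime_primes hp Nat.prime_two).2 hp2
      exact (this.pow_right 2)
    · exact (Nat.Prime.coprime_iff_not_dvd hp).2 hpL
  have h := (hf.isEven_thetaQ hf0 hs).G_prime hp2 hcop
    (M := (if Even m then 1 else -1) * (2 * Nat.card L.Disc)) ?_ ?_
  · rw [h, mul_div_cancel_right₀ _ L.thetaQ.G_one_ne_zero]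
  · rw [hf.thetaQ_G_one_sq hf0 hm, Nat.card_eq_fintype_card]
    split_ifs with h
    · rw [h.neg_one_zpow]; push_cast; ring
    · rw [(Int.not_even_iff_odd.1 h).neg_one_zpow]; push_cast; ring
  · intro h
    have h2 : (p : ℤ) ∣ 2 * Nat.card L.Disc := by
      split_ifs at h
      · simpa using h
      · simpa using h
    have h3 : p ∣ 2 * Nat.card L.Disc := by exact_mod_cast h2
    rcases hp.dvd_mul.1 h3 with h4 | h4
    · exact hp2 ((Nat.prime_dvd_prime_iff_eq hp Nat.prime_two).1 h4)
    · exact not_dvd_card hp hpL h4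

theorem kroneckerSym_neg_one {v m : ℕ} (hm : Odd m) : kroneckerSym (-1) (2 ^ v * m) = ZMod.χ₄ m := by
  have h1 : (2 ^ v * m).factorization 2 = v := by
    rw [Nat.factorization_mul (by positivity) hm.pos.ne', Nat.prime_two.factorization_pow]
    simp [Nat.factorization_eq_zero_of_not_dvd hm.not_two_dvd_nat]
  rw [kroneckerSym, h1, Nat.mul_div_cancel_left _ (by positivity), jacobiSym.at_neg_one hm]
  have : ZMod.χ₈ ((-1 : ℤ) : ZMod 8) = 1 := by decide
  rw [this, one_pow, one_mul]

theorem kroneckerSym_mul {v m : ℕ} (hm : Odd m) (a : ℤ) :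
    kroneckerSym a (2 ^ v * m) = ZMod.χ₈ a ^ v * jacobiSym a m := by
  have h1 : (2 ^ v * m).factorization 2 = v := by
    rw [Nat.factorization_mul (by positivity) hm.pos.ne', Nat.prime_two.factorization_pow]
    simp [Nat.factorization_eq_zero_of_not_dvd hm.not_two_dvd_nat]
  rw [kroneckerSym, h1, Nat.mul_div_cancel_left _ (by positivity)]

/-- Quadratic reciprocity for the odd part `r` of `|D|`. Its sign and `(-1 / p)^m` combine to the
power of `ε_p`, because the Kronecker symbol `(-1 / |D|)` only records `r` modulo `4`. -/
theorem chiD_eq {m : ℤ} (hm : L.sig = 2 * m - 1) {p : ℕ} (hp : Odd p) :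
    L.chiD p = (jacobiSym ((if Even m then 1 else -1) * (2 * Nat.card L.Disc)) p : ℤ) := by
  have hc : Nat.card L.Disc ≠ 0 := Nat.card_pos.ne'
  obtain ⟨v, r, hr2, hr⟩ := Nat.exists_eq_two_pow_mul_odd hc
  have h8 : ZMod.χ₈ ((p : ℤ) : ZMod 8) = jacobiSym 2 p := by
    rw [jacobiSym.at_two hp]; push_cast; rfl
  have hk2 : kroneckerSym p 2 = jacobiSym 2 p := by
    have := kroneckerSym_mul (v := 1) (m := 1) odd_one (p : ℤ)
    rw [pow_one, mul_one, pow_one, jacobiSym.one_right, mul_one, h8] at this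
    exact this
  have hj2 : jacobiSym 2 p = 1 ∨ jacobiSym 2 p = -1 := by
    refine jacobiSym.eq_one_or_neg_one ?_
    have : Nat.gcd 2 p = 1 := (Nat.coprime_two_left.2 hp)
    simpa [Int.gcd] using this
  have hj2' : jacobiSym 2 p ^ L.sig.natAbs = jacobiSym 2 p := by
    have hodd : Odd L.sig.natAbs := by
      rw [Int.natAbs_odd, hm]; exact ⟨m - 1, by ring⟩
    rcases hj2 with h | h
    · rw [h, one_pow]
    · rw [h, hodd.neg_one_pow]
  rw [chiD, hk2, hj2', hr, kroneckerSym_neg_one hr2, kroneckerSym_mul hr2, h8, hm]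
  have hrec := jacobiSym.quadratic_reciprocity_if (Nat.odd_iff.1 hp) (Nat.odd_iff.1 hr2)
  have hexp : jacobiSym ((if Even m then 1 else -1) * (2 * ((2 ^ v * r : ℕ) : ℤ))) p =
      jacobiSym (if Even m then 1 else -1) p * (jacobiSym 2 p * (jacobiSym 2 p ^ v *
        jacobiSym r p)) := by
    push_cast
    rw [jacobiSym.mul_left, jacobiSym.mul_left, jacobiSym.mul_left, jacobiSym.pow_left]
  rw [hexp]
  have hsign : jacobiSym (if Even m then 1 else -1) p = if Even m then 1 else ZMod.χ₄ p := by
    split_ifs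
    · exact jacobiSym.one_left p
    · exact jacobiSym.at_neg_one hp
  rw [hsign, ← hrec]
  have hI2 : ∀ i : ℤ, Complex.I ^ (2 * i) = if Even i then 1 else -1 := fun i => by
    rw [zpow_mul, show Complex.I ^ (2 : ℤ) = -1 from Complex.I_sq]
    split_ifs with h
    · exact h.neg_one_zpow
    · exact (Int.not_even_iff_odd.1 h).neg_one_zpow
  rcases Nat.odd_mod_four_iff.1 (Nat.odd_iff.1 hp) with h1 | h3
  · have hne : ¬ (p % 4 = 3 ∧ r % 4 = 3) := by omega
    rw [epsilonSym, if_pos h1, one_zpow, if_neg hne, ZMod.χ₄_nat_one_mod_four h1]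
    push_cast
    split_ifs <;> ring
  · rw [epsilonSym, if_neg (by omega), ZMod.χ₄_nat_three_mod_four h3]
    rcases Nat.odd_mod_four_iff.1 (Nat.odd_iff.1 hr2) with h1' | h3'
    · have hne : ¬ (p % 4 = 3 ∧ r % 4 = 3) := by omega
      rw [if_neg hne, ZMod.χ₄_nat_one_mod_four h1', show 2 * m - 1 + 1 = 2 * m by ring, hI2]
      push_cast
      split_ifs <;> ring
    · rw [if_pos ⟨h3, h3'⟩, ZMod.χ₄_nat_three_mod_four h3',
        show 2 * m - 1 + -1 = 2 * (m - 1) by ring, hI2]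
      push_cast
      simp only [Int.even_sub_one]
      split_ifs <;> ring

end EvenLattice

/-! ### Fourier coefficients of the translates. -/

theorem sum_intervalIntegral_shift {Φ : ℝ → ℂ} (hΦ : Continuous Φ) (N : ℕ) :
    ∑ m ∈ Finset.range N, ∫ x in (0 : ℝ)..1, Φ (x + m) = N * ∫ x in (0 : ℝ)..1, Φ (N * x) := by
  have h1 := intervalIntegral.smul_integral_comp_mul_left (a := 0) (b := 1) Φ (N : ℝ)
  have h2 := intervalIntegral.sum_integral_adjacent_intervals (μ := MeasureTheory.volume)
    (f := Φ) (a := fun m : ℕ => (m : ℝ)) (n := N) fun m _ => hΦ.intervalIntegrable _ _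
  rw [mul_zero, mul_one] at h1
  rw [Nat.cast_zero, ← h1] at h2
  rw [show (N : ℂ) * ∫ x in (0 : ℝ)..1, Φ (N * x) = (N : ℝ) • ∫ x in (0 : ℝ)..1, Φ (N * x) by
    rw [Complex.real_smul]; push_cast; rfl, ← h2]
  refine Finset.sum_congr rfl fun m _ => ?_
  rw [intervalIntegral.integral_comp_add_right, zero_add, add_comm (1 : ℝ)]
  push_cast; rfl

/-- The integral over a period of a holomorphic function on the upper half plane does not depend
on the base point. -/
theorem intervalIntegral_period_eq {F : ℂ → ℂ} (hF : DifferentiableOn ℂ F {z | 0 < z.im})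
    (hper : ∀ z : ℂ, 0 < z.im → F (z + 1) = F z) {z w : ℂ} (hz : 0 < z.im) (hw : 0 < w.im) :
    ∫ x in (0 : ℝ)..1, F (z + x) = ∫ x in (0 : ℝ)..1, F (w + x) := by
  have key : ∀ y : ℝ, 0 < y → ∫ x in (0 : ℝ)..1, F (x + y * Complex.I) =
      ∫ x in (0 : ℝ)..1, F (x + (1 : ℝ) * Complex.I) := fun y hy => by
    have h := Complex.integral_boundary_rect_eq_zero_of_differentiableOn F (y * Complex.I)
      (1 + Complex.I) (hF.mono ?_)
    · simp only [Complex.re_ofReal_mul, Complex.I_re, mul_zero, Complex.add_re, Complex.one_re,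
        add_zero, Complex.im_ofReal_mul, Complex.I_im, mul_one, Complex.add_im, Complex.one_im,
        zero_add] at h
      have h2 : ∫ t in y..1, F ((1 : ℝ) + t * Complex.I) = ∫ t in y..1, F ((0 : ℝ) + t * Complex.I) := by
        refine intervalIntegral.integral_congr fun t ht => ?_
        have ht0 : 0 < t := by
          rw [Set.mem_uIcc] at ht
          rcases ht with ht | ht <;> linarith [ht.1]
        simp only [Complex.ofReal_one, Complex.ofReal_zero, zero_add]
        rw [add_comm, hper]
        simpa using ht0
      rw [h2, add_sub_cancel_right, sub_eq_zero] at h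
      exact h
    · rintro x ⟨-, hx⟩
      simp only [Complex.im_ofReal_mul, Complex.I_im, mul_one, Complex.add_im, Complex.one_im,
        zero_add, Set.mem_preimage] at hx
      rw [Set.mem_uIcc] at hx
      change 0 < x.im
      rcases hx with hx | hx <;> linarith [hx.1]
  have key2 : ∀ z : ℂ, 0 < z.im → ∫ x in (0 : ℝ)..1, F (z + x) =
      ∫ x in (0 : ℝ)..1, F (x + z.im * Complex.I) := fun z hz => by
    have hp : Function.Periodic (fun x : ℝ => F (x + z.im * Complex.I)) 1 := fun x => by
      simp only
      rw [← hper (x + z.im * Complex.I) (by simpa using hz)]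
      push_cast; ring_nf
    have h := hp.intervalIntegral_add_eq z.re 0
    rw [zero_add] at h
    rw [← h]
    have h3 := intervalIntegral.integral_comp_add_left (a := 0) (b := 1)
      (fun x : ℝ => F (x + z.im * Complex.I)) z.re
    rw [add_zero] at h3
    rw [← h3]
    refine intervalIntegral.integral_congr fun x _ => ?_
    congr 1
    conv_lhs => rw [← Complex.re_add_im z]
    push_cast; ring
  rw [key2 z hz, key2 w hw, key _ hz, key _ hw]

namespace EvenLattice

variable {V : Type*} [AddCommGroup V] [Module ℚ V] {L : EvenLattice V} {k : ℝ} {f : L.VVFun}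

theorem mem_qCoset_iff {μ : L.Disc} {n : ℚ} : n ∈ L.qCoset μ ↔ e n = e (L.qD μ) := by
  have h : e (n : ℂ) = e (L.qD μ) ↔ e ((n : ℂ) - L.qD μ) = 1 := by
    rw [e_sub, div_eq_one_iff_eq (e_ne_zero _)]
  rw [h, e_eq_one_iff]
  refine exists_congr fun m => ?_
  rw [sub_eq_iff_eq_add', eq_comm (a := (n : ℂ)), eq_comm (a := n)]
  exact_mod_cast Iff.rfl

theorem mul_sq_mem_qCoset {μ : L.Disc} {n : ℚ} (h : n ∈ L.qCoset μ) (m : ℤ) :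
    (m : ℚ) ^ 2 * n ∈ L.qCoset (m • μ) := by
  rw [mem_qCoset_iff] at h ⊢
  have h1 := L.discQ.ψ_zsmul m μ
  change e (L.qD (m • μ)) = e (L.qD μ) ^ (m * m) at h1
  rw [h1, ← h, ← e_zmul]
  push_cast; ring_nf

theorem IsCuspForm.map_add_one (hf : L.IsCuspForm k f) {z : ℂ} (hz : 0 < z.im) (μ : L.Disc) :
    ext f (z + 1) μ = e (L.qD μ) * ext f z μ := by
  have := ofComplex_add_real hz 1
  rw [Complex.ofReal_one] at this
  rw [ext, this, hf.map_T]; rfl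

theorem differentiable_e : Differentiable ℂ e := by
  unfold e; fun_prop

theorem IsCuspForm.coeff_eq (hf : L.IsCuspForm k f) {μ : L.Disc} {n : ℚ} (h : n ∈ L.qCoset μ)
    {z : ℂ} (hz : 0 < z.im) :
    ∫ x in (0 : ℝ)..1, ext f (z + x) μ * e (-(n : ℂ) * (z + x)) = L.coeff f μ n := by
  rw [coeff, if_pos h]
  have h1 := intervalIntegral_period_eq (F := fun z => ext f z μ * e (-(n : ℂ) * z))
    ((hf.differentiableOn_ext μ).mul ((differentiable_e.comp (by fun_prop)).differentiableOn))
    (fun z hz => ?_) hz (w := Complex.I) (by simp)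
  · rw [h1]
    refine intervalIntegral.integral_congr fun x _ => ?_
    have h2 : ext f (Complex.I + x) μ = f (x +ᵥ UpperHalfPlane.I) μ := by
      rw [ext, ofComplex_add_real (by simp)]
      congr 3
      exact UpperHalfPlane.ofComplex_apply UpperHalfPlane.I
    change ext f (Complex.I + x) μ * _ = _
    rw [h2, add_comm Complex.I]
  · rw [hf.map_add_one hz, mul_add, mul_one, e_add, e_neg (n : ℂ), mem_qCoset_iff.1 h]
    have := e_ne_zero (L.qD μ : ℂ)
    field_simp

theorem IsCuspForm.continuous_line (hf : L.IsCuspForm k f) (μ : L.Disc) {z : ℂ} (hz : 0 < z.im)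
    (r : ℝ) : Continuous fun x : ℝ => ext f (z + (r * x : ℝ)) μ := by
  refine (hf.differentiableOn_ext μ).continuousOn.comp_continuous (f := fun x : ℝ => z + (r * x : ℝ))
    (by fun_prop) fun x => ?_
  change 0 < (z + (r * x : ℝ)).im
  rw [Complex.add_im, Complex.ofReal_im, add_zero]; exact hz

theorem IsCuspForm.continuous_line_mul (hf : L.IsCuspForm k f) (μ : L.Disc) {z : ℂ}
    (hz : 0 < z.im) (r : ℝ) (n w : ℂ) :
    Continuous fun x : ℝ => ext f (z + (r * x : ℝ)) μ * e (n * (w + x)) :=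
  (hf.continuous_line μ hz r).mul (differentiable_e.continuous.comp (by fun_prop))

/-- After rescaling, the integral runs over `p²` periods, on which the integrand is multiplied by
successive powers of a root of unity. If `n/p²` lies in the coset of `ν`, all periods agree;
otherwise they cancel, matching the default value `0` of `coeff`. -/
theorem IsCuspForm.integral_down (hf : L.IsCuspForm k f) {p : ℕ} (hp : 0 < p) {μ ν : L.Disc}
    (hν : p • ν = μ) {n : ℚ} (h : n ∈ L.qCoset μ) {z : ℂ} (hz : 0 < z.im) :
    ∫ x in (0 : ℝ)..1, ext f ((p : ℂ) ^ 2 * (z + x)) ν * e (-(n : ℂ) * (z + x)) =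
      L.coeff f ν (n / p ^ 2) := by
  have hp' : (p : ℂ) ≠ 0 := by exact_mod_cast hp.ne'
  have hz2 := im_mul_sq_pos hp hz
  have hP : ((p ^ 2 : ℕ) : ℂ) ≠ 0 := by exact_mod_cast (pow_ne_zero 2 hp.ne')
  set Φ : ℝ → ℂ := fun u => ext f ((p : ℂ) ^ 2 * z + u) ν *
    e (-((n / p ^ 2 : ℚ) : ℂ) * ((p : ℂ) ^ 2 * z + u)) with hΦ
  have hcont : Continuous Φ := by
    have h1 := hf.continuous_line_mul ν hz2 1 (-((n / p ^ 2 : ℚ) : ℂ)) ((p : ℂ) ^ 2 * z)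
    simpa only [one_mul] using h1
  have hsum := sum_intervalIntegral_shift hcont (p ^ 2)
  have hc : ∀ m : ℕ, ∀ u : ℝ, Φ (u + m) = e ((L.qD ν : ℂ) - ((n / p ^ 2 : ℚ) : ℂ)) ^ m * Φ u := by
    intro m u
    induction m with
    | zero => simp
    | succ m ih =>
      rw [pow_succ', mul_assoc, ← ih, hΦ]
      simp only
      have h1 : ((p : ℂ) ^ 2 * z + ((u + (m + 1 : ℕ) : ℝ) : ℂ)) =
          ((p : ℂ) ^ 2 * z + ((u + m : ℝ) : ℂ)) + 1 := by push_cast; ring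
      rw [h1, hf.map_add_one (by simpa using hz2), mul_add, mul_one, e_add, e_sub, e_neg]
      field_simp
  have hLHS : ∫ x in (0 : ℝ)..1, ext f ((p : ℂ) ^ 2 * (z + x)) ν * e (-(n : ℂ) * (z + x)) =
      ∫ x in (0 : ℝ)..1, Φ ((p ^ 2 : ℕ) * x) := by
    refine intervalIntegral.integral_congr fun x _ => ?_
    simp only [hΦ]
    push_cast
    congr 2
    · ring
    · field_simp
  rw [hLHS]
  -- The ratio of successive periods is a `p²`-th root of unity, since `q(μ) = p² q(ν)` modulo `1`.
  have hn : e ((L.qD ν : ℂ) - ((n / p ^ 2 : ℚ) : ℂ)) ^ (p ^ 2) = 1 := by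
    have h1 := L.discQ.ψ_zsmul p ν
    rw [natCast_zsmul, hν] at h1
    change e (L.qD μ) = e (L.qD ν) ^ ((p : ℤ) * p) at h1
    rw [← e_nmul, mul_sub, e_sub, e_nmul]
    have h2 : ((p ^ 2 : ℕ) : ℂ) * ((n / p ^ 2 : ℚ) : ℂ) = n := by push_cast; field_simp
    rw [h2, mem_qCoset_iff.1 h, h1]
    rw [show ((p : ℤ) * p) = ((p ^ 2 : ℕ) : ℤ) by push_cast; ring, zpow_natCast]
    exact div_self (pow_ne_zero _ (e_ne_zero _))
  simp_rw [hc, intervalIntegral.integral_const_mul] at hsum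
  rw [← Finset.sum_mul] at hsum
  by_cases hmem : n / p ^ 2 ∈ L.qCoset ν
  · have h1 : e ((L.qD ν : ℂ) - ((n / p ^ 2 : ℚ) : ℂ)) = 1 := by
      rw [e_sub, mem_qCoset_iff.1 hmem, div_self (e_ne_zero _)]
    simp only [h1, one_pow, Finset.sum_const, Finset.card_range, nsmul_eq_mul, mul_one] at hsum
    rw [← hf.coeff_eq hmem hz2, ← mul_left_cancel₀ hP hsum]
  · have h1 : e ((L.qD ν : ℂ) - ((n / p ^ 2 : ℚ) : ℂ)) ≠ 1 := fun h1 => hmem (by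
      rw [e_sub, div_eq_one_iff_eq (e_ne_zero _)] at h1
      exact mem_qCoset_iff.2 h1.symm)
    rw [geom_sum_eq h1, hn, sub_self, zero_div, zero_mul] at hsum
    rw [coeff, if_neg hmem]
    exact (mul_eq_zero.1 hsum.symm).resolve_left hP

/-- The `p²` translates are consecutive pieces of one long integral, which is scaled back to a
single period. -/
theorem IsCuspForm.integral_up (hf : L.IsCuspForm k f) {p : ℕ} (hp : 0 < p) {μ : L.Disc}
    {n : ℚ} (h : n ∈ L.qCoset μ) {z : ℂ} (hz : 0 < z.im) :
    ∑ m ∈ Finset.range (p ^ 2), e (-(m * L.qD μ)) *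
      ∫ x in (0 : ℝ)..1, ext f ((z + x + m) / (p : ℂ) ^ 2) (p • μ) * e (-(n : ℂ) * (z + x)) =
      (p : ℂ) ^ 2 * L.coeff f (p • μ) (p ^ 2 * n) := by
  have hp' : (p : ℂ) ≠ 0 := by exact_mod_cast hp.ne'
  have hz2 := im_div_sq_pos hp hz
  set Φ : ℝ → ℂ := fun u => ext f (z / (p : ℂ) ^ 2 + ((1 / p ^ 2 : ℝ) * u : ℝ)) (p • μ) *
    e (-(n : ℂ) * (z + u)) with hΦ
  have hcont : Continuous Φ := hf.continuous_line_mul (p • μ) hz2 (1 / p ^ 2) (-(n : ℂ)) z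
  have hsum := sum_intervalIntegral_shift hcont (p ^ 2)
  have h2 : ∀ m : ℕ, e (-(m * L.qD μ)) *
      ∫ x in (0 : ℝ)..1, ext f ((z + x + m) / (p : ℂ) ^ 2) (p • μ) * e (-(n : ℂ) * (z + x)) =
      ∫ x in (0 : ℝ)..1, Φ (x + m) := fun m => by
    rw [← intervalIntegral.integral_const_mul]
    refine intervalIntegral.integral_congr fun x _ => ?_
    simp only [hΦ]
    have h3 : (z + x + m) / (p : ℂ) ^ 2 = z / (p : ℂ) ^ 2 + ((1 / p ^ 2 : ℝ) * (x + m) : ℝ) := by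
      push_cast; ring
    have h4 : e (-(n : ℂ) * (z + (x + m : ℝ))) = e (-(m * L.qD μ)) * e (-(n : ℂ) * (z + x)) := by
      rw [e_neg, e_nmul, ← mem_qCoset_iff.1 h, ← e_nmul, ← e_neg, ← e_add]
      push_cast; ring_nf
    rw [h3, h4]; ring
  simp_rw [h2]
  rw [hsum]
  have hmem : (p : ℚ) ^ 2 * n ∈ L.qCoset (p • μ) := by
    have := mul_sq_mem_qCoset h p
    rwa [natCast_zsmul] at this
  rw [← hf.coeff_eq hmem hz2]
  push_cast
  congr 1
  refine intervalIntegral.integral_congr fun x _ => ?_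
  simp only [hΦ]
  push_cast
  congr 2
  · field_simp
  · field_simp

theorem IsCuspForm.integral_mid (hf : L.IsCuspForm k f) {p : ℕ} (b : ℤ) {μ : L.Disc}
    {n : ℚ} (h : n ∈ L.qCoset μ) {z : ℂ} (hz : 0 < z.im) :
    ∫ x in (0 : ℝ)..1, ext f (z + x + b / p) μ * e (-(n : ℂ) * (z + x)) =
      e (n * b / p) * L.coeff f μ n := by
  rw [← hf.coeff_eq h (im_add_ratio_pos hz b p), ← intervalIntegral.integral_const_mul]
  refine intervalIntegral.integral_congr fun x _ => ?_
  change _ = e (n * b / p) * (_ * _)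
  rw [mul_left_comm, ← e_add]
  congr 2
  · ring
  · ring_nf

/-- The action of the Hecke operator on Fourier coefficients. -/
theorem IsCuspForm.hecke_coeff (hf : L.IsCuspForm k f) (hf0 : f ≠ 0) {p : ℕ} (hp : p.Prime)
    (hpL : ¬ p ∣ L.level) {b : ℕ → ℤ} {ω : ℕ → ℂ}
    (h : ∀ j ∈ Finset.Ico 1 p, MidFormula L k f p j (b j) (ω j)) {Λ : ℂ}
    (hΛ : L.hecke k p f = Λ • f) {ν μ : L.Disc} (hν : p • ν = μ) {n : ℚ} (hn : n ∈ L.qCoset μ) :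
    Λ * L.coeff f μ n = (p : ℂ) ^ (2 * (k : ℂ) - 2) * L.coeff f ν (n / p ^ 2) +
      L.coeff f (p • μ) (p ^ 2 * n) +
      (p : ℂ) ^ ((k : ℂ) - 2) * (∑ j ∈ Finset.Ico 1 p, ω j * e (n * b j / p)) * L.coeff f μ n := by
  have hp0 : (p : ℂ) ≠ 0 := by exact_mod_cast hp.ne_zero
  have hcop : IsCoprime (p : ℤ) (L.level : ℤ) :=
    Nat.isCoprime_iff_coprime.2 ((Nat.Prime.coprime_iff_not_dvd hp).2 hpL)
  obtain ⟨p', hp'⟩ := zmod_unit_iff.2 hcop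
  have hν' : p' • μ = ν := by
    rw [← hν, ← natCast_zsmul, ← mul_zsmul, mul_comm, L.discQ.zsmul_congr hp', one_zsmul]
  have hI : 0 < Complex.I.im := by simp
  have him : ∀ x : ℝ, 0 < (Complex.I + x).im := fun x => by simp
  have h1 : ∀ x : ℝ, Λ * (ext f (Complex.I + x) μ * e (-(n : ℂ) * (Complex.I + x))) =
      (p : ℂ) ^ (2 * (k : ℂ) - 2) *
        (ext f ((p : ℂ) ^ 2 * (Complex.I + x)) ν * e (-(n : ℂ) * (Complex.I + x))) +
      (p : ℂ) ^ (-2 : ℂ) * ∑ m ∈ Finset.range (p ^ 2), e (-(m * L.qD μ)) *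
        (ext f ((Complex.I + x + m) / (p : ℂ) ^ 2) (p • μ) * e (-(n : ℂ) * (Complex.I + x))) +
      (p : ℂ) ^ ((k : ℂ) - 2) * ∑ j ∈ Finset.Ico 1 p,
        ω j * (ext f (Complex.I + x + b j / p) μ * e (-(n : ℂ) * (Complex.I + x))) := fun x => by
    have h2 := hf.hecke_apply hf0 hp hpL hp' h ⟨Complex.I + x, him x⟩ μ
    rw [hΛ, hν'] at h2
    have h3 : f ⟨Complex.I + x, him x⟩ μ = ext f (Complex.I + x) μ := by
      rw [ext, UpperHalfPlane.ofComplex_apply_of_im_pos (him x)]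
    simp only [Pi.smul_apply, smul_eq_mul, h3] at h2
    rw [← mul_assoc, h2]
    simp only [← mul_assoc, ← Finset.sum_mul]
    ring
  have hc1 : Continuous fun x : ℝ => ext f ((p : ℂ) ^ 2 * (Complex.I + x)) ν *
      e (-(n : ℂ) * (Complex.I + x)) := by
    refine (hf.continuous_line_mul ν (im_mul_sq_pos hp.pos hI) (p ^ 2) (-(n : ℂ))
      Complex.I).congr fun x => ?_
    push_cast; ring_nf
  have hc2 : ∀ m : ℕ, Continuous fun x : ℝ => e (-(m * L.qD μ)) *
      (ext f ((Complex.I + x + m) / (p : ℂ) ^ 2) (p • μ) * e (-(n : ℂ) * (Complex.I + x))) :=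
    fun m => by
    have him2 : 0 < ((Complex.I + m) / (p : ℂ) ^ 2).im := im_div_sq_pos hp.pos (by simp)
    refine Continuous.mul continuous_const ?_
    refine (hf.continuous_line_mul (p • μ) him2 (1 / p ^ 2) (-(n : ℂ)) Complex.I).congr fun x => ?_
    push_cast; ring_nf
  have hc3 : ∀ j : ℕ, Continuous fun x : ℝ =>
      ω j * (ext f (Complex.I + x + b j / p) μ * e (-(n : ℂ) * (Complex.I + x))) := fun j => by
    refine Continuous.mul continuous_const ?_
    refine (hf.continuous_line_mul μ (im_add_ratio_pos hI (b j) p) 1 (-(n : ℂ))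
      Complex.I).congr fun x => ?_
    push_cast; ring_nf
  have h4 : ∫ x in (0 : ℝ)..1, Λ * (ext f (Complex.I + x) μ * e (-(n : ℂ) * (Complex.I + x))) =
      Λ * L.coeff f μ n := by
    rw [intervalIntegral.integral_const_mul, hf.coeff_eq hn hI]
  rw [← h4]
  simp_rw [h1]
  rw [intervalIntegral.integral_add, intervalIntegral.integral_add,
    intervalIntegral.integral_const_mul, intervalIntegral.integral_const_mul,
    intervalIntegral.integral_const_mul, hf.integral_down hp.pos hν hn hI,
    intervalIntegral.integral_finsetSum, intervalIntegral.integral_finsetSum]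
  · simp_rw [intervalIntegral.integral_const_mul]
    rw [hf.integral_up hp.pos hn hI]
    simp_rw [hf.integral_mid _ hn hI]
    congr 1
    · congr 1
      rw [← mul_assoc, ← Complex.cpow_ofNat, ← Complex.cpow_add _ _ hp0]
      simp
    · rw [mul_assoc, Finset.sum_mul]
      simp_rw [mul_assoc]
  · exact fun j _ => (hc3 j).intervalIntegrable _ _
  · exact fun j _ => (hc2 j).intervalIntegrable _ _
  · exact (hc1.intervalIntegrable _ _).const_mul _
  · exact (continuous_const.mul (continuous_finsetSum _ fun m _ => hc2 m)).intervalIntegrable _ _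
  · exact ((continuous_const.mul hc1).add
      (continuous_const.mul (continuous_finsetSum _ fun m _ => hc2 m))).intervalIntegrable _ _
  · exact (continuous_const.mul (continuous_finsetSum _ fun m _ => hc3 m)).intervalIntegrable _ _

end EvenLattice

/-! ### Evaluation of the sum over the middle cosets. -/

theorem sum_Ico_zmod {p : ℕ} [Fact p.Prime] (h : ZMod p → ℂ) :
    ∑ j ∈ Finset.Ico 1 p, h (j : ZMod p) = ∑ u : ZMod p with u ≠ 0, h u := by
  have hp := (Fact.out : p.Prime)
  refine Finset.sum_bij (fun j _ => (j : ZMod p)) ?_ ?_ ?_ (fun _ _ => rfl)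
  · intro j hj
    rw [Finset.mem_Ico] at hj
    simp only [Finset.mem_filter, Finset.mem_univ, true_and]
    rw [Ne, ZMod.natCast_eq_zero_iff]
    exact Nat.not_dvd_of_pos_of_lt (by omega) hj.2
  · intro i hi j hj hij
    rw [Finset.mem_Ico] at hi hj
    rw [ZMod.natCast_eq_natCast_iff, Nat.ModEq, Nat.mod_eq_of_lt hi.2, Nat.mod_eq_of_lt hj.2] at hij
    exact hij
  · intro u hu
    simp only [Finset.mem_filter, Finset.mem_univ, true_and] at hu
    refine ⟨u.val, Finset.mem_Ico.2 ⟨?_, ZMod.val_lt u⟩, ZMod.natCast_rightInverse u⟩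
    exact Nat.one_le_iff_ne_zero.2 ((ZMod.val_ne_zero u).2 hu)

theorem sum_ne_zero_inv {F : Type*} [Field F] [Fintype F] [DecidableEq F] (h : F → ℂ) :
    ∑ u : F with u ≠ 0, h u⁻¹ = ∑ u : F with u ≠ 0, h u :=
  Finset.sum_bij (fun u _ => u⁻¹) (by simp) (by simp) (fun u hu => ⟨u⁻¹, by simpa using hu, by simp⟩)
    (fun _ _ => rfl)

theorem sum_ne_zero_stdAddChar {p : ℕ} [Fact p.Prime] (c : ZMod p) :
    ∑ u : ZMod p with u ≠ 0, (ZMod.stdAddChar (c * u) : ℂ) = if c = 0 then (p : ℂ) - 1 else -1 := by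
  have h2 := AddChar.sum_mulShift (R' := ℂ) c (ZMod.isPrimitive_stdAddChar p)
  rw [ZMod.card, ← Finset.sum_filter_add_sum_filter_not Finset.univ (fun u : ZMod p => u ≠ 0)] at h2
  have h6 : ∑ u : ZMod p with ¬ u ≠ 0, (ZMod.stdAddChar (u * c) : ℂ) = 1 := by
    simp [Finset.filter_eq']
  rw [h6] at h2
  simp_rw [mul_comm c]
  rw [eq_sub_of_add_eq h2]
  split_ifs <;> simp

theorem exists_dvd_mul_eq_one {p : ℕ} [Fact p.Prime] {M : ℕ} (hM : ¬ p ∣ M) {j : ℕ}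
    (hj : j ∈ Finset.Ico 1 p) : ∃ b : ℤ, (M : ℤ) ∣ b ∧ (p : ℤ) ∣ 1 - j * b := by
  rw [Finset.mem_Ico] at hj
  have h1 : (M : ZMod p) ≠ 0 := fun h => hM ((ZMod.natCast_eq_zero_iff _ _).1 h)
  have h2 : (j : ZMod p) ≠ 0 := fun h =>
    Nat.not_dvd_of_pos_of_lt (by omega) hj.2 ((ZMod.natCast_eq_zero_iff _ _).1 h)
  obtain ⟨c, hc⟩ := ZMod.intCast_surjective ((M * j : ZMod p)⁻¹)
  refine ⟨M * c, dvd_mul_right _ _, ?_⟩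
  rw [← ZMod.intCast_zmod_eq_zero_iff_dvd]
  push_cast
  rw [hc]
  field_simp
  ring

namespace EvenLattice

variable {V : Type*} [AddCommGroup V] [Module ℚ V] {L : EvenLattice V} {k : ℝ} {f : L.VVFun}

theorem level_mul_mem {μ : L.Disc} {n : ℚ} (hn : n ∈ L.qCoset μ) : ∃ A : ℤ, L.level * n = A := by
  obtain ⟨m, hm⟩ := L.level_spec_aux.2 _ (L.rep_mem μ)
  obtain ⟨r, rfl⟩ := hn
  refine ⟨m + L.level * r, ?_⟩
  push_cast
  rw [mul_add, qD, hm]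

theorem den_dvd_level {μ : L.Disc} {n : ℚ} (hn : n ∈ L.qCoset μ) : n.den ∣ L.level := by
  obtain ⟨A, hA⟩ := level_mul_mem hn
  have h0 : (L.level : ℚ) ≠ 0 := by exact_mod_cast L.level_pos.ne'
  have h1 : n = (A : ℚ) / ((L.level : ℤ) : ℚ) := by
    rw [← hA]; push_cast; field_simp
  have := Rat.den_dvd A L.level
  rw [Rat.divInt_eq_div, ← h1] at this
  exact_mod_cast this

theorem den_ne_zero {p : ℕ} (hpL : ¬ p ∣ L.level) {μ : L.Disc} {n : ℚ} (hn : n ∈ L.qCoset μ) :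
    (n.den : ZMod p) ≠ 0 := fun h =>
  hpL (((ZMod.natCast_eq_zero_iff _ _).1 h).trans (den_dvd_level hn))

/-- The denominator of `n` divides the level and hence `b`, so `n b` is an integer with the expected
residue modulo `p`. -/
theorem e_mul_div {p : ℕ} [Fact p.Prime] (hpL : ¬ p ∣ L.level) {μ : L.Disc} {n : ℚ}
    (hn : n ∈ L.qCoset μ) {b : ℤ} (hb : (L.level : ℤ) ∣ b) :
    e (n * b / p) = ZMod.stdAddChar ((n : ZMod p) * (b : ZMod p)) := by
  obtain ⟨c, rfl⟩ := hb
  obtain ⟨d, hd⟩ := den_dvd_level hn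
  have h1 : (n : ℂ) * n.den = n.num := by exact_mod_cast congrArg (Rat.cast (K := ℂ)) n.mul_den_eq_num
  have h2 : (n : ZMod p) * ((L.level * c : ℤ) : ZMod p) = ((n.num * d * c : ℤ) : ZMod p) := by
    have := den_ne_zero hpL hn
    rw [Rat.cast_def, hd]; push_cast; field_simp
  rw [h2, stdAddChar_intCast]
  congr 2
  rw [hd]
  push_cast
  rw [← h1]; ring

theorem ratCast_eq_zero_iff {p : ℕ} [Fact p.Prime] (hpL : ¬ p ∣ L.level) {μ : L.Disc} {n : ℚ}
    (hn : n ∈ L.qCoset μ) : (n : ZMod p) = 0 ↔ (p : ℤ) ∣ n.num := by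
  rw [Rat.cast_def, div_eq_zero_iff, or_iff_left (den_ne_zero hpL hn),
    ZMod.intCast_zmod_eq_zero_iff_dvd]

theorem ratLegendre_neg {p : ℕ} [Fact p.Prime] (hpL : ¬ p ∣ L.level) {μ : L.Disc} {n : ℚ}
    (hn : n ∈ L.qCoset μ) : ratLegendre (-n) p = quadraticChar (ZMod p) (-(n : ZMod p)) := by
  have h0 := den_ne_zero hpL hn
  rw [ratLegendre, ← jacobiSym.legendreSym.to_jacobiSym, legendreSym, Rat.num_neg_eq_neg_num,
    Rat.den_neg_eq_den]
  have : ((-n.num * n.den : ℤ) : ZMod p) = -(n : ZMod p) * (n.den : ZMod p) ^ 2 := by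
    rw [Rat.cast_def]; push_cast; field_simp
  rw [this, map_mul, quadraticChar_sq_one' h0, mul_one]

section

variable (L)

/-- The Gauss type sum in the middle term of the action of the Hecke operator. -/
def midSum (p : ℕ) (n : ℚ) : ℂ :=
  if Even L.rank then (L.gaussSum 1 / L.gaussSum p) * (if (p : ℤ) ∣ n.num then (p : ℂ) - 1 else -1)
  else L.chiD p * (ratLegendre (-n) p : ℂ) * (p : ℂ) ^ (1 / 2 : ℂ)

end

theorem gaussSum_eq (d : ℕ) : L.gaussSum d = L.discQ.G d := by
  rw [gaussSum, FinQuad.G]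
  refine Finset.sum_congr rfl fun μ _ => ?_
  rw [e_nmul, zpow_natCast]; rfl

/-- The quotient is a sign, hence equal to its inverse. -/
theorem IsCuspForm.gaussSum_quot (hf : L.IsCuspForm k f) (hf0 : f ≠ 0) (hs : Even L.sig)
    {p : ℕ} (hp : p.Prime) (hpL : ¬ p ∣ L.level) :
    L.gaussSum 1 / L.gaussSum p = L.discQ.G p / L.discQ.G 1 ∧
      ‖L.discQ.G p / L.discQ.G 1‖ = 1 := by
  have hcop : IsCoprime (p : ℤ) (L.level : ℤ) :=
    Nat.isCoprime_iff_coprime.2 ((Nat.Prime.coprime_iff_not_dvd hp).2 hpL)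
  obtain ⟨δ, hδ, h⟩ := (hf.isEven hf0 hs).G_eq hcop
  have hG := L.discQ.G_one_ne_zero
  rw [gaussSum_eq, gaussSum_eq, h, Nat.cast_one]
  rcases hδ with rfl | rfl
  · simp [hG]
  · constructor
    · push_cast; field_simp
    · simp [hG]

/-- The cosets in the middle of the Hecke operator. -/
theorem IsCuspForm.exists_mid (hf : L.IsCuspForm k f) (hf0 : f ≠ 0) {p : ℕ} (hp : p.Prime)
    (hpL : ¬ p ∣ L.level) : ∃ b : ℕ → ℤ, ∃ ω : ℕ → ℂ,
      (∀ j ∈ Finset.Ico 1 p, MidFormula L k f p j (b j) (ω j)) ∧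
      (∀ j ∈ Finset.Ico 1 p, ‖ω j‖ = 1) ∧
      ∀ μ n, n ∈ L.qCoset μ → ∑ j ∈ Finset.Ico 1 p, ω j * e (n * b j / p) = L.midSum p n := by
  have : Fact p.Prime := ⟨hp⟩
  have hbu : ∀ (b : ℤ) (j : ℕ), (p : ℤ) ∣ 1 - j * b → (b : ZMod p) = (j : ZMod p)⁻¹ :=
    fun b j h => by
      rw [← ZMod.intCast_zmod_eq_zero_iff_dvd] at h
      push_cast at h
      exact eq_inv_of_mul_eq_one_right (sub_eq_zero.1 h).symm
  by_cases hs : Even L.sig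
  · have hb : ∀ j : ℕ, ∃ b : ℤ, j ∈ Finset.Ico 1 p → (L.level : ℤ) ∣ b ∧ (p : ℤ) ∣ 1 - j * b :=
      fun j => by
        by_cases hj : j ∈ Finset.Ico 1 p
        · exact (exists_dvd_mul_eq_one hpL hj).imp fun b hb _ => hb
        · exact ⟨0, fun h => absurd h hj⟩
    choose b hb using hb
    refine ⟨b, fun _ => L.discQ.G p / L.discQ.G 1, fun j hj => ?_, fun _ _ =>
      (hf.gaussSum_quot hf0 hs hp hpL).2, fun μ n hn => ?_⟩
    · exact hf.midFormula_even hf0 hs hp.pos (hb j hj).1 (hb j hj).2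
    · rw [midSum, if_pos (L.even_rank_iff.2 hs), (hf.gaussSum_quot hf0 hs hp hpL).1, ← Finset.mul_sum]
      congr 1
      -- Since `b j` is inverse to `j` modulo `p`, the sum is a Ramanujan sum over the non-zero
      -- residues.
      have h1 : ∀ j ∈ Finset.Ico 1 p, e (n * b j / p) =
          ZMod.stdAddChar ((n : ZMod p) * (j : ZMod p)⁻¹) := fun j hj => by
        rw [e_mul_div hpL hn (hb j hj).1, hbu _ _ (hb j hj).2]
      rw [Finset.sum_congr rfl h1, sum_Ico_zmod (fun u => ZMod.stdAddChar ((n : ZMod p) * u⁻¹)),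
        sum_ne_zero_inv (fun u => ZMod.stdAddChar ((n : ZMod p) * u)), sum_ne_zero_stdAddChar]
      simp only [ratCast_eq_zero_iff hpL hn]
  · have hs' := Int.not_even_iff_odd.1 hs
    have hp2 := hf.ne_two hf0 hs' hpL
    obtain ⟨m, hm⟩ : ∃ m, L.sig = 2 * m - 1 := by
      obtain ⟨m, hm⟩ := hs'; exact ⟨m + 1, by omega⟩
    have hδ : L.thetaQ.G p / L.thetaQ.G 1 = L.chiD p := by
      rw [hf.thetaQ_G hf0 hm hp hpL, chiD_eq hm (hp.odd_of_ne_two hp2)]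
    have hcop4 : ¬ p ∣ 4 * L.level := fun h => by
      rcases hp.dvd_mul.1 h with h | h
      · exact hp2 ((Nat.prime_dvd_prime_iff_eq hp Nat.prime_two).1
          (hp.dvd_of_dvd_pow (show p ∣ 2 ^ 2 from h)))
      · exact hpL h
    have hb : ∀ j : ℕ, ∃ b : ℤ, j ∈ Finset.Ico 1 p →
        ((4 * L.level : ℕ) : ℤ) ∣ b ∧ (p : ℤ) ∣ 1 - j * b := fun j => by
      by_cases hj : j ∈ Finset.Ico 1 p
      · exact (exists_dvd_mul_eq_one hcop4 hj).imp fun b hb _ => hb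
      · exact ⟨0, fun h => absurd h hj⟩
    choose b hb using hb
    have hj0 : ∀ j ∈ Finset.Ico 1 p, (j : ZMod p) ≠ 0 := fun j hj h => by
      rw [Finset.mem_Ico] at hj
      exact Nat.not_dvd_of_pos_of_lt (by omega) hj.2 ((ZMod.natCast_eq_zero_iff _ _).1 h)
    have hpp : (p : ℂ) ^ (1 / 2 : ℂ) * (p : ℂ) ^ (1 / 2 : ℂ) = p := by
      rw [← Complex.cpow_add _ _ (by exact_mod_cast hp.ne_zero)]; norm_num
    have hpp0 : (p : ℂ) ^ (1 / 2 : ℂ) ≠ 0 := by simp [hp.ne_zero]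
    refine ⟨b, fun j => L.thetaQ.G p / L.thetaQ.G 1 *
      ((p : ℂ) ^ (1 / 2 : ℂ) / quadGauss p (-(j : ℤ))), fun j hj => ?_, fun j hj => ?_,
      fun μ n hn => ?_⟩
    · have := hf.midFormula_odd hf0 hs' hp2 hpL (hb j hj).1 (hb j hj).2
      simpa using this
    · have hcop : IsCoprime (p : ℤ) ((4 * L.level : ℕ) : ℤ) :=
        Nat.isCoprime_iff_coprime.2 ((Nat.Prime.coprime_iff_not_dvd hp).2 hcop4)
      obtain ⟨δ, hδ1, h⟩ := (hf.isEven_thetaQ hf0 hs').G_eq hcop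
      have h1 : ‖L.thetaQ.G p / L.thetaQ.G 1‖ = 1 := by
        rw [h, mul_div_cancel_right₀ _ L.thetaQ.G_one_ne_zero]
        rcases hδ1 with rfl | rfl <;> simp
      have h2 := norm_quadGauss_sq hp2 (neg_ne_zero.2 (hj0 j hj))
      have h3 : ‖(p : ℂ) ^ (1 / 2 : ℂ)‖ ^ 2 = p := by
        rw [← norm_pow, sq, hpp]; simp
      have h4 : ‖(p : ℂ) ^ (1 / 2 : ℂ)‖ = ‖quadGauss p (-(j : ZMod p))‖ := by
        rw [← sq_eq_sq₀ (norm_nonneg _) (norm_nonneg _), h2, h3]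
      simp only
      rw [norm_mul, h1, one_mul, norm_div, Int.cast_natCast, h4, div_self]
      rw [← h4]
      exact norm_ne_zero_iff.2 hpp0
    · rw [midSum, if_neg (mt L.even_rank_iff.1 hs), ← hδ]
      -- The relations `g(j) g(-j) = p` and `g(j⁻¹) = g(j)` move the Gauss sum from the denominator
      -- into the numerator, ready for `sum_quadGauss_mul` with `u = j⁻¹`.
      have h1 : ∀ j ∈ Finset.Ico 1 p, L.thetaQ.G p / L.thetaQ.G 1 *
          ((p : ℂ) ^ (1 / 2 : ℂ) / quadGauss p (-((j : ℤ) : ZMod p))) * e (n * b j / p) =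
          L.thetaQ.G p / L.thetaQ.G 1 * ((p : ℂ) ^ (1 / 2 : ℂ))⁻¹ * (quadGauss p (j : ZMod p)⁻¹ *
          ZMod.stdAddChar ((n : ZMod p) * (j : ZMod p)⁻¹)) := fun j hj => by
        rw [e_mul_div hpL hn (dvd_trans ⟨4, by push_cast; ring⟩ (hb j hj).1),
          hbu _ _ (hb j hj).2]
        have h2 := quadGauss_mul_neg hp2 (hj0 j hj)
        have h3 := quadGauss_ne_zero hp2 (neg_ne_zero.2 (hj0 j hj))
        have h4 : quadGauss p (j : ZMod p)⁻¹ = quadGauss p (j : ZMod p) := by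
          rw [← quadGauss_mul_sq (j : ZMod p)⁻¹ (hj0 j hj)]
          congr 1
          have := hj0 j hj
          field_simp
        have h5 : (p : ℂ) ^ (1 / 2 : ℂ) / quadGauss p (-((j : ℤ) : ZMod p)) =
            ((p : ℂ) ^ (1 / 2 : ℂ))⁻¹ * quadGauss p (j : ZMod p)⁻¹ := by
          rw [h4, Int.cast_natCast, div_eq_iff h3, mul_assoc, h2,
            eq_inv_mul_iff_mul_eq₀ hpp0, hpp]
        rw [h5]; ring
      rw [Finset.sum_congr rfl h1, ← Finset.mul_sum, sum_Ico_zmod (fun u => quadGauss p u⁻¹ *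
        (ZMod.stdAddChar ((n : ZMod p) * u⁻¹) : ℂ)), sum_ne_zero_inv (fun u => quadGauss p u *
        (ZMod.stdAddChar ((n : ZMod p) * u) : ℂ)), sum_quadGauss_mul hp2, ratLegendre_neg hpL hn]
      have hpi : ((p : ℂ) ^ (1 / 2 : ℂ))⁻¹ * p = (p : ℂ) ^ (1 / 2 : ℂ) := by
        rw [inv_mul_eq_iff_eq_mul₀ hpp0, hpp]
      linear_combination (L.thetaQ.G p / L.thetaQ.G 1 *
        (quadraticChar (ZMod p) (-(n : ZMod p)) : ℂ)) * hpi

end EvenLattice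

/-! ### Growth of cusp forms, coefficients and eigenvalues. -/

namespace EvenLattice

variable {V : Type*} [AddCommGroup V] [Module ℚ V] {L : EvenLattice V} {k : ℝ} {f : L.VVFun}

/-- Plancherel's formula on `D`: the Weil representation is unitary at `S`. -/
theorem sum_norm_weilS (v : L.Disc → ℂ) : ∑ μ, ‖L.weilS v μ‖ ^ 2 = ∑ μ, ‖v μ‖ ^ 2 := by
  classical
  have h1 : ∑ μ, (∑ ν, e (-(L.bD ν μ : ℂ)) * v ν) *
      starRingEnd ℂ (∑ ν, e (-(L.bD ν μ : ℂ)) * v ν) =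
      Fintype.card L.Disc * ∑ μ, v μ * starRingEnd ℂ (v μ) := by
    have h2 : ∀ μ ν κ : L.Disc, (e (-(L.bD ν μ : ℂ)) * v ν) * starRingEnd ℂ (e (-(L.bD κ μ : ℂ)) * v κ)
        = L.discQ.B (κ - ν) μ * (v ν * starRingEnd ℂ (v κ)) := fun μ ν κ => by
      have h3 : starRingEnd ℂ (e (-(L.bD κ μ : ℂ))) = L.discQ.B κ μ := by
        rw [e, ← Complex.exp_conj]
        change _ = Complex.exp _
        congr 1
        simp only [map_mul, map_neg, Complex.conj_I, Complex.conj_ofReal, map_ofNat, map_ratCast]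
        ring
      rw [map_mul, h3, sub_eq_add_neg, FinQuad.B_add, FinQuad.B_neg, e_neg]
      change (L.discQ.B ν μ)⁻¹ * _ * _ = _
      ring
    simp_rw [map_sum, Finset.sum_mul_sum, h2]
    rw [Finset.sum_comm]
    rw [Finset.mul_sum]
    refine Finset.sum_congr rfl fun ν _ => ?_
    rw [Finset.sum_comm]
    simp_rw [← Finset.sum_mul, FinQuad.sum_B, sub_eq_zero]
    simp
  have h4 : ∀ z : ℂ, ((‖z‖ ^ 2 : ℝ) : ℂ) = z * starRingEnd ℂ z := fun z => by
    rw [Complex.mul_conj, Complex.normSq_eq_norm_sq]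
  have hsq : ‖e (-(L.sig : ℂ) / 8) / (Real.sqrt (Nat.card L.Disc) : ℂ)‖ ^ 2 =
      ((Fintype.card L.Disc : ℝ))⁻¹ := by
    have h5 : ‖e (-(L.sig : ℂ) / 8)‖ = 1 := by
      have := norm_e_rat (-(L.sig : ℚ) / 8)
      push_cast at this
      exact this
    rw [norm_div, h5, Complex.norm_real, Real.norm_of_nonneg (Real.sqrt_nonneg _), div_pow,
      Real.sq_sqrt (Nat.cast_nonneg _), Nat.card_eq_fintype_card]
    simp
  have hc : (Fintype.card L.Disc : ℝ) ≠ 0 := by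
    have := FinQuad.card_ne_zero (A := L.Disc)
    exact_mod_cast this
  simp only [weilS, norm_mul, mul_pow, hsq]
  rw [← Finset.mul_sum, inv_mul_eq_iff_eq_mul₀ hc]
  have : ((∑ μ, ‖∑ ν, e (-(L.bD ν μ : ℂ)) * v ν‖ ^ 2 : ℝ) : ℂ) =
      ((Fintype.card L.Disc * ∑ μ, ‖v μ‖ ^ 2 : ℝ) : ℂ) := by
    simp only [Complex.ofReal_sum, Complex.ofReal_mul, h4, h1, Complex.ofReal_natCast]
  exact_mod_cast this

/-- The invariant `y ^ k ∑ |f_μ|²`. -/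
def petersson (k : ℝ) (f : L.VVFun) (τ : ℍ) : ℝ := τ.im ^ k * ∑ μ, ‖f τ μ‖ ^ 2

theorem IsCuspForm.petersson_T (hf : L.IsCuspForm k f) (τ : ℍ) :
    petersson k f (ModularGroup.T • τ) = petersson k f τ := by
  have h1 : ∀ μ, ‖e (L.qD μ)‖ = 1 := fun μ => norm_e_rat _
  rw [UpperHalfPlane.modular_T_smul, petersson, petersson, UpperHalfPlane.vadd_im]
  simp_rw [hf.map_T, norm_mul, h1, one_mul]

theorem IsCuspForm.petersson_S (hf : L.IsCuspForm k f) (τ : ℍ) :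
    petersson k f (ModularGroup.S • τ) = petersson k f τ := by
  have hn : 0 < ‖(τ : ℂ)‖ := norm_pos_iff.2 τ.ne_zero
  have him : (ModularGroup.S • τ).im = τ.im * (‖(τ : ℂ)‖ ^ 2)⁻¹ := by
    rw [← UpperHalfPlane.coe_im, modular_S_coe, neg_div, Complex.neg_im, one_div, Complex.inv_im,
      Complex.normSq_eq_norm_sq]
    rw [neg_div, neg_neg]
    rfl
  rw [petersson, petersson, hf.map_S, him]
  simp only [Pi.smul_apply, smul_eq_mul, norm_mul, mul_pow]
  rw [← Finset.mul_sum, sum_norm_weilS, Complex.norm_cpow_real,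
    Real.mul_rpow τ.im_pos.le (by positivity), Real.inv_rpow (by positivity),
    ← Real.rpow_natCast, ← Real.rpow_natCast, ← Real.rpow_mul hn.le, ← Real.rpow_mul hn.le,
    mul_comm k]
  have : ‖(τ : ℂ)‖ ^ ((2 : ℕ) * k) ≠ 0 := (Real.rpow_pos_of_pos hn _).ne'
  field_simp

theorem IsCuspForm.petersson_smul (hf : L.IsCuspForm k f) (g : Matrix.SpecialLinearGroup (Fin 2) ℤ)
    (τ : ℍ) : petersson k f (g • τ) = petersson k f τ := by
  obtain ⟨w, rfl⟩ := exists_slWord g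
  induction w with
  | nil => simp
  | cons b w ih =>
    cases b with
    | true => rw [slWord_true, mul_smul, hf.petersson_S, ih]
    | false => rw [slWord_false, mul_smul, hf.petersson_T, ih]

theorem IsCuspForm.periodic (hf : L.IsCuspForm k f) (μ : L.Disc) :
    Function.Periodic (fun z => ext f z μ) (L.level : ℝ) := fun z => by
  by_cases hz : 0 < z.im
  · have h : ∀ m : ℕ, ext f (z + m) μ = e (L.qD μ) ^ m * ext f z μ := fun m => by
      induction m with
      | zero => simp
      | succ m ih =>
        rw [Nat.cast_succ, ← add_assoc, hf.map_add_one (by simpa using hz), ih, pow_succ]; ring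
    have h2 := h L.level
    have h3 := L.discQ.ψ_pow μ
    change e (L.qD μ) ^ L.level = 1 at h3
    rw [h3, one_mul] at h2
    simpa using h2
  · have h1 : (z + ((L.level : ℝ) : ℂ)).im ≤ 0 := by simpa using hz
    simp only [ext]
    rw [UpperHalfPlane.ofComplex_apply_of_im_nonpos h1,
      UpperHalfPlane.ofComplex_apply_of_im_nonpos (not_lt.1 hz)]

/-- Each component has the level as a period and vanishes at `i∞`, so it is a holomorphic function
of `e(z/N)` with a zero at the origin. -/
theorem IsCuspForm.exp_decay (hf : L.IsCuspForm k f) (μ : L.Disc) :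
    (fun z => ext f z μ) =O[Filter.comap Complex.im Filter.atTop]
      fun z => Real.exp (-2 * Real.pi * z.im / L.level) := by
  refine Function.Periodic.exp_decay_of_zero_at_inf (by exact_mod_cast L.level_pos) (hf.periodic μ)
    ?_ ?_
  · have : ∀ᶠ z : ℂ in Filter.comap Complex.im Filter.atTop, 0 < z.im :=
      Filter.tendsto_comap.eventually (Filter.eventually_gt_atTop 0)
    filter_upwards [this] with z hz
    exact (hf.differentiableOn_ext μ).differentiableAt
      ((isOpen_lt continuous_const Complex.continuous_im).mem_nhds hz)
  · exact (hf.zero_at_infty μ).comp UpperHalfPlane.tendsto_comap_im_ofComplex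

theorem IsCuspForm.petersson_bounded (hf : L.IsCuspForm k f) :
    UpperHalfPlane.IsBoundedAtImInfty (petersson k f) := by
  have hlev : (0 : ℝ) < L.level := by exact_mod_cast L.level_pos
  have h1 : ∀ μ, (fun τ : ℍ => f τ μ) =O[UpperHalfPlane.atImInfty]
      fun τ : ℍ => Real.exp (-2 * Real.pi * τ.im / L.level) := fun μ => by
    have := (hf.exp_decay μ).comp_tendsto UpperHalfPlane.tendsto_coe_atImInfty
    refine this.congr_left fun τ => ?_
    simp only [Function.comp_apply, ext, UpperHalfPlane.ofComplex_apply]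
  have h2 : ∀ μ, (fun τ : ℍ => ‖f τ μ‖ ^ 2) =O[UpperHalfPlane.atImInfty]
      fun τ : ℍ => Real.exp (-2 * Real.pi * τ.im / L.level) ^ 2 := fun μ => (h1 μ).norm_left.pow 2
  have h3 := (Asymptotics.isBigO_refl (fun τ : ℍ => τ.im ^ k) UpperHalfPlane.atImInfty).mul
    (Asymptotics.IsBigO.sum (s := Finset.univ) fun μ _ => h2 μ)
  refine Asymptotics.IsBigO.trans (h3.congr_left (f₂ := petersson k f) fun τ => ?_) ?_
  · simp [petersson]
  · have h4 := tendsto_rpow_mul_exp_neg_mul_atTop_nhds_zero k (4 * Real.pi / L.level)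
      (by positivity)
    have h5 : Filter.Tendsto (fun τ : ℍ => τ.im) UpperHalfPlane.atImInfty Filter.atTop :=
      Filter.tendsto_comap
    refine ((h4.comp h5).isBigO_one ℝ).congr_left fun τ => ?_
    simp only [Function.comp_apply]
    rw [← Real.exp_nat_mul]
    congr 2
    push_cast; ring

theorem IsCuspForm.exists_bound (hf : L.IsCuspForm k f) :
    ∃ C : ℝ, ∀ τ : ℍ, ∀ μ, τ.im ^ (k / 2) * ‖f τ μ‖ ≤ C := by
  have hcont : Continuous (petersson k f) := by
    unfold petersson
    refine Continuous.mul ?_ (continuous_finsetSum _ fun μ _ => (hf.holo μ).continuous.norm.pow 2)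
    exact UpperHalfPlane.continuous_im.rpow_const fun τ => .inl τ.im_ne_zero
  obtain ⟨C, hC⟩ := ModularGroup.exists_bound_of_invariant hcont hf.petersson_bounded
    hf.petersson_smul
  refine ⟨Real.sqrt C, fun τ μ => Real.le_sqrt_of_sq_le ?_⟩
  refine le_trans ?_ ((le_abs_self _).trans (hC τ))
  rw [petersson, mul_pow, ← Real.rpow_natCast (τ.im ^ (k / 2)), ← Real.rpow_mul τ.im_pos.le]
  have : k / 2 * (2 : ℕ) = k := by push_cast; ring
  rw [this]
  refine mul_le_mul_of_nonneg_left ?_ (Real.rpow_nonneg τ.im_pos.le _)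
  exact Finset.single_le_sum (f := fun μ => ‖f τ μ‖ ^ 2) (fun _ _ => by positivity)
    (Finset.mem_univ μ)

theorem IsCuspForm.exists_bound_ext (hf : L.IsCuspForm k f) :
    ∃ C : ℝ, 0 ≤ C ∧ ∀ z : ℂ, 0 < z.im → ∀ μ, ‖ext f z μ‖ ≤ C * z.im ^ (-(k / 2)) := by
  obtain ⟨C, hC⟩ := hf.exists_bound
  refine ⟨max C 0, le_max_right _ _, fun z hz μ => ?_⟩
  have h := hC ⟨z, hz⟩ μ
  have hp : 0 < z.im ^ (k / 2) := Real.rpow_pos_of_pos hz _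
  rw [Real.rpow_neg hz.le, ← div_eq_mul_inv, le_div_iff₀ hp, ext,
    UpperHalfPlane.ofComplex_apply_of_im_pos hz, mul_comm]
  exact h.trans (le_max_left _ _)

theorem IsCuspForm.norm_coeff_le (hf : L.IsCuspForm k f) {C : ℝ}
    (hC : ∀ z : ℂ, 0 < z.im → ∀ μ, ‖ext f z μ‖ ≤ C * z.im ^ (-(k / 2))) {μ : L.Disc} {n : ℚ}
    (hn : n ∈ L.qCoset μ) {y : ℝ} (hy : 0 < y) :
    ‖L.coeff f μ n‖ ≤ C * y ^ (-(k / 2)) * Real.exp (2 * Real.pi * n * y) := by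
  have hz : 0 < ((y : ℂ) * Complex.I).im := by simpa using hy
  rw [← hf.coeff_eq hn hz]
  have h1 := intervalIntegral.norm_integral_le_of_norm_le_const (a := 0) (b := 1)
    (f := fun x : ℝ => ext f (y * Complex.I + x) μ * e (-(n : ℂ) * (y * Complex.I + x)))
    (C := C * y ^ (-(k / 2)) * Real.exp (2 * Real.pi * n * y)) fun x _ => ?_
  · simpa using h1
  · rw [norm_mul]
    have him : ((y : ℂ) * Complex.I + x).im = y := by simp
    have h2 := hC (y * Complex.I + x) (by rw [him]; exact hy) μ
    rw [him] at h2
    have h3 : ‖e (-(n : ℂ) * (y * Complex.I + x))‖ = Real.exp (2 * Real.pi * n * y) := by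
      rw [norm_e]
      congr 1
      have : (-(n : ℂ) * (y * Complex.I + x)) = ((-n : ℝ) : ℂ) * (y * Complex.I + x) := by
        push_cast; ring
      rw [this, Complex.im_ofReal_mul, him]; ring
    rw [h3]
    exact mul_le_mul_of_nonneg_right h2 (Real.exp_pos _).le

/-- Let `y → ∞` in `norm_coeff_le`: the exponential is at most `1` and `y^(-k/2)` tends to `0`. -/
theorem IsCuspForm.coeff_eq_zero (hf : L.IsCuspForm k f) (hk : 0 < k) {μ : L.Disc} {n : ℚ}
    (hn : n ≤ 0) : L.coeff f μ n = 0 := by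
  by_cases hmem : n ∈ L.qCoset μ
  · obtain ⟨C, hC0, hC⟩ := hf.exists_bound_ext
    have h1 : Filter.Tendsto (fun y : ℝ => C * y ^ (-(k / 2))) Filter.atTop (nhds (C * 0)) :=
      (tendsto_rpow_neg_atTop (by positivity)).const_mul C
    rw [mul_zero] at h1
    refine norm_le_zero_iff.1 (ge_of_tendsto h1 ?_)
    filter_upwards [Filter.eventually_gt_atTop 0] with y hy
    refine (hf.norm_coeff_le hC hmem hy).trans (mul_le_of_le_one_right (by positivity) ?_)
    rw [Real.exp_le_one_iff]
    have : (n : ℝ) ≤ 0 := by exact_mod_cast hn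
    have h2 := mul_nonneg (neg_nonneg.2 this) hy.le
    nlinarith [Real.pi_pos, mul_nonneg h2 Real.pi_pos.le]
  · rw [coeff, if_neg hmem]

/-- Take `y = 1/n` in `norm_coeff_le`. -/
theorem IsCuspForm.exists_coeff_bound (hf : L.IsCuspForm k f) :
    ∃ C : ℝ, 0 ≤ C ∧ ∀ μ (n : ℚ), 0 < n → ‖L.coeff f μ n‖ ≤ C * (n : ℝ) ^ (k / 2) := by
  obtain ⟨C, hC0, hC⟩ := hf.exists_bound_ext
  refine ⟨C * Real.exp (2 * Real.pi), by positivity, fun μ n hn => ?_⟩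
  have hn' : (0 : ℝ) < n := by exact_mod_cast hn
  by_cases hmem : n ∈ L.qCoset μ
  · refine (hf.norm_coeff_le hC hmem (inv_pos.2 hn')).trans_eq ?_
    rw [Real.inv_rpow hn'.le, Real.rpow_neg hn'.le, inv_inv, mul_assoc (2 * Real.pi),
      mul_inv_cancel₀ hn'.ne', mul_one]
    ring
  · rw [coeff, if_neg hmem, norm_zero]; positivity

/-- The Hecke bound for the eigenvalues. -/
theorem IsCuspForm.norm_eigenvalue_le (hf : L.IsCuspForm k f) (hf0 : f ≠ 0) {p : ℕ} (hp : p.Prime)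
    (hpL : ¬ p ∣ L.level) {Λ : ℂ} (hΛ : L.hecke k p f = Λ • f) :
    ‖Λ‖ ≤ (p : ℝ) ^ k + (p : ℝ) ^ (k - 1) := by
  obtain ⟨b, ω, hb, hω, -⟩ := hf.exists_mid hf0 hp hpL
  have hp0 : (0 : ℝ) < p := by exact_mod_cast hp.pos
  have hcop : IsCoprime (p : ℤ) (L.level : ℤ) :=
    Nat.isCoprime_iff_coprime.2 ((Nat.Prime.coprime_iff_not_dvd hp).2 hpL)
  obtain ⟨p', hp'⟩ := zmod_unit_iff.2 hcop
  obtain ⟨C₀, hC₀⟩ := hf.exists_bound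
  let g : ℍ × L.Disc → ℝ := fun x => x.1.im ^ (k / 2) * ‖f x.1 x.2‖
  have hbdd : BddAbove (Set.range g) := ⟨C₀, by rintro _ ⟨x, rfl⟩; exact hC₀ x.1 x.2⟩
  -- The constant must be the exact supremum: applying the Hecke operator then bounds `|Λ|` times
  -- the supremum by a multiple of the same supremum, which is positive and cancels.
  set C := ⨆ x, g x with hCdef
  have hle : ∀ x, g x ≤ C := fun x => le_ciSup hbdd x
  have hpos : 0 < C := by
    obtain ⟨τ, hτ⟩ := Function.ne_iff.1 hf0
    obtain ⟨μ, hμ⟩ := Function.ne_iff.1 hτ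
    refine lt_of_lt_of_le ?_ (hle (τ, μ))
    exact mul_pos (Real.rpow_pos_of_pos τ.im_pos _) (norm_pos_iff.2 hμ)
  have hext : ∀ z : ℂ, 0 < z.im → ∀ μ, ‖ext f z μ‖ ≤ C * z.im ^ (-(k / 2)) := fun z hz μ => by
    have h := hle (⟨z, hz⟩, μ)
    have hp : 0 < z.im ^ (k / 2) := Real.rpow_pos_of_pos hz _
    rw [Real.rpow_neg hz.le, ← div_eq_mul_inv, le_div_iff₀ hp, ext,
      UpperHalfPlane.ofComplex_apply_of_im_pos hz, mul_comm]
    exact h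
  have hnp : ∀ r : ℝ, ‖(p : ℂ) ^ (r : ℂ)‖ = (p : ℝ) ^ r := fun r => by
    rw [Complex.norm_cpow_real, Complex.norm_natCast]
  have key : ∀ x, ‖Λ‖ * g x ≤ ((p : ℝ) ^ k + (p : ℝ) ^ (k - 1)) * C := by
    rintro ⟨τ, μ⟩
    have hy := τ.im_pos
    have hyk : 0 < τ.im ^ (k / 2) := Real.rpow_pos_of_pos hy _
    have h1 := hf.hecke_apply hf0 hp hpL hp' hb τ μ
    rw [hΛ] at h1
    simp only [Pi.smul_apply, smul_eq_mul] at h1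
    set Y := τ.im ^ (-(k / 2)) with hY
    have hYk : τ.im ^ (k / 2) * Y = 1 := by
      rw [hY, ← Real.rpow_add hy, add_neg_cancel, Real.rpow_zero]
    have hpk : ((p : ℝ) ^ 2) ^ (-(k / 2)) = (p : ℝ) ^ (-k) := by
      rw [← Real.rpow_natCast, ← Real.rpow_mul hp0.le]; congr 1; push_cast; ring
    have e1 : ‖ext f ((p : ℂ) ^ 2 * τ) (p' • μ)‖ ≤ C * ((p : ℝ) ^ (-k) * Y) := by
      refine (hext _ (im_mul_sq_pos hp.pos hy) _).trans_eq ?_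
      have : ((p : ℂ) ^ 2 * τ).im = (p : ℝ) ^ 2 * τ.im := by
        have : (p : ℂ) ^ 2 * τ = (((p : ℝ) ^ 2 : ℝ) : ℂ) * τ := by push_cast; ring
        rw [this, Complex.im_ofReal_mul]; rfl
      rw [this, Real.mul_rpow (by positivity) hy.le, hpk]
    have e2 : ∀ m : ℕ, ‖e (-(m * L.qD μ)) * ext f (((τ : ℂ) + m) / (p : ℂ) ^ 2) (p • μ)‖ ≤
        C * ((p : ℝ) ^ k * Y) := fun m => by
      have h3 : ‖e (-(m * L.qD μ : ℂ))‖ = 1 := by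
        have := norm_e_rat (-(m * L.qD μ))
        push_cast at this
        exact this
      have hpos2 : 0 < ((τ : ℂ) + m).im := by
        rw [Complex.add_im, Complex.natCast_im, add_zero]; exact hy
      rw [norm_mul, h3, one_mul]
      refine (hext _ (im_div_sq_pos hp.pos hpos2) _).trans_eq ?_
      have : (((τ : ℂ) + m) / (p : ℂ) ^ 2).im = ((p : ℝ) ^ 2)⁻¹ * τ.im := by
        have : ((τ : ℂ) + m) / (p : ℂ) ^ 2 = ((((p : ℝ) ^ 2)⁻¹ : ℝ) : ℂ) * (τ + m) := by
          push_cast; ring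
        rw [this, Complex.im_ofReal_mul, Complex.add_im, Complex.natCast_im, add_zero]; rfl
      rw [this, Real.mul_rpow (by positivity) hy.le, Real.inv_rpow (by positivity), hpk,
        Real.rpow_neg hp0.le, inv_inv]
    have e3 : ∀ j ∈ Finset.Ico 1 p, ‖ω j * ext f ((τ : ℂ) + b j / p) μ‖ ≤ C * Y := fun j hj => by
      rw [norm_mul, hω j hj, one_mul]
      refine (hext _ (im_add_ratio_pos hy _ _) _).trans_eq ?_
      have : ((τ : ℂ) + b j / p).im = τ.im := by
        have : ((τ : ℂ) + b j / p) = τ + ((b j / p : ℝ) : ℂ) := by push_cast; rfl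
        rw [this, Complex.add_im, Complex.ofReal_im, add_zero]; rfl
      rw [this]
    have h2 : ‖Λ * f τ μ‖ ≤ (p : ℝ) ^ (2 * k - 2) * (C * ((p : ℝ) ^ (-k) * Y)) +
        (p : ℝ) ^ (-2 : ℝ) * ((p : ℝ) ^ 2 * (C * ((p : ℝ) ^ k * Y))) +
        (p : ℝ) ^ (k - 2) * (((p : ℝ) - 1) * (C * Y)) := by
      rw [h1]
      refine (norm_add_le _ _).trans (add_le_add ((norm_add_le _ _).trans (add_le_add ?_ ?_)) ?_)
      · rw [norm_mul]
        have := hnp (2 * k - 2)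
        push_cast at this
        rw [this]
        exact mul_le_mul_of_nonneg_left e1 (Real.rpow_nonneg hp0.le _)
      · rw [norm_mul]
        have := hnp (-2)
        push_cast at this
        rw [this]
        refine mul_le_mul_of_nonneg_left ?_ (Real.rpow_nonneg hp0.le _)
        refine (norm_sum_le_of_le _ fun m _ => e2 m).trans_eq ?_
        rw [Finset.sum_const, Finset.card_range, nsmul_eq_mul]
        push_cast; rfl
      · rw [norm_mul]
        have := hnp (k - 2)
        push_cast at this
        rw [this]
        refine mul_le_mul_of_nonneg_left ?_ (Real.rpow_nonneg hp0.le _)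
        refine (norm_sum_le_of_le _ fun j hj => e3 j hj).trans_eq ?_
        rw [Finset.sum_const, Nat.card_Ico, nsmul_eq_mul, Nat.cast_sub hp.one_le]
        push_cast; rfl
    -- The `1`, `p²` and `p - 1` cosets contribute `p^(k-2)`, `p^k` and `(p - 1) p^(k-2)`.
    have h3 : (p : ℝ) ^ (2 * k - 2) * (C * ((p : ℝ) ^ (-k) * Y)) +
        (p : ℝ) ^ (-2 : ℝ) * ((p : ℝ) ^ 2 * (C * ((p : ℝ) ^ k * Y))) +
        (p : ℝ) ^ (k - 2) * (((p : ℝ) - 1) * (C * Y)) =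
        ((p : ℝ) ^ k + (p : ℝ) ^ (k - 1)) * C * Y := by
      have q1 : (p : ℝ) ^ (2 * k - 2) * (p : ℝ) ^ (-k) = (p : ℝ) ^ (k - 2) := by
        rw [← Real.rpow_add hp0]; congr 1; ring
      have q2 : (p : ℝ) ^ (-2 : ℝ) * (p : ℝ) ^ 2 = 1 := by
        rw [← Real.rpow_natCast, ← Real.rpow_add hp0]; norm_num
      have q3 : (p : ℝ) ^ (k - 2) * p = (p : ℝ) ^ (k - 1) := by
        nth_rw 2 [← Real.rpow_one (p : ℝ)]
        rw [← Real.rpow_add hp0]; congr 1; ring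
      linear_combination (C * Y) * q1 + (C * (p : ℝ) ^ k * Y) * q2 + (C * Y) * q3
    rw [h3, norm_mul] at h2
    calc ‖Λ‖ * (τ.im ^ (k / 2) * ‖f τ μ‖) = τ.im ^ (k / 2) * (‖Λ‖ * ‖f τ μ‖) := by ring
      _ ≤ τ.im ^ (k / 2) * (((p : ℝ) ^ k + (p : ℝ) ^ (k - 1)) * C * Y) :=
        mul_le_mul_of_nonneg_left h2 hyk.le
      _ = ((p : ℝ) ^ k + (p : ℝ) ^ (k - 1)) * C * (τ.im ^ (k / 2) * Y) := by ring
      _ = _ := by rw [hYk, mul_one]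
  have h4 : ‖Λ‖ * C ≤ ((p : ℝ) ^ k + (p : ℝ) ^ (k - 1)) * C := by
    rcases (norm_nonneg Λ).eq_or_lt with h | h
    · rw [← h, zero_mul]; positivity
    · rw [← le_div_iff₀' h]
      exact ciSup_le fun x => (le_div_iff₀' h).2 (key x)
  exact le_of_mul_le_mul_right h4 hpos

end EvenLattice

/-! ### Formal Euler products. -/

/-- Summation of a sequence that satisfies a two-term linear recurrence. -/
theorem tsum_of_linear_recurrence {c : ℕ → ℂ} (hc : Summable c) {α β γ : ℂ} (h1 : c 1 = α * c 0)
    (h2 : ∀ j, c (j + 2) = β * c (j + 1) - γ * c j) :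
    (1 - β + γ) * ∑' j, c j = (1 + (α - β)) * c 0 := by
  have e1 := hc.tsum_eq_zero_add
  have hs1 : Summable fun j => c (j + 1) := (summable_nat_add_iff 1).2 hc
  have e2 := hs1.tsum_eq_zero_add
  have e3 : ∑' j, c (j + 1 + 1) = β * ∑' j, c (j + 1) - γ * ∑' j, c j := by
    rw [← tsum_mul_left, ← tsum_mul_left, ← (hs1.mul_left β).tsum_sub (hc.mul_left γ)]
    exact tsum_congr h2
  rw [e3] at e2
  rw [zero_add, h1] at e2
  linear_combination (1 - β) * e1 + e2

/-- A formal Euler product over a set of primes, for a series with local factors at these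
primes. -/
theorem tsum_eq_tsum_mul_prod {a : ℕ → ℂ} (ha : Summable a) {Q : ℕ → ℂ}
    {F : Finset ℕ} (hF : ∀ p ∈ F, p.Prime)
    (hQ : ∀ p ∈ F, ∀ n, n ≠ 0 → ¬ p ∣ n → ∑' j, a (p ^ j * n) = Q p * a n) :
    ∑' n, Set.indicator {n | n ≠ 0} a n =
      (∏ p ∈ F, Q p) * ∑' n, Set.indicator {n | n ≠ 0 ∧ ∀ p ∈ F, ¬ p ∣ n} a n := by
  induction F using Finset.induction_on with
  | empty => simp
  | insert p F hpF ih =>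
    rw [ih (fun q hq => hF q (Finset.mem_insert_of_mem hq))
      (fun q hq => hQ q (Finset.mem_insert_of_mem hq)), Finset.prod_insert hpF,
      mul_comm (Q p), mul_assoc]
    congr 1
    have hp := hF p (Finset.mem_insert_self p F)
    set U : Set ℕ := {n | n ≠ 0 ∧ ∀ q ∈ insert p F, ¬ q ∣ n} with hU
    have hU0 : ∀ m : U, (m : ℕ) ≠ 0 := fun m => m.2.1
    have hUp : ∀ m : U, ¬ p ∣ (m : ℕ) := fun m => m.2.2 p (Finset.mem_insert_self p F)
    -- Each `n ≠ 0` prime to `F` is uniquely `p^i m` with `m` prime to `p` as well; for fixed `m`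
    -- the sum over `i` is `Q p * a m`.
    let g : U × ℕ → ℕ := fun x => p ^ x.2 * x.1
    have hg : Function.Injective g := by
      rintro ⟨m, i⟩ ⟨m', j⟩ h
      change p ^ i * (m : ℕ) = p ^ j * (m' : ℕ) at h
      have hv : ∀ (m : U) i, (p ^ i * (m : ℕ)).factorization p = i := fun m i => by
        rw [Nat.factorization_mul (pow_ne_zero _ hp.ne_zero) (hU0 m), Finsupp.add_apply,
          hp.factorization_pow, Finsupp.single_eq_same,
          Nat.factorization_eq_zero_of_not_dvd (hUp m), add_zero]
      have hij : i = j := by rw [← hv m i, h, hv]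
      subst hij
      have := Nat.eq_of_mul_eq_mul_left (pow_pos hp.pos i) h
      rw [Subtype.ext this]
    have hsupp : Function.support (Set.indicator {n | n ≠ 0 ∧ ∀ q ∈ F, ¬ q ∣ n} a) ⊆ Set.range g := by
      intro n hn
      have hn := (Set.mem_of_indicator_ne_zero hn)
      obtain ⟨j, m, hm, rfl⟩ := Nat.exists_eq_pow_mul_and_not_dvd hn.1 p hp.ne_one
      refine ⟨(⟨m, right_ne_zero_of_mul hn.1, fun q hq hd => ?_⟩, j), rfl⟩
      rcases Finset.mem_insert.1 hq with rfl | hq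
      · exact hm hd
      · exact hn.2 q hq (hd.mul_left _)
    have hgU : ∀ x, g x ∈ {n | n ≠ 0 ∧ ∀ q ∈ F, ¬ q ∣ n} := fun x =>
      ⟨mul_ne_zero (pow_ne_zero _ hp.ne_zero) (hU0 x.1), fun q hq hd => by
        have hq' := hF q (Finset.mem_insert_of_mem hq)
        rcases (hq'.dvd_mul).1 hd with h | h
        · exact hpF ((Nat.prime_dvd_prime_iff_eq hq' hp).1 (hq'.dvd_of_dvd_pow h) ▸ hq)
        · exact x.1.2.2 q (Finset.mem_insert_of_mem hq) h⟩
    rw [← hg.tsum_eq hsupp]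
    simp_rw [Set.indicator_of_mem (hgU _)]
    have hsum : Summable fun x => a (g x) := ha.comp_injective hg
    rw [hsum.tsum_prod, ← tsum_subtype U a, ← tsum_mul_left]
    exact tsum_congr fun m => hQ p (Finset.mem_insert_self p F) m (hU0 m) (hUp m)

/-- An Euler product over a set of primes, for a series with local factors at these primes. -/
theorem tsum_eq_tsum_mul_tprod {a : ℕ → ℂ} (ha : Summable a) {Q : ℕ → ℂ} {P : ℕ → Prop}
    (hP : ∀ p, P p → p.Prime)
    (hQ : ∀ p, P p → ∀ n, n ≠ 0 → ¬ p ∣ n → ∑' j, a (p ^ j * n) = Q p * a n)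
    (hm : Multipliable fun p : {p // P p} => Q p) :
    ∑' n, Set.indicator {n | n ≠ 0} a n =
      (∑' n, Set.indicator {n | n ≠ 0 ∧ ∀ p, P p → ¬ p ∣ n} a n) * ∏' p : {p // P p}, Q p := by
  classical
  have h1 : ∀ F : Finset {p // P p}, ∑' n, Set.indicator {n | n ≠ 0} a n =
      (∏ p ∈ F, Q p) * ∑' n, Set.indicator {n | n ≠ 0 ∧ ∀ p ∈ F, ¬ (p : ℕ) ∣ n} a n := fun F => by
    have h := tsum_eq_tsum_mul_prod ha (Q := Q) (F := F.map (Function.Embedding.subtype _))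
      (fun p hp => by
        obtain ⟨q, -, rfl⟩ := Finset.mem_map.1 hp
        exact hP _ q.2)
      (fun p hp => by
        obtain ⟨q, -, rfl⟩ := Finset.mem_map.1 hp
        exact hQ _ q.2)
    rw [h, Finset.prod_map]
    congr 3
    ext n
    simp [Finset.mem_map]
  -- Dominated convergence with majorant `‖a n‖`: an `n` divisible by some prime in `P` drops out
  -- once `F` contains that prime.
  have h2 : Filter.Tendsto (fun F : Finset {p // P p} =>
      ∑' n, Set.indicator {n | n ≠ 0 ∧ ∀ p ∈ F, ¬ (p : ℕ) ∣ n} a n) Filter.atTop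
      (nhds (∑' n, Set.indicator {n | n ≠ 0 ∧ ∀ p, P p → ¬ p ∣ n} a n)) := by
    refine tendsto_tsum_of_dominated_convergence ha.norm (fun n => ?_)
      (Filter.Eventually.of_forall fun F n => norm_indicator_le_norm_self _ _)
    refine tendsto_const_nhds.congr' ?_
    by_cases hn : n ≠ 0 ∧ ∀ p, P p → ¬ p ∣ n
    · rw [Set.indicator_of_mem (by exact hn)]
      refine Filter.Eventually.of_forall fun F => ?_
      exact (Set.indicator_of_mem (s := {n | n ≠ 0 ∧ ∀ p ∈ F, ¬ (p : ℕ) ∣ n})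
        ⟨hn.1, fun p _ => hn.2 p p.2⟩ a).symm
    · rw [Set.indicator_of_notMem (by exact hn)]
      by_cases hn0 : n = 0
      · refine Filter.Eventually.of_forall fun F => ?_
        exact (Set.indicator_of_notMem (fun h => h.1 hn0) a).symm
      · push Not at hn
        obtain ⟨p, hp, hd⟩ := hn hn0
        filter_upwards [Filter.eventually_ge_atTop {⟨p, hp⟩}] with F hF
        exact (Set.indicator_of_notMem (fun h => h.2 _ (Finset.singleton_subset_iff.1 hF) hd) a).symm
  have h3 : Filter.Tendsto (fun F : Finset {p // P p} => ∏ p ∈ F, Q p) Filter.atTop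
      (nhds (∏' p : {p // P p}, Q p)) := hm.hasProd
  have h3 := h3.mul h2
  rw [mul_comm]
  exact tendsto_nhds_unique (tendsto_const_nhds.congr h1) h3

theorem Nat.exists_dvd_pow_iff_forall_prime {n N : ℕ} (hn : n ≠ 0) :
    (∃ m : ℕ, n ∣ N ^ m) ↔ ∀ p : ℕ, p.Prime ∧ ¬ p ∣ N → ¬ p ∣ n := by
  constructor
  · rintro ⟨m, hm⟩ p ⟨hp, hpN⟩ hd
    exact hpN (hp.dvd_of_dvd_pow (hd.trans hm))
  · intro h
    induction n using Nat.recOnMul with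
    | zero => exact absurd rfl hn
    | one => exact ⟨0, one_dvd _⟩
    | prime p hp => exact ⟨1, by
        rw [pow_one]
        by_contra hd
        exact h p ⟨hp, hd⟩ dvd_rfl⟩
    | mul a b iha ihb =>
      obtain ⟨i, hi⟩ := iha (left_ne_zero_of_mul hn) fun p hp hd => h p hp (hd.mul_right b)
      obtain ⟨j, hj⟩ := ihb (right_ne_zero_of_mul hn) fun p hp hd => h p hp (hd.mul_left a)
      exact ⟨i + j, pow_add N i j ▸ mul_dvd_mul hi hj⟩

/-! ### Recurrences of the coefficients along powers of `p`. -/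

namespace EvenLattice

variable {V : Type*} [AddCommGroup V] [Module ℚ V] {L : EvenLattice V} {k : ℝ} {f : L.VVFun}

theorem nsmul_mem_qCoset {μ : L.Disc} {t : ℚ} (ht : t ∈ L.qCoset μ) (m : ℕ) :
    (m : ℚ) ^ 2 * t ∈ L.qCoset (m • μ) := by
  have := mul_sq_mem_qCoset ht (m : ℤ)
  rwa [natCast_zsmul, Int.cast_natCast] at this

theorem ratCast_sq_mul {p : ℕ} [Fact p.Prime] (hpL : ¬ p ∣ L.level) {μ : L.Disc} {t : ℚ}
    (ht : t ∈ L.qCoset μ) (m : ℕ) :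
    (((m : ℚ) ^ 2 * t : ℚ) : ZMod p) = (m : ZMod p) ^ 2 * (t : ZMod p) := by
  have h : (m : ℚ) ^ 2 = ((m ^ 2 : ℕ) : ℚ) := by push_cast; rfl
  rw [h, Rat.cast_mul_of_ne_zero (by simp) (den_ne_zero hpL ht), Rat.cast_natCast]
  push_cast; rfl

theorem midSum_sq_mul {p : ℕ} [Fact p.Prime] (hpL : ¬ p ∣ L.level) {μ : L.Disc} {t : ℚ}
    (ht : t ∈ L.qCoset μ) {m : ℕ} (hm : ¬ p ∣ m) : L.midSum p ((m : ℚ) ^ 2 * t) = L.midSum p t := by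
  have hm0 : (m : ZMod p) ≠ 0 := fun h => hm ((ZMod.natCast_eq_zero_iff _ _).1 h)
  have ht' := nsmul_mem_qCoset ht m
  simp only [midSum, ratLegendre_neg hpL ht, ratLegendre_neg hpL ht', ← ratCast_eq_zero_iff hpL ht,
    ← ratCast_eq_zero_iff hpL ht', ratCast_sq_mul hpL ht, mul_eq_zero, pow_eq_zero_iff two_ne_zero,
    hm0, false_or]
  rw [← mul_neg, map_mul, quadraticChar_sq_one' hm0, one_mul]

theorem midSum_of_dvd {p : ℕ} [Fact p.Prime] (hpL : ¬ p ∣ L.level) {μ : L.Disc} {t : ℚ}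
    (ht : t ∈ L.qCoset μ) {m : ℕ} (hm : p ∣ m) : L.midSum p ((m : ℚ) ^ 2 * t) =
      if Even L.rank then (L.gaussSum 1 / L.gaussSum p) * ((p : ℂ) - 1) else 0 := by
  have hm0 : (m : ZMod p) = 0 := (ZMod.natCast_eq_zero_iff _ _).2 hm
  have ht' := nsmul_mem_qCoset ht m
  simp only [midSum, ratLegendre_neg hpL ht', ← ratCast_eq_zero_iff hpL ht',
    ratCast_sq_mul hpL ht, hm0]
  simp

/-- Multiplied by the level, `n² t / p²` would be an integer if it lay in a coset `q(ν) + ℤ`; as `p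
∤ n`, this contradicts `p² ∤ N t`. -/
theorem coeff_div_sq_eq_zero {p : ℕ} (hp : p.Prime) {μ ν : L.Disc} {t : ℚ} (ht : t ∈ L.qCoset μ)
    (ht_sq : ¬ ∃ m : ℤ, (L.level : ℚ) * t = (p : ℚ) ^ 2 * m) {n : ℕ} (hn : ¬ p ∣ n) :
    L.coeff f ν ((n : ℚ) ^ 2 * t / p ^ 2) = 0 := by
  rw [coeff, if_neg]
  intro hmem
  obtain ⟨A, hA⟩ := level_mul_mem hmem
  obtain ⟨B, hB⟩ := level_mul_mem ht
  have hp0 : (p : ℚ) ≠ 0 := by exact_mod_cast hp.ne_zero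
  have h : (n : ℤ) ^ 2 * B = (p : ℤ) ^ 2 * A := by
    have : (n : ℚ) ^ 2 * B = (p : ℚ) ^ 2 * A := by rw [← hA, ← hB]; field_simp
    exact_mod_cast this
  have hcop : IsCoprime ((p : ℤ) ^ 2) ((n : ℤ) ^ 2) :=
    (Nat.isCoprime_iff_coprime.2 ((Nat.Prime.coprime_iff_not_dvd hp).2 hn)).pow
  obtain ⟨c, hc⟩ := hcop.dvd_of_dvd_mul_left (Dvd.intro _ h.symm)
  exact ht_sq ⟨c, by rw [hB, hc]; push_cast; rfl⟩

theorem IsCuspForm.hecke_coeff_eigenform (hf : L.IsCuspForm k f) (hf0 : f ≠ 0) {p : ℕ}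
    (hp : p.Prime) (hpL : ¬ p ∣ L.level) {Λ : ℂ} (hΛ : L.hecke k p f = Λ • f) {ν μ : L.Disc}
    (hν : p • ν = μ) {n : ℚ} (hn : n ∈ L.qCoset μ) :
    L.coeff f (p • μ) (p ^ 2 * n) = (Λ - (p : ℂ) ^ ((k : ℂ) - 2) * L.midSum p n) * L.coeff f μ n -
      (p : ℂ) ^ (2 * (k : ℂ) - 2) * L.coeff f ν (n / p ^ 2) := by
  obtain ⟨b, ω, hb, -, h⟩ := hf.exists_mid hf0 hp hpL
  have := hf.hecke_coeff hf0 hp hpL hb hΛ hν hn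
  rw [h μ n hn] at this
  linear_combination -this

/-- The exceptional first step of the recurrence: the downward term vanishes by
`coeff_div_sq_eq_zero`, and the middle sum is the one at `t`. -/
theorem IsCuspForm.coeff_prime_mul (hf : L.IsCuspForm k f) (hf0 : f ≠ 0) {p : ℕ}
    (hp : p.Prime) (hpL : ¬ p ∣ L.level) {Λ : ℂ} (hΛ : L.hecke k p f = Λ • f) {μ : L.Disc}
    {t : ℚ} (ht : t ∈ L.qCoset μ)
    (ht_sq : ¬ ∃ m : ℤ, (L.level : ℚ) * t = (p : ℚ) ^ 2 * m) {n : ℕ} (hn : ¬ p ∣ n) :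
    L.coeff f ((p * n) • μ) (((p * n : ℕ) : ℚ) ^ 2 * t) =
      (Λ - (p : ℂ) ^ ((k : ℂ) - 2) * L.midSum p t) * L.coeff f (n • μ) ((n : ℚ) ^ 2 * t) := by
  have : Fact p.Prime := ⟨hp⟩
  have hcop : IsCoprime (p : ℤ) (L.level : ℤ) :=
    Nat.isCoprime_iff_coprime.2 ((Nat.Prime.coprime_iff_not_dvd hp).2 hpL)
  obtain ⟨p', hp'⟩ := zmod_unit_iff.2 hcop
  have hν : p • (p' • (n • μ)) = n • μ := by
    rw [← natCast_zsmul (p' • (n • μ)), ← mul_zsmul, L.discQ.zsmul_congr hp', one_zsmul]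
  have h := hf.hecke_coeff_eigenform hf0 hp hpL hΛ hν (nsmul_mem_qCoset ht n)
  rw [coeff_div_sq_eq_zero hp ht ht_sq hn, mul_zero, sub_zero, midSum_sq_mul hpL ht hn] at h
  rw [← h, mul_nsmul']
  congr 1
  push_cast; ring

/-- From the second step on the argument is divisible by `p`, and the middle sum no longer depends
on `t` or `n`. -/
theorem IsCuspForm.coeff_prime_sq_mul (hf : L.IsCuspForm k f) (hf0 : f ≠ 0) {p : ℕ}
    (hp : p.Prime) (hpL : ¬ p ∣ L.level) {Λ : ℂ} (hΛ : L.hecke k p f = Λ • f) {μ : L.Disc}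
    {t : ℚ} (ht : t ∈ L.qCoset μ) (n : ℕ) :
    L.coeff f ((p * (p * n)) • μ) (((p * (p * n) : ℕ) : ℚ) ^ 2 * t) =
      (Λ - (p : ℂ) ^ ((k : ℂ) - 2) *
        (if Even L.rank then (L.gaussSum 1 / L.gaussSum p) * ((p : ℂ) - 1) else 0)) *
        L.coeff f ((p * n) • μ) (((p * n : ℕ) : ℚ) ^ 2 * t) -
      (p : ℂ) ^ (2 * (k : ℂ) - 2) * L.coeff f (n • μ) ((n : ℚ) ^ 2 * t) := by
  have : Fact p.Prime := ⟨hp⟩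
  have hp0 : (p : ℚ) ≠ 0 := by exact_mod_cast hp.ne_zero
  have h := hf.hecke_coeff_eigenform hf0 hp hpL hΛ (mul_nsmul' μ p n).symm
    (nsmul_mem_qCoset ht (p * n))
  rw [midSum_of_dvd hpL ht (Dvd.intro _ rfl)] at h
  have e1 : ((p * n : ℕ) : ℚ) ^ 2 * t / p ^ 2 = (n : ℚ) ^ 2 * t := by
    push_cast; field_simp
  rw [e1] at h
  rw [← h, mul_nsmul' μ p (p * n)]
  congr 1
  push_cast; ring

end EvenLattice

/-! ### Local factors and convergence. -/

namespace EvenLattice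

variable {V : Type*} [AddCommGroup V] [Module ℚ V] {L : EvenLattice V} {k : ℝ} {f : L.VVFun}

/-- The general term of the series as a function on all natural numbers. -/
def natTerm (f : L.VVFun) (μ : L.Disc) (t : ℚ) (s : ℂ) (n : ℕ) : ℂ :=
  L.coeff f (n • μ) ((n : ℚ) ^ 2 * t) / (n : ℂ) ^ s

/-- The bound `a(μ, n) = O(n^(k/2))` at `n² t` gives `O(n^k)`. The term `n = 0` and the case `t ≤ 0`
vanish by cuspidality. -/
theorem IsCuspForm.summable_norm_natTerm (hf : L.IsCuspForm k f) (hk : 0 < k) (μ : L.Disc) (t : ℚ)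
    {s : ℂ} (hs : k + 1 < s.re) : Summable fun n => ‖natTerm f μ t s n‖ := by
  obtain ⟨C, hC0, hC⟩ := hf.exists_coeff_bound
  have hsum : Summable fun n : ℕ => C * |(t : ℝ)| ^ (k / 2) * (n : ℝ) ^ (k - s.re) :=
    (Real.summable_nat_rpow.2 (by linarith)).mul_left _
  refine hsum.of_nonneg_of_le (fun _ => norm_nonneg _) fun n => ?_
  rw [natTerm]
  rcases Nat.eq_zero_or_pos n with rfl | hn
  · rw [hf.coeff_eq_zero hk (by simp), zero_div, norm_zero]; positivity
  rcases le_or_gt t 0 with ht | ht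
  · rw [hf.coeff_eq_zero hk (mul_nonpos_of_nonneg_of_nonpos (by positivity) ht), zero_div, norm_zero]
    positivity
  have hn' : (0 : ℝ) < n := by exact_mod_cast hn
  have ht' : (0 : ℝ) < t := by exact_mod_cast ht
  rw [norm_div, Complex.norm_natCast_cpow_of_pos hn, Real.rpow_sub hn', abs_of_pos ht',
    mul_div_assoc', div_le_div_iff_of_pos_right (Real.rpow_pos_of_pos hn' _)]
  refine (hC _ _ (by positivity)).trans_eq ?_
  push_cast
  rw [Real.mul_rpow (by positivity) ht'.le, ← Real.rpow_natCast, ← Real.rpow_mul hn'.le]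
  have : ((2 : ℕ) : ℝ) * (k / 2) = k := by push_cast; ring
  rw [this]; ring

section

variable (L)

/-- The quantity whose reciprocal powers give the linear term of `eulerDen`. -/
def eulerLin (k : ℝ) (Λ : ℂ) (p : ℕ) : ℂ :=
  Λ / (p : ℂ) ^ ((k : ℂ) - 1) -
    if Even L.rank then (1 - (p : ℂ)⁻¹) * (L.gaussSum 1 / L.gaussSum p) else 0

/-- The coefficient of the linear term of `eulerNum`. -/
def eulerNumLin (t : ℚ) (p : ℕ) : ℂ :=
  if Even L.rank then (if (p : ℤ) ∣ t.num then 0 else 1) * (L.gaussSum 1 / L.gaussSum p)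
  else -(L.chiD p * (ratLegendre (-t) p : ℂ) * (p : ℂ) ^ (-1 / 2 : ℂ))

theorem eulerDen_eq (p : ℕ) (k : ℝ) (Λ : ℕ → ℂ) (s : ℂ) : L.eulerDen k Λ p s =
    1 - L.eulerLin k (Λ p) p * (p : ℂ) ^ (k - 1 - s) + ((p : ℂ) ^ (k - 1 - s)) ^ 2 := by
  have h : (p : ℂ) ^ (2 * (k - 1 - s)) = ((p : ℂ) ^ (k - 1 - s)) ^ 2 := by
    rw [← Complex.cpow_nat_mul]; norm_num
  rw [eulerDen, eulerLin, h]
  split_ifs <;> simp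

theorem eulerNum_eq (k : ℝ) (t : ℚ) (p : ℕ) (s : ℂ) : L.eulerNum k t p s =
    1 + L.eulerNumLin t p * (p : ℂ) ^ (k - 1 - s) := by
  rw [eulerNum, eulerNumLin]
  split_ifs <;> ring

/-- The numerator measures how far the first step of the recurrence deviates from the later ones: it
is the middle sum at multiples of `p` minus the one at `t`. -/
theorem eulerNumLin_eq {p : ℕ} (hp : p ≠ 0) (t : ℚ) : L.eulerNumLin t p =
    ((if Even L.rank then (L.gaussSum 1 / L.gaussSum p) * ((p : ℂ) - 1) else 0) -
      L.midSum p t) / p := by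
  have hp0 : (p : ℂ) ≠ 0 := by exact_mod_cast hp
  have h : (p : ℂ) ^ (-1 / 2 : ℂ) = (p : ℂ) ^ (1 / 2 : ℂ) / p := by
    rw [eq_div_iff hp0]
    nth_rw 2 [← Complex.cpow_one (p : ℂ)]
    rw [← Complex.cpow_add _ _ hp0]; norm_num
  rw [eulerNumLin, midSum, h]
  split_ifs
  · simp
  · field_simp; ring
  · field_simp; ring

theorem eulerLin_eq {p : ℕ} (hp : p ≠ 0) (Λ : ℂ) : L.eulerLin k Λ p * (p : ℂ) ^ ((k : ℂ) - 1) =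
    Λ - (p : ℂ) ^ ((k : ℂ) - 2) *
      if Even L.rank then (L.gaussSum 1 / L.gaussSum p) * ((p : ℂ) - 1) else 0 := by
  have hp0 : (p : ℂ) ≠ 0 := by exact_mod_cast hp
  have h0 : (p : ℂ) ^ ((k : ℂ) - 1) ≠ 0 := by
    simp [Complex.cpow_eq_zero_iff, hp0]
  have h : (p : ℂ) ^ ((k : ℂ) - 2) = (p : ℂ) ^ ((k : ℂ) - 1) / p := by
    rw [eq_div_iff hp0]
    nth_rw 2 [← Complex.cpow_one (p : ℂ)]
    rw [← Complex.cpow_add _ _ hp0]; ring_nf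
  rw [eulerLin, h]
  split_ifs
  · field_simp
  · rw [sub_zero, mul_zero, sub_zero, div_mul_cancel₀ _ h0]

end

/-- The local factor of the series at a prime not dividing the level. -/
theorem IsCuspForm.tsum_natTerm_prime_pow (hf : L.IsCuspForm k f) (hf0 : f ≠ 0) (hk : 0 < k) {p : ℕ}
    (hp : p.Prime) (hpL : ¬ p ∣ L.level) {Λ : ℕ → ℂ} (hΛ : L.hecke k p f = Λ p • f) {μ : L.Disc}
    {t : ℚ} (ht : t ∈ L.qCoset μ)
    (ht_sq : ¬ ∃ m : ℤ, (L.level : ℚ) * t = (p : ℚ) ^ 2 * m) {s : ℂ} (hs : k + 1 < s.re)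
    {n : ℕ} (hn0 : n ≠ 0) (hn : ¬ p ∣ n) :
    L.eulerDen k Λ p s * ∑' j, natTerm f μ t s (p ^ j * n) =
      L.eulerNum k t p s * natTerm f μ t s n := by
  have hp0 : (p : ℂ) ≠ 0 := by exact_mod_cast hp.ne_zero
  have hinj : Function.Injective fun j => p ^ j * n := fun i j h =>
    Nat.pow_right_injective hp.two_le (Nat.eq_of_mul_eq_mul_right (Nat.pos_of_ne_zero hn0) h)
  have hsum : Summable fun j => natTerm f μ t s (p ^ j * n) :=
    (hf.summable_norm_natTerm hk μ t hs).of_norm.comp_injective hinj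
  have hmul : ∀ m : ℕ, ((p * m : ℕ) : ℂ) ^ s = (p : ℂ) ^ s * (m : ℂ) ^ s := fun m => by
    rw [Nat.cast_mul, Complex.natCast_mul_natCast_cpow]
  have hps : (p : ℂ) ^ s ≠ 0 := by simp [Complex.cpow_eq_zero_iff, hp0]
  have hX : (p : ℂ) ^ (k - 1 - s) = (p : ℂ) ^ ((k : ℂ) - 1) / (p : ℂ) ^ s :=
    Complex.cpow_sub _ _ hp0
  have hX2 : (p : ℂ) ^ (2 * (k : ℂ) - 2) = ((p : ℂ) ^ ((k : ℂ) - 1)) ^ 2 := by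
    rw [← Complex.cpow_nat_mul]; congr 1; push_cast; ring
  have hk2 : (p : ℂ) ^ ((k : ℂ) - 2) = (p : ℂ) ^ ((k : ℂ) - 1) / p := by
    rw [eq_div_iff hp0]
    nth_rw 2 [← Complex.cpow_one (p : ℂ)]
    rw [← Complex.cpow_add _ _ hp0]; ring_nf
  -- Here `α` is the coefficient of the first step and `β`, `γ` are those of all later steps; the
  -- numerator is `1 + (α - β)`.
  have key := tsum_of_linear_recurrence hsum
    (α := (Λ p - (p : ℂ) ^ ((k : ℂ) - 2) * L.midSum p t) / (p : ℂ) ^ s)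
    (β := L.eulerLin k (Λ p) p * (p : ℂ) ^ (k - 1 - s)) (γ := ((p : ℂ) ^ (k - 1 - s)) ^ 2)
    (by
      rw [pow_one, pow_zero, one_mul, natTerm, natTerm,
        hf.coeff_prime_mul hf0 hp hpL hΛ ht ht_sq hn, hmul]
      ring)
    (fun j => by
      have e1 : p ^ (j + 2) * n = p * (p * (p ^ j * n)) := by ring
      have e2 : p ^ (j + 1) * n = p * (p ^ j * n) := by ring
      rw [e1, e2, natTerm, natTerm, natTerm, hf.coeff_prime_sq_mul hf0 hp hpL hΛ ht, hmul, hmul,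
        ← eulerLin_eq L hp.ne_zero, hX, hX2]
      field_simp)
  rw [eulerDen_eq L, key, eulerNum_eq, eulerNumLin_eq L hp.ne_zero, pow_zero, one_mul]
  congr 2
  have h3 := eulerLin_eq L (k := k) hp.ne_zero (Λ p)
  rw [hX, mul_div_assoc', h3, hk2]
  field_simp
  ring

/-- The eigenvalue bound gives `p + 1`; the Gauss sum quotient is a sign and adds at most `1 - 1/p`.
-/
theorem IsCuspForm.norm_eulerLin_le (hf : L.IsCuspForm k f) (hf0 : f ≠ 0) {p : ℕ}
    (hp : p.Prime) (hpL : ¬ p ∣ L.level) {Λ : ℂ} (hΛ : L.hecke k p f = Λ • f) :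
    ‖L.eulerLin k Λ p‖ ≤ p + 2 - (p : ℝ)⁻¹ := by
  have hp0 : (0 : ℝ) < p := by exact_mod_cast hp.pos
  have hinv : (p : ℝ)⁻¹ ≤ 1 := inv_le_one_of_one_le₀ (by exact_mod_cast hp.one_le)
  have hnp : ‖(p : ℂ) ^ ((k : ℂ) - 1)‖ = (p : ℝ) ^ (k - 1) := by
    rw [Complex.norm_natCast_cpow_of_pos hp.pos]; simp
  have h1 : ‖Λ / (p : ℂ) ^ ((k : ℂ) - 1)‖ ≤ p + 1 := by
    have hpk : 0 < (p : ℝ) ^ (k - 1) := Real.rpow_pos_of_pos hp0 _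
    rw [norm_div, hnp, div_le_iff₀ hpk]
    refine (hf.norm_eigenvalue_le hf0 hp hpL hΛ).trans_eq ?_
    have : (p : ℝ) ^ k = p * (p : ℝ) ^ (k - 1) := by
      nth_rw 2 [← Real.rpow_one (p : ℝ)]
      rw [← Real.rpow_add hp0]; ring_nf
    rw [this]; ring
  refine (norm_sub_le _ _).trans ?_
  split_ifs with hr
  · obtain ⟨h2, h3⟩ := hf.gaussSum_quot hf0 ((even_rank_iff L).1 hr) hp hpL
    rw [norm_mul, h2, h3, mul_one]
    have h4 : (1 - (p : ℂ)⁻¹) = ((1 - (p : ℝ)⁻¹ : ℝ) : ℂ) := by push_cast; rfl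
    rw [h4, Complex.norm_real, Real.norm_of_nonneg (by linarith)]
    linarith
  · rw [norm_zero]; linarith

theorem IsCuspForm.norm_eulerNumLin_le (hf : L.IsCuspForm k f) (hf0 : f ≠ 0) {p : ℕ}
    (hp : p.Prime) (hpL : ¬ p ∣ L.level) {μ : L.Disc} {t : ℚ} (ht : t ∈ L.qCoset μ) :
    ‖L.eulerNumLin t p‖ ≤ 1 := by
  have hp0 : (0 : ℝ) < p := by exact_mod_cast hp.pos
  by_cases hr : Even L.rank
  · obtain ⟨h2, h3⟩ := hf.gaussSum_quot hf0 ((even_rank_iff L).1 hr) hp hpL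
    rw [eulerNumLin, if_pos hr, norm_mul, h2, h3, mul_one]
    split_ifs <;> simp
  · rw [eulerNumLin_eq L hp.ne_zero, if_neg hr, zero_sub, norm_div, norm_neg, Complex.norm_natCast,
      div_le_one hp0]
    -- For odd rank the trivial bound suffices: the middle sum consists of `p - 1` numbers of
    -- absolute value `1`.
    obtain ⟨b, ω, -, hω, h⟩ := hf.exists_mid hf0 hp hpL
    rw [← h μ t ht]
    have h1 : ∀ j ∈ Finset.Ico 1 p, ‖ω j * e (t * b j / p)‖ ≤ 1 := fun j hj => by
      have := norm_e_rat (t * b j / p)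
      push_cast at this
      rw [norm_mul, hω j hj, this, one_mul]
    refine (norm_sum_le_of_le _ h1).trans ?_
    rw [Finset.sum_const, Nat.card_Ico, nsmul_eq_mul, mul_one]
    exact_mod_cast Nat.sub_le p 1

theorem norm_cpow_le {p : ℕ} (hp : p.Prime) {s : ℂ} (hs : k + 1 < s.re) :
    ‖(p : ℂ) ^ (k - 1 - s)‖ ≤ ((p : ℝ) ^ 2)⁻¹ := by
  have hp1 : (1 : ℝ) ≤ p := by exact_mod_cast hp.one_le
  rw [Complex.norm_natCast_cpow_of_pos hp.pos, ← Real.rpow_natCast, ← Real.rpow_neg (by linarith)]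
  refine Real.rpow_le_rpow_of_exponent_le hp1 ?_
  simp; linarith

/-- As `|p^(k-1-s)| ≤ p^(-2)`, the terms after the leading `1` have total size at most `(p³ + 2p² -
p + 1)/p⁴`, which equals `15/16` at `p = 2` and is smaller for larger `p`. -/
theorem IsCuspForm.norm_eulerDen_ge (hf : L.IsCuspForm k f) (hf0 : f ≠ 0) {p : ℕ}
    (hp : p.Prime) (hpL : ¬ p ∣ L.level) {Λ : ℕ → ℂ} (hΛ : L.hecke k p f = Λ p • f) {s : ℂ}
    (hs : k + 1 < s.re) : 1 / 16 ≤ ‖L.eulerDen k Λ p s‖ := by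
  have hp2 : (2 : ℝ) ≤ p := by exact_mod_cast hp.two_le
  have hX := norm_cpow_le (k := k) hp hs
  have hl := hf.norm_eulerLin_le hf0 hp hpL hΛ
  rw [eulerDen_eq L]
  set X := (p : ℂ) ^ (k - 1 - s)
  set l := L.eulerLin k (Λ p) p
  have h1 : (1 : ℝ) ≤ ‖1 - l * X + X ^ 2‖ + ‖l‖ * ‖X‖ + ‖X‖ ^ 2 := by
    have h : (1 : ℂ) = (1 - l * X + X ^ 2) + l * X - X ^ 2 := by ring
    have h2 := norm_sub_le ((1 - l * X + X ^ 2) + l * X) (X ^ 2)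
    have h3 := norm_add_le (1 - l * X + X ^ 2) (l * X)
    rw [← h, norm_one, norm_pow] at h2
    rw [norm_mul] at h3
    linarith
  have h2 : ‖l‖ * ‖X‖ ≤ (p + 2 - (p : ℝ)⁻¹) * ((p : ℝ) ^ 2)⁻¹ :=
    mul_le_mul hl hX (norm_nonneg _) ((norm_nonneg _).trans hl)
  have h3 : ‖X‖ ^ 2 ≤ (((p : ℝ) ^ 2)⁻¹) ^ 2 := pow_le_pow_left₀ (norm_nonneg _) hX 2
  have h4 : (p + 2 - (p : ℝ)⁻¹) * ((p : ℝ) ^ 2)⁻¹ + (((p : ℝ) ^ 2)⁻¹) ^ 2 ≤ 15 / 16 := by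
    have e : (p + 2 - (p : ℝ)⁻¹) * ((p : ℝ) ^ 2)⁻¹ + (((p : ℝ) ^ 2)⁻¹) ^ 2 =
        ((p : ℝ) ^ 3 + 2 * p ^ 2 - p + 1) / p ^ 4 := by field_simp
    rw [e, div_le_div_iff₀ (by positivity) (by norm_num)]
    obtain ⟨h, hh⟩ : ∃ h : ℝ, (p : ℝ) = 2 + h := ⟨p - 2, by ring⟩
    have h0 : 0 ≤ h := by linarith
    rw [hh]
    nlinarith [pow_nonneg h0 2, pow_nonneg h0 3, pow_nonneg h0 4]
  linarith

theorem IsCuspForm.norm_eulerFactor_sub_one_le (hf : L.IsCuspForm k f) (hf0 : f ≠ 0) {p : ℕ}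
    (hp : p.Prime) (hpL : ¬ p ∣ L.level) {Λ : ℕ → ℂ} (hΛ : L.hecke k p f = Λ p • f)
    {μ : L.Disc} {t : ℚ} (ht : t ∈ L.qCoset μ) {s : ℂ} (hs : k + 1 < s.re) :
    ‖L.eulerFactor k Λ t p s - 1‖ ≤ 48 * (p : ℝ) ^ (k - s.re) := by
  have hp2 : (2 : ℝ) ≤ p := by exact_mod_cast hp.two_le
  have hd := hf.norm_eulerDen_ge hf0 hp hpL hΛ hs
  have hd0 : L.eulerDen k Λ p s ≠ 0 := fun h => by rw [h, norm_zero] at hd; norm_num at hd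
  have hX := norm_cpow_le (k := k) hp hs
  have hl := hf.norm_eulerLin_le hf0 hp hpL hΛ
  have hu := hf.norm_eulerNumLin_le hf0 hp hpL ht
  have h1 : L.eulerNum k t p s - L.eulerDen k Λ p s =
      (L.eulerNumLin t p + L.eulerLin k (Λ p) p - (p : ℂ) ^ (k - 1 - s)) * (p : ℂ) ^ (k - 1 - s) := by
    rw [eulerNum_eq, eulerDen_eq L]; ring
  have h2 : ‖(p : ℂ) ^ (k - 1 - s)‖ * p = (p : ℝ) ^ (k - s.re) := by
    rw [Complex.norm_natCast_cpow_of_pos hp.pos]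
    nth_rw 2 [← Real.rpow_one (p : ℝ)]
    rw [← Real.rpow_add (by linarith)]
    simp; ring_nf
  rw [eulerFactor, div_sub_one hd0, norm_div, div_le_iff₀ (by linarith), h1, norm_mul, ← h2]
  -- The bound `3p` for this coefficient, divided by the lower bound `1/16` of the denominator,
  -- gives the constant `48`.
  have h3 : ‖L.eulerNumLin t p + L.eulerLin k (Λ p) p - (p : ℂ) ^ (k - 1 - s)‖ ≤ 3 * p := by
    refine (norm_sub_le _ _).trans ((add_le_add (norm_add_le _ _) hX).trans ?_)
    have h4 : ((p : ℝ) ^ 2)⁻¹ ≤ 1 := inv_le_one_of_one_le₀ (by nlinarith)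
    have h5 : 0 ≤ (p : ℝ)⁻¹ := by positivity
    linarith
  set X := ‖(p : ℂ) ^ (k - 1 - s)‖
  have hX0 : 0 ≤ X := norm_nonneg _
  calc _ ≤ 3 * p * X := mul_le_mul_of_nonneg_right h3 hX0
    _ = 48 * (X * p) * (1 / 16) := by ring
    _ ≤ _ := mul_le_mul_of_nonneg_left hd (by positivity)

theorem IsCuspForm.eulerFactor_ne_zero (hf : L.IsCuspForm k f) (hf0 : f ≠ 0) {p : ℕ}
    (hp : p.Prime) (hpL : ¬ p ∣ L.level) {Λ : ℕ → ℂ} (hΛ : L.hecke k p f = Λ p • f)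
    {μ : L.Disc} {t : ℚ} (ht : t ∈ L.qCoset μ) {s : ℂ} (hs : k + 1 < s.re) :
    L.eulerFactor k Λ t p s ≠ 0 := by
  have hp2 : (2 : ℝ) ≤ p := by exact_mod_cast hp.two_le
  have hd := hf.norm_eulerDen_ge hf0 hp hpL hΛ hs
  refine div_ne_zero (fun h => ?_) fun h => by rw [h, norm_zero] at hd; norm_num at hd
  rw [eulerNum_eq] at h
  have h1 : ‖L.eulerNumLin t p * (p : ℂ) ^ (k - 1 - s)‖ = 1 := by
    rw [eq_neg_of_add_eq_zero_right h, norm_neg, norm_one]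
  have h2 : ‖L.eulerNumLin t p * (p : ℂ) ^ (k - 1 - s)‖ ≤ 1 * ((p : ℝ) ^ 2)⁻¹ := by
    rw [norm_mul]
    exact mul_le_mul (hf.norm_eulerNumLin_le hf0 hp hpL ht) (norm_cpow_le hp hs) (norm_nonneg _)
      zero_le_one
  rw [h1, one_mul] at h2
  have h3 : ((p : ℝ) ^ 2)⁻¹ < 1 := inv_lt_one_of_one_lt₀ (by nlinarith)
  linarith

end EvenLattice

theorem mainTheorem6 {V : Type*} [AddCommGroup V] [Module ℚ V] (L : EvenLattice V)
    (k : ℝ) (hk : 2 ≤ k) (hk_half : ∃ w : ℤ, k = w / 2)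
    (f : L.VVFun) (hf : L.IsCuspForm k f)
    (Λ : ℕ → ℂ) (hΛ : L.IsEigenform k f Λ)
    (μ : L.Disc) (t : ℚ) (ht : t ∈ L.qCoset μ)
    (ht_sq : ∀ p : ℕ, p.Prime → ¬ p ∣ L.level → ¬ ∃ m : ℤ, (L.level : ℚ) * t = (p : ℚ) ^ 2 * m)
    (s : ℂ) (hs : k + 1 < s.re) :
    Summable (fun n : ℕ+ => ‖L.LTerm f μ t s n‖) ∧
    (∀ p : L.GoodPrime, L.eulerDen k Λ p s ≠ 0) ∧
    Summable (fun p : L.GoodPrime => ‖L.eulerFactor k Λ t p s - 1‖) ∧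
    Multipliable (fun p : L.GoodPrime => L.eulerFactor k Λ t p s) ∧
    (∏' p : L.GoodPrime, L.eulerFactor k Λ t p s) ≠ 0 ∧
    L.LFun f μ t s = L.LLevel f μ t s * ∏' p : L.GoodPrime, L.eulerFactor k Λ t p s := by
  obtain ⟨hf0, hΛ⟩ := hΛ
  have hk0 : 0 < k := by linarith
  have hsum := hf.summable_norm_natTerm hk0 μ t hs
  have hden : ∀ p : ℕ, p.Prime ∧ ¬ p ∣ L.level → L.eulerDen k Λ p s ≠ 0 := fun p hp h => by
    have := hf.norm_eulerDen_ge hf0 hp.1 hp.2 (hΛ p hp.1 hp.2) hs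
    rw [h, norm_zero] at this
    norm_num at this
  have hfac : Summable (fun p : L.GoodPrime => ‖L.eulerFactor k Λ t p s - 1‖) := by
    have h1 : Summable fun p : L.GoodPrime => 48 * ((p : ℕ) : ℝ) ^ (k - s.re) :=
      ((Real.summable_nat_rpow.2 (by linarith)).comp_injective
        (i := fun p : L.GoodPrime => (p : ℕ)) Subtype.val_injective).mul_left 48
    exact h1.of_nonneg_of_le (fun _ => norm_nonneg _) fun p =>
      hf.norm_eulerFactor_sub_one_le hf0 p.2.1 p.2.2 (hΛ p p.2.1 p.2.2) ht hs
  have hadd : (fun p : L.GoodPrime => 1 + (L.eulerFactor k Λ t p s - 1)) =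
      fun p : L.GoodPrime => L.eulerFactor k Λ t p s := funext fun p => by ring
  have hmul : Multipliable (fun p : L.GoodPrime => L.eulerFactor k Λ t p s) :=
    hadd ▸ multipliable_one_add_of_summable hfac
  refine ⟨hsum.comp_injective (i := fun n : ℕ+ => (n : ℕ)) PNat.coe_injective,
    fun p => hden p p.2, hfac, hmul, ?_, ?_⟩
  · rw [← hadd]
    refine tprod_one_add_ne_zero_of_summable (fun p => ?_) hfac
    rw [add_sub_cancel]
    exact hf.eulerFactor_ne_zero hf0 p.2.1 p.2.2 (hΛ p p.2.1 p.2.2) ht hs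
  · have h := tsum_eq_tsum_mul_tprod hsum.of_norm (Q := fun p => L.eulerFactor k Λ t p s)
      (P := fun p => p.Prime ∧ ¬ p ∣ L.level) (fun p hp => hp.1) (fun p hp n hn0 hn => by
        have := hf.tsum_natTerm_prime_pow hf0 hk0 hp.1 hp.2 (hΛ p hp.1 hp.2) ht
          (ht_sq p hp.1 hp.2) hs hn0 hn
        rw [EvenLattice.eulerFactor, div_mul_eq_mul_div, eq_div_iff (hden p hp), mul_comm, this])
      hmul
    -- The combinatorial lemmas sum over all naturals, so `n = 0` is removed by an indicator.
    have h1 : L.LFun f μ t s =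
        ∑' n, Set.indicator {n | n ≠ 0} (EvenLattice.natTerm f μ t s) n := by
      rw [EvenLattice.LFun, ← PNat.coe_injective.tsum_eq]
      · exact tsum_congr fun n => (Set.indicator_of_mem (s := {n : ℕ | n ≠ 0}) n.ne_zero
          (EvenLattice.natTerm f μ t s)).symm
      · exact fun n hn => ⟨⟨n, Nat.pos_of_ne_zero (Set.mem_of_indicator_ne_zero hn)⟩, rfl⟩
    have h2 : L.LLevel f μ t s = ∑' n, Set.indicator
        {n | n ≠ 0 ∧ ∀ p : ℕ, p.Prime ∧ ¬ p ∣ L.level → ¬ p ∣ n} (EvenLattice.natTerm f μ t s) n := by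
      have hinj : Function.Injective
          fun n : {n : ℕ+ // ∃ m : ℕ, (n : ℕ) ∣ L.level ^ m} => ((n : ℕ+) : ℕ) :=
        PNat.coe_injective.comp Subtype.val_injective
      rw [EvenLattice.LLevel, ← hinj.tsum_eq]
      · refine tsum_congr fun n => ?_
        rw [Set.indicator_of_mem]
        · rfl
        · exact ⟨n.1.ne_zero, (Nat.exists_dvd_pow_iff_forall_prime n.1.ne_zero).1 n.2⟩
      · intro n hn
        have hn := Set.mem_of_indicator_ne_zero hn
        exact ⟨⟨⟨n, Nat.pos_of_ne_zero hn.1⟩,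
          (Nat.exists_dvd_pow_iff_forall_prime hn.1).2 hn.2⟩, rfl⟩
    rw [h1, h2, h]
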